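/- For $a\in\mathbf{Q}^*/{\mathbf{Q}^*}^2$, $a\neq 1$, let $\Delta(a)$ be the discriminant of the quadratic field $\mathbf{Q}(\sqrt a)$, and write $\Delta(a)=t_a\prod_{p\mid\Delta(a),\,p\text{ odd}}p^*$ with $p^*=(-1)^{(p-1)/2}p$ and $t_a\in\{1,-4,\pm8\}$. Let $a,b\in\mathbf{Q}^*/{\mathbf{Q}^*}^2$ be non-trivial elements (represented by rational numbers, again denoted $a,b$) such that $x^2-ay^2-bz^2=0$ has a non-zero rational solution. Put $K=\mathbf{Q}(\sqrt{ab})$ and $E=\mathbf{Q}(\sqrt a,\sqrt b)$. For a non-zero rational solution $(x,y,z)$ let $F=F(x,y,z)=E(\sqrt{\beta})$ with $\beta=x+y\sqrt a$, and for $t\in\mathbf{Q}^*$ let $F_t=F(tx,ty,tz)=E(\sqrt{t\beta})$ be its quadratic twist. The extension $K\subset F$ is called minimally ramified if 1. it is unramified over all odd primes $p\nmid\gcd(\Delta(a),\Delta(b))$; 2. it is unramified over $2$ if $\Delta(a)\Delta(b)$ is odd or one of $\Delta(a),\Delta(b)$ is $1\bmod 8$; 3. if $(\Delta(a),\Delta(b))\equiv(4,5)\bmod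 8$, the local extension $\mathbf{Q}_2(\sqrt a)\subset F\otimes\mathbf{Q}_2$ has conductor $(2)$, and if $(\Delta(a),\Delta(b))\equiv(5,4)\bmod 8$, the local extension $\mathbf{Q}_2(\sqrt b)\subset F\otimes\mathbf{Q}_2$ has conductor $(2)$. Let $T_{a,b}\subset\mathbf{Q}^*/{\mathbf{Q}^*}^2$ be the subgroup generated by the classes of $p^*$ for the odd primes $p\mid\Delta(a)\Delta(b)$, the classes of $t_a$ and $t_b$ and, in case $\Delta(a)$ and $\Delta(b)$ are both even, the classes of $-1$ and $2$. Then there exists a non-zero rational solution $(x,y,z)$ for which $K\subset F(x,y,z)$ is minimally ramified. Moreover, for every non-zero rational solution $(x,y,z)$ for which $K\subset F=F(x,y,z)$ is minimally ramified, and for every $t\in\mathbf{Q}^*$, the extension $K\subset F_t$ is minimally ramified if and only if the class of $t$ lies in $T_{a,b}$. -/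

import Mathlib

open scoped NumberField TensorProduct

namespace Redei

noncomputable section

/-- The group `ℚ* / ℚ*²` of square classes of rational numbers. -/
abbrev SqClass : Type := ℚˣ ⧸ (powMonoidHom 2 : ℚˣ →* ℚˣ).range

/-- A square root of `c` in `ℂ` (one of the two, fixed once and for all). -/
def rt (c : ℂ) : ℂ := (IsAlgClosed.exists_pow_nat_eq c (n := 2) two_pos).choose

theorem rt_sq (c : ℂ) : rt c ^ 2 = c :=
  (IsAlgClosed.exists_pow_nat_eq c (n := 2) two_pos).choose_spec

/-- The field `ℚ(√a)`. -/
def quadField (a : ℚ) : IntermediateField ℚ ℂ :=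
  IntermediateField.adjoin ℚ {rt (a : ℂ)}

instance (a : ℚ) : NumberField (quadField a) where
  to_charZero := inferInstance
  to_finiteDimensional := by
    have h : IsIntegral ℚ (rt (a : ℂ)) :=
      IsIntegral.of_pow two_pos (by rw [rt_sq]; exact isIntegral_algebraMap (x := a))
    exact IntermediateField.adjoin.finiteDimensional h

/-- `Δ(a)`: the discriminant of the field `ℚ(√a)`. -/
def disc (a : ℚ) : ℤ := NumberField.discr (quadField a)

/-- `(x, y, z)` is a non-zero rational solution of `x² - a y² - b z² = 0`. -/
def IsNonzeroSolution (a b x y z : ℚ) : Prop :=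
  (x, y, z) ≠ (0, 0, 0) ∧ x ^ 2 - a * y ^ 2 - b * z ^ 2 = 0

/-- The field `F = F(x, y, z) = E(√β)`, where `E = ℚ(√a, √b)` and `β = x + y√a`. It does not
involve `z`; its quadratic twist by `t` is `F(tx, ty, tz) = E(√(tβ))`. -/
def fieldF (a b x y : ℚ) : IntermediateField ℚ ℂ :=
  IntermediateField.adjoin ℚ
    {rt (a : ℂ), rt (b : ℂ), rt ((x : ℂ) + (y : ℂ) * rt (a : ℂ))}

theorem quadField_left_le (a b x y : ℚ) : quadField a ≤ fieldF a b x y :=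
  IntermediateField.adjoin.mono _ _ _ (by simp)

theorem quadField_right_le (a b x y : ℚ) : quadField b ≤ fieldF a b x y :=
  IntermediateField.adjoin.mono _ _ _ (by simp)

theorem quadField_mul_le (a b x y : ℚ) : quadField (a * b) ≤ fieldF a b x y := by
  have ha : rt (a : ℂ) ∈ fieldF a b x y := IntermediateField.subset_adjoin _ _ (by simp)
  have hb : rt (b : ℂ) ∈ fieldF a b x y := IntermediateField.subset_adjoin _ _ (by simp)
  have h : rt ((a * b : ℚ) : ℂ) ^ 2 = (rt (a : ℂ) * rt (b : ℂ)) ^ 2 := by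
    rw [mul_pow, rt_sq, rt_sq, rt_sq]; push_cast; rfl
  refine IntermediateField.adjoin_le_iff.2 (Set.singleton_subset_iff.2 ?_)
  rcases sq_eq_sq_iff_eq_or_eq_neg.1 h with h | h <;> rw [h]
  · exact mul_mem ha hb
  · exact neg_mem (mul_mem ha hb)

/-- The extension of number fields `F / k` is unramified over the rational prime `p`: every prime
of `F` that lies over `p` is unramified over `k`. -/
def UnramifiedOver (k F : Type) [Field k] [Field F] [Algebra k F] (p : ℕ) : Prop :=
  ∀ (P : Ideal (𝓞 F)) [P.IsPrime], (p : 𝓞 F) ∈ P → Algebra.IsUnramifiedAt (𝓞 k) P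

/-- For a local field `R` over `ℚ_p` and a finite abelian extension `S / R`, `𝔣` is the conductor
of `S / R`: the largest ideal of the ring of integers of `R` such that all units congruent to `1`
modulo that ideal are norms from `S`. With `𝔭` the maximal ideal this is `𝔭 ^ n` for the smallest
`n ≥ 0` such that the `n`-th unit group (of all units if `n = 0`, and `1 + 𝔭 ^ n` otherwise)
consists of norms. -/
def IsLocalConductor (p : ℕ) [Fact p.Prime] (R S : Type) [CommRing R] [Algebra ℤ_[p] R]
    [CommRing S] [Algebra R S] (𝔣 : Ideal (integralClosure ℤ_[p] R)) : Prop :=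
  IsGreatest {𝔤 : Ideal (integralClosure ℤ_[p] R) |
    ∀ u : (integralClosure ℤ_[p] R)ˣ, (u : integralClosure ℤ_[p] R) - 1 ∈ 𝔤 →
      ∃ w : S, Algebra.norm R w = ((u : integralClosure ℤ_[p] R) : R)} 𝔣

/-- The map `k ⊗ ℚ_p → F ⊗ ℚ_p` induced by a field extension `F / k`. -/
def localMap (p : ℕ) [Fact p.Prime] (k F : Type) [Field k] [CharZero k] [Field F] [CharZero F]
    [Algebra k F] : ℚ_[p] ⊗[ℚ] k →ₐ[ℚ_[p]] ℚ_[p] ⊗[ℚ] F :=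
  Algebra.TensorProduct.map (AlgHom.id ℚ_[p] ℚ_[p]) (algebraMap k F).toRatAlgHom

/-- The local extension `k ⊗ ℚ_2 ⊂ F ⊗ ℚ_2` is of conductor `2`. -/
def LocalConductorTwo (k F : Type) [Field k] [CharZero k] [Field F] [CharZero F]
    [Algebra k F] : Prop :=
  letI : Algebra (ℚ_[2] ⊗[ℚ] k) (ℚ_[2] ⊗[ℚ] F) := (localMap 2 k F : _ →+* _).toAlgebra
  IsLocalConductor 2 (ℚ_[2] ⊗[ℚ] k) (ℚ_[2] ⊗[ℚ] F) (Ideal.span {2})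

/-- The extension `ℚ(√(ab)) = K ⊂ F = F(x, y, z)` is minimally ramified. (Condition 3 refers to
`ℚ_2(√a)` if `Δ(a) ≡ 4` and `Δ(b) ≡ 5` modulo `8`, and to `ℚ_2(√b)` if the roles are reversed.) -/
structure MinimallyRamified (a b x y : ℚ) : Prop where
  odd : ∀ p : ℕ, p.Prime → p ≠ 2 → ¬ p ∣ Int.gcd (disc a) (disc b) →
    UnramifiedOver (quadField (a * b))
      (IntermediateField.extendScalars (quadField_mul_le a b x y)) p
  two : Odd (disc a * disc b) ∨ disc a ≡ 1 [ZMOD 8] ∨ disc b ≡ 1 [ZMOD 8] →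
    UnramifiedOver (quadField (a * b))
      (IntermediateField.extendScalars (quadField_mul_le a b x y)) 2
  two_left : disc a ≡ 4 [ZMOD 8] → disc b ≡ 5 [ZMOD 8] →
    LocalConductorTwo (quadField a)
      (IntermediateField.extendScalars (quadField_left_le a b x y))
  two_right : disc a ≡ 5 [ZMOD 8] → disc b ≡ 4 [ZMOD 8] →
    LocalConductorTwo (quadField b)
      (IntermediateField.extendScalars (quadField_right_le a b x y))

/-- The signed prime `p* = (-1)^((p-1)/2) p ≡ 1 mod 4`, for an odd prime `p`. -/
def signedPrime (p : ℕ) : ℤ := (-1) ^ ((p - 1) / 2) * p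

/-- The 2-part `t_D` in the factorization `D = t_D ∏ p*` of a discriminant `D`, the product
ranging over the odd primes `p ∣ D`. The division is exact. -/
def twoPart (D : ℤ) : ℤ := D / ∏ p ∈ D.natAbs.primeFactors.erase 2, signedPrime p

/-- The twisting subgroup `T_{a,b}` of `ℚ* / ℚ*²`, generated by the classes of the `p*` for odd
primes `p` dividing `Δ(a) Δ(b)` (for squarefree integers `a, b`: the odd primes dividing `ab`),
of the 2-parts of `Δ(a)` and `Δ(b)`, and of `-1` and `2` if `Δ(a)` and `Δ(b)` are both even. -/
def twistingSubgroup (a b : ℚ) : Subgroup SqClass :=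
  Subgroup.closure {c : SqClass | ∃ u : ℚˣ, c = (u : SqClass) ∧
    ((∃ p : ℕ, p.Prime ∧ p ≠ 2 ∧ (p : ℤ) ∣ disc a * disc b ∧ (u : ℚ) = signedPrime p) ∨
      (u : ℚ) = twoPart (disc a) ∨ (u : ℚ) = twoPart (disc b) ∨
      (Even (disc a) ∧ Even (disc b) ∧ ((u : ℚ) = -1 ∨ (u : ℚ) = 2)))}

end

end Redei

/-! ### Square roots and the absolute value on the algebraic closure of ℚ_p. -/

namespace Redei

noncomputable section

/-! Write a = m r² and b = n s² with m, n squarefree integers. The group of F over K is cyclic of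
order 4, and σ : √β ↦ -√β is its only involution, so a prime of F ramifies over K exactly when σ
lies in its inertia group. Hence F/K is unramified over p if and only if L(√β)/L is unramified for L
= ℚ_p(√m, √n), that is, if β is up to squares of L a unit congruent to a square modulo 4
(`UnrClass`, `IsRedeiField.unramifiedOver_iff`). Such classes are closed under products, so once β
is good at p, the twist tβ is good if and only if t is.

Odd p. If p divides exactly one of m and n, then β is always good, because L contains an element of
valuation 1/2. If p divides neither, then all valuations in L are integral, β is good when its
valuation is even, and a twist by p repairs an odd one (`unrClass_or`). Only finitely many primes
need a repair.

The prime 2, where F has to be unramified. Every class of ℚ₂* is ±1 or ±2 times that of a unit ≡ 1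
mod 4, which is good. Since the norm of β is bz², Hilbert 90 makes β rational up to squares and a
good factor, so one of these four twists repairs it (`exists_sign_unrClass_add`).

The prime 2, where the conductor has to be (2). Let m ≡ 3 mod 4 and n ≡ 5 mod 8, and let 𝔭 be the
prime of ℚ₂(√m), so that 𝔭² = (2). The conductor is (2) exactly when β is ≡ 1 mod 𝔭³ up to squares
(`CondTwoClass`, `isLocalConductor_iff`). Because the norm of β is n times a square, exactly one of
β and 2β has this property (`HasNormClass.condTwoClass_or`, `not_condTwoClass_two`). The case with a
and b interchanged follows from F = E(√(2x + 2z√b)) (`fieldF_swap`).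

Twists. For minimally ramified F the twist F_t is minimally ramified if and only if t satisfies the
local conditions `IsAdmissible`. The generators of T do. Conversely, parity at the odd primes writes
an admissible t, up to squares, as a sign factor in {±1, ±2} times a product of p* with p ∣ mn; the
analysis at 2 shows that the sign factor lies in T as well (`inTwistingSubgroup_sign`). -/

theorem exists_algEquiv_neg {k Ω : Type*} [Field k] [Field Ω] [Algebra k Ω] [CharZero k]
    [Normal k Ω] {A : Ω} {c : k} (hA : A ^ 2 = algebraMap k Ω c)
    (hn : ∀ u : k, algebraMap k Ω u ≠ A) : ∃ σ : Ω ≃ₐ[k] Ω, σ A = -A := by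
  have hint : IsIntegral k A := Algebra.IsIntegral.isIntegral A
  have hn' : A ∉ (⊥ : Subalgebra k Ω) := by
    rw [Algebra.mem_bot]; rintro ⟨u, hu⟩; exact hn u hu
  obtain ⟨y, hy, hc⟩ := (notMem_iff_exists_ne_and_isConjRoot
    (Irreducible.separable (minpoly.irreducible hint)) (Normal.splits inferInstance A)).1 hn'
  obtain ⟨σ, hσ⟩ := isConjRoot_iff_exists_algEquiv.1 hc.symm
  refine ⟨σ, ?_⟩
  have h2 : y ^ 2 = A ^ 2 := by rw [← hσ, ← map_pow, hA, AlgEquiv.commutes]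
  rcases sq_eq_sq_iff_eq_or_eq_neg.1 h2 with h | h
  · exact absurd h hy.symm
  · rw [hσ, h]

theorem mem_adjoin_insert_sqrt {k Ω : Type*} [CommRing k] [CommRing Ω] [Algebra k Ω]
    {S : Set Ω} {g : Ω} (hg : g ^ 2 ∈ Algebra.adjoin k S) {w : Ω}
    (hw : w ∈ Algebra.adjoin k (insert g S)) :
    ∃ u ∈ Algebra.adjoin k S, ∃ v ∈ Algebra.adjoin k S, w = u + v * g := by
  induction hw using Algebra.adjoin_induction with
  | mem x hx =>
    rcases hx with rfl | hx
    · exact ⟨0, zero_mem _, 1, one_mem _, by ring⟩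
    · exact ⟨x, Algebra.subset_adjoin hx, 0, zero_mem _, by ring⟩
  | algebraMap r => exact ⟨_, Subalgebra.algebraMap_mem _ r, 0, zero_mem _, by ring⟩
  | add x y _ _ hx hy =>
    obtain ⟨u, hu, v, hv, rfl⟩ := hx
    obtain ⟨u', hu', v', hv', rfl⟩ := hy
    exact ⟨u + u', add_mem hu hu', v + v', add_mem hv hv', by ring⟩
  | mul x y _ _ hx hy =>
    obtain ⟨u, hu, v, hv, rfl⟩ := hx
    obtain ⟨u', hu', v', hv', rfl⟩ := hy
    exact ⟨u * u' + v * v' * g ^ 2, add_mem (mul_mem hu hu') (mul_mem (mul_mem hv hv') hg),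
      u * v' + v * u', add_mem (mul_mem hu hv') (mul_mem hv hu'), by ring⟩

theorem mem_adjoin_singleton_sqrt {k Ω : Type*} [CommRing k] [CommRing Ω] [Algebra k Ω]
    {g : Ω} {c : k} (hg : g ^ 2 = algebraMap k Ω c) {w : Ω}
    (hw : w ∈ Algebra.adjoin k {g}) :
    ∃ u v : k, w = algebraMap k Ω u + algebraMap k Ω v * g := by
  have h := mem_adjoin_insert_sqrt (k := k) (S := (∅ : Set Ω)) (g := g) (w := w)
    (by rw [hg]; exact Subalgebra.algebraMap_mem _ _) (by simpa using hw)
  simp only [Algebra.adjoin_empty, Algebra.mem_bot] at h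
  obtain ⟨_, ⟨u, rfl⟩, _, ⟨v, rfl⟩, h⟩ := h
  exact ⟨u, v, h⟩

variable {p : ℕ} [Fact p.Prime]

/-- The absolute value of the algebraic closure is the spectral norm, which automorphisms preserve.
Valuations in quadratic extensions are computed below from this fact alone. -/
theorem norm_conj {L : IntermediateField ℚ_[p] (PadicAlgCl p)} {A : PadicAlgCl p}
    (hA : A ∉ L) (hA2 : A ^ 2 ∈ L) {u v : PadicAlgCl p} (hu : u ∈ L) (hv : v ∈ L) :
    ‖u - v * A‖ = ‖u + v * A‖ := by
  obtain ⟨σ, hσ⟩ := exists_algEquiv_neg (k := L) (A := A) (c := ⟨A ^ 2, hA2⟩) rfl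
    (fun u h => hA (h ▸ u.2))
  have h := spectralNorm_eq_of_equiv (σ.restrictScalars ℚ_[p]) (u + v * A)
  rw [PadicAlgCl.spectralNorm_eq, PadicAlgCl.spectralNorm_eq] at h
  rw [h]
  have h1 : σ u = u := σ.commutes ⟨u, hu⟩
  have h2 : σ v = v := σ.commutes ⟨v, hv⟩
  congr 1
  simp [h1, h2, hσ, sub_eq_add_neg]

theorem norm_add_le_max (x y : PadicAlgCl p) : ‖x + y‖ ≤ max ‖x‖ ‖y‖ :=
  PadicAlgCl.isNonarchimedean p x y

theorem norm_sub_le_max (x y : PadicAlgCl p) : ‖x - y‖ ≤ max ‖x‖ ‖y‖ := by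
  simpa [sub_eq_add_neg] using norm_add_le_max x (-y)

/-- Krasner's lemma for square roots: if A were not in L, then c + A and c - A would have equal
size, hence size at least |2c|, as their sum is 2c. But their product is small. -/
theorem mem_of_norm_sq_sub_lt {L : IntermediateField ℚ_[p] (PadicAlgCl p)} {A c : PadicAlgCl p}
    (hA2 : A ^ 2 ∈ L) (hc : c ∈ L) (h : ‖A ^ 2 - c ^ 2‖ < ‖2 * c‖ ^ 2) : A ∈ L := by
  by_contra hA
  have h1 := norm_conj hA hA2 hc (one_mem L)
  rw [one_mul] at h1
  have h2 : ‖A ^ 2 - c ^ 2‖ = ‖c + A‖ ^ 2 := by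
    rw [show A ^ 2 - c ^ 2 = -((c + A) * (c - A)) by ring, norm_neg, norm_mul, h1, sq]
  have h3 : ‖2 * c‖ ≤ ‖c + A‖ := by
    have := norm_add_le_max (c + A) (c - A)
    rw [h1, max_self] at this
    rwa [show 2 * c = (c + A) + (c - A) by ring]
  rw [h2] at h
  exact absurd h (not_lt.2 (by gcongr))

theorem exists_sqrt_of_norm_sub_one_lt {L : IntermediateField ℚ_[p] (PadicAlgCl p)}
    {D : PadicAlgCl p} (hD : D ∈ L) (h : ‖D - 1‖ < ‖(4 : PadicAlgCl p)‖) : ∃ d ∈ L, d ^ 2 = D := by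
  obtain ⟨d, hd⟩ := IsAlgClosed.exists_pow_nat_eq D (n := 2) two_pos
  refine ⟨d, mem_of_norm_sq_sub_lt (c := 1) (hd ▸ hD) (one_mem L) ?_, hd⟩
  rw [hd, one_pow, mul_one, ← norm_pow]
  norm_num
  exact h

theorem adjoin_toSubalgebra_eq (S : Set (PadicAlgCl p)) :
    (IntermediateField.adjoin ℚ_[p] S).toSubalgebra = Algebra.adjoin ℚ_[p] S :=
  IntermediateField.adjoin_toSubalgebra S

/-- The class of `β` defines an unramified extension `L(√β)` of `L`. -/
def UnrClass (L : IntermediateField ℚ_[p] (PadicAlgCl p)) (β : PadicAlgCl p) : Prop :=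
  ∃ w ∈ L, ∃ s ∈ L, ‖w ^ 2 * β‖ = 1 ∧ ‖s‖ ≤ 1 ∧ ‖w ^ 2 * β - s ^ 2‖ ≤ ‖(4 : PadicAlgCl p)‖

end

end Redei

/-! ### The Galois group of F over K. -/

namespace Redei

noncomputable section

/-- `F = ℚ(√a, √b, √(x + y√a))`, with square roots `α`, `δ`, `γ`, is an extension of
`K = ℚ(√(ab))`, where `(x, y, z)` is a non-zero solution of `x² - a y² - b z² = 0` and neither
`a` nor `b` is a square. -/
structure IsRedeiField (a b x y z : ℚ) (K F : Type*) [Field K] [Field F] [NumberField F]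
    [Algebra K F] (α δ γ : F) : Prop where
  sq_left : α ^ 2 = algebraMap ℚ F a
  sq_right : δ ^ 2 = algebraMap ℚ F b
  sq_top : γ ^ 2 = algebraMap ℚ F x + algebraMap ℚ F y * α
  eqn : x ^ 2 - a * y ^ 2 = b * z ^ 2
  not_sq_left : ¬ IsSquare a
  not_sq_right : ¬ IsSquare b
  z_ne : z ≠ 0
  gen : Algebra.adjoin ℚ {γ, α, δ} = (⊤ : Subalgebra ℚ F)
  mem_base : ∃ κ : K, algebraMap K F κ = α * δ
  base : ∀ k : K, ∃ c₀ c₁ : ℚ, algebraMap K F k = algebraMap ℚ F c₀ + algebraMap ℚ F c₁ * (α * δ)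

namespace IsRedeiField

variable {a b x y z : ℚ} {K F : Type*} [Field K] [Field F] [NumberField F]
    [Algebra K F] {α δ γ : F} (h : IsRedeiField a b x y z K F α δ γ)

include h

theorem a_ne : a ≠ 0 := fun h0 => h.not_sq_left (h0 ▸ IsSquare.zero)

theorem b_ne : b ≠ 0 := fun h0 => h.not_sq_right (h0 ▸ IsSquare.zero)

theorem left_ne : α ≠ 0 := by
  rintro rfl
  have := h.sq_left
  rw [zero_pow two_ne_zero, eq_comm, map_eq_zero] at this
  exact h.a_ne this

theorem right_ne : δ ≠ 0 := by
  rintro rfl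
  have := h.sq_right
  rw [zero_pow two_ne_zero, eq_comm, map_eq_zero] at this
  exact h.b_ne this

/-- The product of β with its conjugate is bz² = (zδ)². So zδ/γ is a square root of the conjugate,
which makes F normal over ℚ. -/
theorem top_mul_conj : γ ^ 2 * (algebraMap ℚ F x - algebraMap ℚ F y * α)
    = (algebraMap ℚ F z * δ) ^ 2 := by
  rw [h.sq_top, mul_pow, h.sq_right, mul_comm (algebraMap ℚ F z ^ 2), ← map_pow, ← map_mul, ← h.eqn,
    map_sub, map_mul, ← h.sq_left, map_pow, map_pow]
  ring

theorem map_z_ne : algebraMap ℚ F z ≠ 0 := by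
  rw [ne_eq, map_eq_zero]; exact h.z_ne

theorem top_ne : γ ≠ 0 := by
  rintro rfl
  have := h.top_mul_conj
  rw [zero_pow two_ne_zero, zero_mul, eq_comm, pow_eq_zero_iff two_ne_zero, mul_eq_zero] at this
  exact this.elim h.map_z_ne h.right_ne

theorem conj_sq : (algebraMap ℚ F z * δ / γ) ^ 2 = algebraMap ℚ F x - algebraMap ℚ F y * α := by
  rw [div_pow, ← h.top_mul_conj]
  field_simp [h.top_ne]

theorem isGalois_rat : IsGalois ℚ F := by
  have hn : Normal ℚ F := by
    rw [normal_iff]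
    intro w
    refine ⟨Algebra.IsIntegral.isIntegral w, ?_⟩
    have hS : ∀ g ∈ ({γ, α, δ} : Set F), IsIntegral ℚ g ∧
        ((minpoly ℚ g).map (algebraMap ℚ F)).Splits := by
      have key : ∀ (g : F) (c : ℚ), g ^ 2 = algebraMap ℚ F c →
          ((minpoly ℚ g).map (algebraMap ℚ F)).Splits := by
        intro g c hg
        have hd : minpoly ℚ g ∣ Polynomial.X ^ 2 - Polynomial.C c :=
          minpoly.dvd _ _ (by simp [hg])
        refine Polynomial.Splits.of_dvd ?_ ?_ (Polynomial.map_dvd (algebraMap ℚ F) hd)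
        · have : (Polynomial.X ^ 2 - Polynomial.C c).map (algebraMap ℚ F)
              = (Polynomial.X - Polynomial.C g) * (Polynomial.X - Polynomial.C (-g)) := by
            simp only [Polynomial.map_sub, Polynomial.map_pow, Polynomial.map_X, Polynomial.map_C,
              ← hg, map_pow, map_neg]
            ring
          rw [this]
          exact (Polynomial.Splits.X_sub_C _).mul (Polynomial.Splits.X_sub_C _)
        · exact (Polynomial.map_ne_zero_iff (algebraMap ℚ F).injective).2
            (Polynomial.X_pow_sub_C_ne_zero two_pos c)
      intro g hg
      refine ⟨Algebra.IsIntegral.isIntegral g, ?_⟩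
      rcases hg with rfl | rfl | rfl
      -- The four roots of this polynomial are ±γ and ±zδ/γ.
      · set q : Polynomial ℚ := (Polynomial.X ^ 2 - Polynomial.C x) ^ 2
          - Polynomial.C (a * y ^ 2) with hq
        set g' := algebraMap ℚ F z * δ / g with hg'
        have hg'2 : g' ^ 2 = _ := h.conj_sq
        have hmap : q.map (algebraMap ℚ F)
            = (Polynomial.X - Polynomial.C g) * (Polynomial.X - Polynomial.C (-g)) *
              ((Polynomial.X - Polynomial.C g') * (Polynomial.X - Polynomial.C (-g'))) := by
          have e1 : (Polynomial.X - Polynomial.C g) * (Polynomial.X - Polynomial.C (-g))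
              = Polynomial.X ^ 2 - Polynomial.C (g ^ 2) := by
            simp only [map_neg, map_pow]; ring
          have e2 : (Polynomial.X - Polynomial.C g') * (Polynomial.X - Polynomial.C (-g'))
              = Polynomial.X ^ 2 - Polynomial.C (g' ^ 2) := by
            simp only [map_neg, map_pow]; ring
          have e3 : algebraMap ℚ F (a * y ^ 2) = (algebraMap ℚ F y * α) ^ 2 := by
            rw [map_mul, ← h.sq_left, map_pow]; ring
          rw [e1, e2, hg'2, h.sq_top, hq, Polynomial.map_sub, Polynomial.map_C, e3]
          simp only [Polynomial.map_sub, Polynomial.map_pow, Polynomial.map_X, Polynomial.map_C,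
            map_mul, map_add, map_sub, map_pow]
          ring
        have hq0 : q.map (algebraMap ℚ F) ≠ 0 := by
          rw [hmap]
          exact mul_ne_zero (mul_ne_zero (Polynomial.X_sub_C_ne_zero _)
            (Polynomial.X_sub_C_ne_zero _)) (mul_ne_zero (Polynomial.X_sub_C_ne_zero _)
            (Polynomial.X_sub_C_ne_zero _))
        refine Polynomial.Splits.of_dvd ?_ hq0 (Polynomial.map_dvd (algebraMap ℚ F)
          (minpoly.dvd ℚ g (p := q) ?_))
        · rw [hmap]
          exact ((Polynomial.Splits.X_sub_C _).mul (Polynomial.Splits.X_sub_C _)).mul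
            ((Polynomial.Splits.X_sub_C _).mul (Polynomial.Splits.X_sub_C _))
        · rw [Polynomial.aeval_def, ← Polynomial.eval_map, hmap]
          simp
      · exact key _ _ h.sq_left
      · exact key _ _ h.sq_right
    refine IntermediateField.splits_of_mem_adjoin ℚ F hS (x := w) ?_
    have : Algebra.adjoin ℚ {γ, α, δ} ≤ (IntermediateField.adjoin ℚ {γ, α, δ}).toSubalgebra :=
      Algebra.adjoin_le (IntermediateField.subset_adjoin ℚ _)
    exact this (h.gen ▸ Algebra.mem_top)
  exact isGalois_iff.2 ⟨inferInstance, hn⟩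

/-- Squaring α = c₀ + c₁αδ shows that α or δ would be rational. The irrationality of αδ is not
needed, so the case K = ℚ, where ab is a square, is included. -/
theorem left_not_base (k : K) : algebraMap K F k ≠ α := by
  intro hk
  obtain ⟨c₀, c₁, hc⟩ := h.base k
  rw [hk] at hc
  have inj := (algebraMap ℚ F).injective
  have hrat : ∀ c : ℚ, algebraMap ℚ F c ≠ α := by
    intro c hc
    apply h.not_sq_left
    refine ⟨c, inj ?_⟩
    rw [map_mul, hc, ← sq, h.sq_left]
  have hsq : algebraMap ℚ F (a - c₀ ^ 2 - c₁ ^ 2 * (a * b)) =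
      algebraMap ℚ F (2 * c₀ * c₁) * (α * δ) := by
    have h1 : α ^ 2 = (algebraMap ℚ F c₀ + algebraMap ℚ F c₁ * (α * δ)) ^ 2 := by rw [← hc]
    simp only [map_sub, map_mul, map_pow, ← h.sq_left, ← h.sq_right, map_ofNat]
    linear_combination h1
  by_cases hcc : 2 * c₀ * c₁ = 0
  · rcases mul_eq_zero.1 hcc with h0 | h0
    · have h0 : c₀ = 0 := by simpa using h0
      rw [h0, map_zero, zero_add] at hc
      have h1 : (algebraMap ℚ F c₁ * δ) = 1 := by
        apply mul_right_cancel₀ h.left_ne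
        rw [one_mul]
        linear_combination -hc
      apply h.not_sq_right
      refine ⟨c₁⁻¹, inj ?_⟩
      have hc1 : algebraMap ℚ F c₁ ≠ 0 := left_ne_zero_of_mul_eq_one h1
      rw [map_mul, map_inv₀, ← h.sq_right]
      have : δ = (algebraMap ℚ F c₁)⁻¹ := eq_inv_of_mul_eq_one_right h1
      rw [← this, sq]
    · rw [h0, map_zero, zero_mul, add_zero] at hc
      exact hrat _ hc.symm
  · have h2 : algebraMap ℚ F (2 * c₀ * c₁) ≠ 0 := by rwa [ne_eq, map_eq_zero]
    apply hrat (c₀ + c₁ * ((a - c₀ ^ 2 - c₁ ^ 2 * (a * b)) / (2 * c₀ * c₁)))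
    have h3 : α * δ = algebraMap ℚ F ((a - c₀ ^ 2 - c₁ ^ 2 * (a * b)) / (2 * c₀ * c₁)) := by
      rw [map_div₀, eq_div_iff h2, hsq]; ring
    rw [h3] at hc
    rw [hc, map_add, map_mul]

theorem isGalois_base [NumberField K] : IsGalois K F :=
  have := h.isGalois_rat
  IsGalois.tower_top_of_isGalois ℚ K F

theorem algEquiv_ext {σ τ : F ≃ₐ[K] F} (h1 : σ α = τ α) (h2 : σ γ = τ γ) : σ = τ := by
  obtain ⟨κ, hκ⟩ := h.mem_base
  have h3 : σ δ = τ δ := by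
    have : σ (α * δ) = τ (α * δ) := by rw [← hκ, AlgEquiv.commutes, AlgEquiv.commutes]
    rw [map_mul, map_mul, h1] at this
    exact mul_left_cancel₀ ((map_ne_zero τ).2 h.left_ne) this
  ext w
  have hw : w ∈ Algebra.adjoin ℚ {γ, α, δ} := h.gen ▸ Algebra.mem_top
  induction hw using Algebra.adjoin_induction with
  | mem x hx => rcases hx with rfl | rfl | rfl <;> assumption
  | algebraMap r =>
    rw [show algebraMap ℚ F r = (r : F) from (eq_ratCast (algebraMap ℚ F) r)]
    simp
  | add x y _ _ hx hy => rw [map_add, map_add, hx, hy]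
  | mul x y _ _ hx hy => rw [map_mul, map_mul, hx, hy]

/-- Fixing αδ, τ negates δ and sends γ to ±zδ/γ; a second application gives -γ for either sign. So τ
has order 4. -/
theorem apply_apply_top {τ : F ≃ₐ[K] F} (hτ : τ α = -α) : τ (τ γ) = -γ := by
  obtain ⟨κ, hκ⟩ := h.mem_base
  have hδ : τ δ = -δ := by
    have : τ (α * δ) = α * δ := by rw [← hκ, AlgEquiv.commutes]
    rw [map_mul, hτ] at this
    apply mul_left_cancel₀ h.left_ne
    linear_combination -this
  have hQ : ∀ c : ℚ, τ (algebraMap ℚ F c) = algebraMap ℚ F c := by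
    intro r
    rw [show algebraMap ℚ F r = (r : F) from (eq_ratCast (algebraMap ℚ F) r)]
    simp
  have hsq : (τ γ) ^ 2 = (algebraMap ℚ F z * δ / γ) ^ 2 := by
    rw [h.conj_sq, ← map_pow, h.sq_top, map_add, map_mul, hQ, hQ, hτ]; ring
  have hγ := h.top_ne
  have hδ0 := h.right_ne
  have hz := h.map_z_ne
  rcases sq_eq_sq_iff_eq_or_eq_neg.1 hsq with h1 | h1
  · rw [h1, map_div₀, map_mul, hQ, hδ, h1]
    field_simp
  · rw [h1, map_neg, map_div₀, map_mul, hQ, hδ, h1]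
    field_simp

/-- An automorphism fixing α sends γ to ±γ, and one negating α squares to σ. The last clause says
that every non-trivial subgroup contains σ, which is how it is used for inertia groups. -/
theorem exists_algEquiv [NumberField K] : ∃ σ : F ≃ₐ[K] F, σ α = α ∧ σ δ = δ ∧ σ γ = -γ ∧
    ∀ ρ : F ≃ₐ[K] F, ρ ≠ 1 → ρ = σ ∨ ρ ^ 2 = σ := by
  have := h.isGalois_base
  have hα2 : α ^ 2 = algebraMap K F (algebraMap ℚ K a) := by
    rw [h.sq_left, ← IsScalarTower.algebraMap_apply]
  obtain ⟨τ, hτ⟩ := exists_algEquiv_neg hα2 h.left_not_base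
  obtain ⟨κ, hκ⟩ := h.mem_base
  have h1 : (τ ^ 2) α = α := by
    rw [sq, AlgEquiv.mul_apply, hτ, map_neg, hτ, neg_neg]
  have h3 : (τ ^ 2) γ = -γ := by
    rw [sq, AlgEquiv.mul_apply, h.apply_apply_top hτ]
  refine ⟨τ ^ 2, h1, ?_, h3, ?_⟩
  · have : (τ ^ 2) (α * δ) = α * δ := by rw [← hκ, AlgEquiv.commutes]
    rw [map_mul, h1] at this
    exact mul_left_cancel₀ h.left_ne this
  · intro ρ hρ
    have hρα : ρ α ^ 2 = α ^ 2 := by rw [← map_pow, hα2, AlgEquiv.commutes]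
    rcases sq_eq_sq_iff_eq_or_eq_neg.1 hρα with h4 | h4
    · left
      have hργ : ρ γ ^ 2 = γ ^ 2 := by
        have hQ : ∀ c : ℚ, ρ (algebraMap ℚ F c) = algebraMap ℚ F c := by
          intro r
          rw [show algebraMap ℚ F r = (r : F) from (eq_ratCast (algebraMap ℚ F) r)]
          simp
        rw [← map_pow, h.sq_top, map_add, map_mul, hQ, hQ, h4]
      rcases sq_eq_sq_iff_eq_or_eq_neg.1 hργ with h5 | h5
      · exact absurd (h.algEquiv_ext (σ := ρ) (τ := 1) (by simpa using h4) (by simpa using h5)) hρ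
      · exact h.algEquiv_ext (by rw [h4, h1]) (by rw [h5, h3])
    · right
      refine h.algEquiv_ext ?_ ?_
      · rw [h1, sq, AlgEquiv.mul_apply, h4, map_neg, h4, neg_neg]
      · rw [h3, sq, AlgEquiv.mul_apply, h.apply_apply_top h4]

end IsRedeiField

end

end Redei

/-! ### Primes over p as embeddings, and inertia. -/

namespace Redei

noncomputable section

variable {p : ℕ} [Fact p.Prime]

theorem norm_le_one_of_isIntegral {w : PadicAlgCl p} (hw : IsIntegral ℤ w) : ‖w‖ ≤ 1 := by
  have hv : (Valued.v (R := PadicAlgCl p)).Integers (Valued.v (R := PadicAlgCl p)).integer :=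
    Valuation.integer.integers _
  have h1 : IsIntegral (Valued.v (R := PadicAlgCl p)).integer w := hw.tower_top
  exact hv.mem_of_integral h1

/-- The prime of `𝓞 F` defined by an embedding of `F` in the algebraic closure of `ℚ_p`. -/
def primeOf {F : Type*} [Field F] (φ : F →+* PadicAlgCl p) : Ideal (𝓞 F) where
  carrier := {θ | ‖φ (algebraMap (𝓞 F) F θ)‖ < 1}
  zero_mem' := by simp
  add_mem' {u v} hu hv := by
    simp only [Set.mem_ofPred_eq] at hu hv ⊢
    rw [map_add, map_add]
    exact (norm_add_le_max _ _).trans_lt (max_lt hu hv)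
  smul_mem' r u hu := by
    simp only [Set.mem_ofPred_eq] at hu ⊢
    have hr : ‖φ (algebraMap (𝓞 F) F r)‖ ≤ 1 := norm_le_one_of_isIntegral (r.isIntegral_coe.map φ.toIntAlgHom)
    rw [smul_eq_mul, map_mul, map_mul, norm_mul]
    exact mul_lt_one_of_nonneg_of_lt_one_right hr (norm_nonneg _) hu

theorem mem_primeOf {F : Type*} [Field F] {φ : F →+* PadicAlgCl p} {θ : 𝓞 F} :
    θ ∈ primeOf φ ↔ ‖φ (algebraMap (𝓞 F) F θ)‖ < 1 := Iff.rfl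

theorem norm_map_le_one {F : Type*} [Field F] (φ : F →+* PadicAlgCl p) (r : 𝓞 F) :
    ‖φ (algebraMap (𝓞 F) F r)‖ ≤ 1 := norm_le_one_of_isIntegral (r.isIntegral_coe.map φ.toIntAlgHom)

instance {F : Type*} [Field F] (φ : F →+* PadicAlgCl p) : (primeOf φ).IsPrime where
  ne_top' := by
    rw [Ideal.ne_top_iff_one, mem_primeOf]; simp
  mem_or_mem' {u v} h := by
    simp only [mem_primeOf] at h ⊢
    rw [map_mul, map_mul, norm_mul] at h
    by_contra! hc
    have h1 := norm_map_le_one φ u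
    nlinarith [hc.1, hc.2]

theorem natCast_mem_primeOf {F : Type*} [Field F] (φ : F →+* PadicAlgCl p) :
    (p : 𝓞 F) ∈ primeOf φ := by
  rw [mem_primeOf, map_natCast, map_natCast, ← map_natCast (algebraMap ℚ_[p] (PadicAlgCl p)),
    PadicAlgCl.norm_extends]
  exact Padic.norm_p_lt_one

theorem under_int_eq {F : Type*} [Field F] [NumberField F] (P : Ideal (𝓞 F)) [hP : P.IsPrime]
    (hp : (p : 𝓞 F) ∈ P) : P.under ℤ = Ideal.span {(p : ℤ)} := by
  have hmax : (Ideal.span {(p : ℤ)}).IsMaximal :=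
    PrincipalIdealRing.isMaximal_of_irreducible
      (Nat.prime_iff_prime_int.1 Fact.out).irreducible
  refine (hmax.eq_of_le (Ideal.IsPrime.under ℤ P).ne_top ?_).symm
  rw [Ideal.span_le, Set.singleton_subset_iff]
  simpa [Ideal.under, Ideal.mem_comap] using hp

/-- The Galois group permutes the primes over p transitively, so one embedding composed with
automorphisms reaches all of them. -/
theorem exists_eq_primeOf {F : Type*} [Field F] [NumberField F] [IsGalois ℚ F]
    (P : Ideal (𝓞 F)) [hP : P.IsPrime] (hp : (p : 𝓞 F) ∈ P) :
    ∃ φ : F →+* PadicAlgCl p, P = primeOf φ := by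
  let φ : F →+* PadicAlgCl p := (IsAlgClosed.lift (R := ℚ) (S := F) (M := PadicAlgCl p)).toRingHom
  obtain ⟨g, hg⟩ := Algebra.IsInvariant.exists_smul_of_under_eq ℤ (𝓞 F) Gal(F/ℚ) (primeOf φ) P
    (by rw [under_int_eq P hp, under_int_eq _ (natCast_mem_primeOf φ)])
  refine ⟨φ.comp (g⁻¹ : Gal(F/ℚ)).toRingEquiv.toRingHom, ?_⟩
  ext θ
  rw [hg, Ideal.mem_pointwise_smul_iff_inv_smul_mem, mem_primeOf, mem_primeOf]
  rfl

/-- In the discrete valuation ring at the prime, numerator and denominator of θ are comparable under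
divisibility. If the numerator divides the denominator, the bound on θ makes the cofactor a unit. -/
theorem exists_frac_of_norm_le_one {F : Type*} [Field F] [NumberField F]
    (φ : F →+* PadicAlgCl p) {θ : F} (hθ : ‖φ θ‖ ≤ 1) :
    ∃ s r : 𝓞 F, r ∉ primeOf φ ∧ θ * r = s := by
  obtain ⟨u, v, hv, rfl⟩ := IsFractionRing.div_surjective (A := 𝓞 F) θ
  have hv0 : v ≠ 0 := nonZeroDivisors.ne_zero hv
  have hvF : (algebraMap (𝓞 F) F v) ≠ 0 := by simpa using hv0
  have hP0 : primeOf φ ≠ ⊥ := by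
    intro h0
    have := natCast_mem_primeOf φ
    rw [h0, Ideal.mem_bot, Nat.cast_eq_zero] at this
    exact (Fact.out : p.Prime).ne_zero this
  have := IsLocalization.AtPrime.isDiscreteValuationRing_of_dedekind_domain (𝓞 F) hP0
    (Localization.AtPrime (primeOf φ))
  have inj : Function.Injective (algebraMap (𝓞 F) (Localization.AtPrime (primeOf φ))) :=
    IsLocalization.injective _ (primeOf φ).primeCompl_le_nonZeroDivisors
  have key : ∀ u v : 𝓞 F, algebraMap (𝓞 F) (Localization.AtPrime (primeOf φ)) v ∣
      algebraMap (𝓞 F) (Localization.AtPrime (primeOf φ)) u →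
      ∃ s r : 𝓞 F, r ∉ primeOf φ ∧ u * r = v * s := by
    rintro u v ⟨c, hc⟩
    obtain ⟨s, r, rfl⟩ := IsLocalization.exists_mk'_eq (primeOf φ).primeCompl c
    refine ⟨s, r, r.2, inj ?_⟩
    rw [map_mul, hc, map_mul, mul_assoc, IsLocalization.mk'_spec]
  rcases ValuationRing.dvd_total (algebraMap (𝓞 F) (Localization.AtPrime (primeOf φ)) v)
    (algebraMap (𝓞 F) (Localization.AtPrime (primeOf φ)) u) with h | h
  · obtain ⟨s, r, hr, hrs⟩ := key u v h
    refine ⟨s, r, hr, ?_⟩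
    have := congrArg (algebraMap (𝓞 F) F) hrs
    rw [map_mul, map_mul] at this
    field_simp
    linear_combination this
  · obtain ⟨s, r, hr, hrs⟩ := key v u h
    have := congrArg (algebraMap (𝓞 F) F) hrs
    rw [map_mul, map_mul] at this
    refine ⟨r, s, ?_, ?_⟩
    · rw [mem_primeOf] at hr ⊢
      intro hs
      apply hr
      have h1 := congrArg (fun w => ‖φ w‖) this
      simp only [map_mul, norm_mul] at h1
      rw [map_div₀, norm_div] at hθ
      have h2 : 0 < ‖φ (algebraMap (𝓞 F) F v)‖ := by
        rw [norm_pos_iff]; exact (map_ne_zero φ).2 hvF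
      have h3 : ‖φ (algebraMap (𝓞 F) F u)‖ ≤ ‖φ (algebraMap (𝓞 F) F v)‖ := by
        rwa [div_le_one h2] at hθ
      have h4 := norm_nonneg (φ (algebraMap (𝓞 F) F s))
      change ‖φ (algebraMap (𝓞 F) F s)‖ < 1 at hs
      change ‖φ (algebraMap (𝓞 F) F r)‖ < 1
      nlinarith [norm_nonneg (φ (algebraMap (𝓞 F) F u))]
    · field_simp
      linear_combination -this

namespace IsRedeiField

variable {a b x y z : ℚ} {K F : Type} [Field K] [Field F] [NumberField K] [NumberField F]
    [Algebra K F] {α δ γ : F} (h : IsRedeiField a b x y z K F α δ γ)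

include h

/-- The ramification index is the order of the inertia group, and a non-trivial inertia group
contains σ. -/
theorem isUnramifiedAt_iff {σ : F ≃ₐ[K] F} (hγ : σ γ = -γ)
    (hσ : ∀ ρ : F ≃ₐ[K] F, ρ ≠ 1 → ρ = σ ∨ ρ ^ 2 = σ) (P : Ideal (𝓞 F)) [P.IsPrime] :
    Algebra.IsUnramifiedAt (𝓞 K) P ↔ ∃ θ : 𝓞 F, σ • θ - θ ∉ P := by
  have := h.isGalois_base
  have hσ1 : σ ≠ 1 := by
    rintro rfl
    rw [AlgEquiv.one_apply] at hγ
    exact h.top_ne (self_eq_neg.1 hγ)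
  rw [← Ideal.ramificationIdx_eq_one_iff,
    ← Ideal.ramificationIdxIn_eq_ramificationIdx (P.under (𝓞 K)) P Gal(F/K),
    ← Ideal.card_inertia_eq_ramificationIdxIn (G := Gal(F/K)) (P.under (𝓞 K)) P,
    Subgroup.card_eq_one]
  rw [← not_iff_not]
  push Not
  change _ ↔ σ ∈ Ideal.inertia Gal(F/K) P
  constructor
  · intro hne
    obtain ⟨ρ, hρ1⟩ := Subgroup.ne_bot_iff_exists_ne_one.1 hne
    rcases hσ ρ (by simpa using hρ1) with h1 | h1
    · rw [← h1]; exact ρ.2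
    · rw [← h1]; exact pow_mem ρ.2 2
  · intro hmem h0
    rw [h0, Subgroup.mem_bot] at hmem
    exact hσ1 hmem

theorem unramifiedOver_iff_forall {σ : F ≃ₐ[K] F} (hγ : σ γ = -γ)
    (hσ : ∀ ρ : F ≃ₐ[K] F, ρ ≠ 1 → ρ = σ ∨ ρ ^ 2 = σ) :
    UnramifiedOver K F p ↔
      ∀ φ : F →+* PadicAlgCl p, ∃ θ : F, ‖φ θ‖ ≤ 1 ∧ 1 ≤ ‖φ (σ θ - θ)‖ := by
  have := h.isGalois_rat
  constructor
  · intro hU φ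
    obtain ⟨θ, hθ⟩ := (h.isUnramifiedAt_iff hγ hσ _).1 (hU (primeOf φ) (natCast_mem_primeOf φ))
    exact ⟨θ, norm_map_le_one φ θ, not_lt.1 hθ⟩
  · intro hU P _ hp
    obtain ⟨φ, rfl⟩ := exists_eq_primeOf P hp
    rw [h.isUnramifiedAt_iff hγ hσ]
    by_contra! hc
    obtain ⟨θ, hθ, hθ2⟩ := hU φ
    obtain ⟨s, r, hr, hrs⟩ := exists_frac_of_norm_le_one φ hθ
    have hr' : ‖φ r‖ = 1 := le_antisymm (norm_map_le_one φ r) (not_lt.1 hr)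
    have hσr := hc r
    have hσs := hc s
    rw [mem_primeOf] at hσr hσs
    have e1 : algebraMap (𝓞 F) F (σ • r - r) = σ r - r := rfl
    have e2 : algebraMap (𝓞 F) F (σ • s - s) = σ s - s := rfl
    rw [e1, map_sub] at hσr
    rw [e2, map_sub] at hσs
    have h1 : ‖φ (σ r)‖ = 1 := by
      apply le_antisymm
      · exact norm_map_le_one φ (σ • r)
      · by_contra! hlt
        have := norm_sub_le_max (φ (σ r)) (φ (σ r) - φ r)
        rw [sub_sub_cancel, hr'] at this
        exact absurd this (not_le.2 (max_lt hlt hσr))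
    -- From θr = s: σs - s = (σθ - θ)σr + θ(σr - r). Since σr is a unit, σθ - θ is small as soon as
    -- σs - s and σr - r are.
    have e3 : (φ (σ θ - θ)) * φ (σ r) = (φ (σ s) - φ s) - φ θ * (φ (σ r) - φ r) := by
      have e4 : σ θ * σ r = σ s := by rw [← map_mul, hrs]
      have e5 := congrArg φ e4
      have e6 := congrArg φ hrs
      rw [map_mul] at e5 e6
      rw [map_sub]
      linear_combination e5 - e6
    have e7 : ‖φ (σ θ - θ)‖ < 1 := by
      rw [← mul_one ‖φ (σ θ - θ)‖]
      nth_rw 1 [← h1]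
      rw [← norm_mul, e3]
      refine (norm_sub_le_max _ _).trans_lt (max_lt hσs ?_)
      rw [norm_mul]
      exact mul_lt_one_of_nonneg_of_lt_one_right hθ (norm_nonneg _) hσr
    exact absurd hθ2 (not_le.2 e7)

end IsRedeiField

end

end Redei

/-! ### Unramified square classes and unramified primes. -/

namespace Redei

noncomputable section

variable {p : ℕ} [Fact p.Prime]

namespace UnrClass

variable {L : IntermediateField ℚ_[p] (PadicAlgCl p)} {β β' : PadicAlgCl p}

theorem mul (h : UnrClass L β) (h' : UnrClass L β') : UnrClass L (β * β') := by
  obtain ⟨w, hw, s, hs, h1, h2, h3⟩ := h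
  obtain ⟨w', hw', s', hs', h1', h2', h3'⟩ := h'
  refine ⟨w * w', mul_mem hw hw', s * s', mul_mem hs hs', ?_, ?_, ?_⟩
  · rw [show (w * w') ^ 2 * (β * β') = (w ^ 2 * β) * (w' ^ 2 * β') by ring, norm_mul, h1, h1',
      one_mul]
  · rw [norm_mul]; exact mul_le_one₀ h2 (norm_nonneg _) h2'
  · rw [show (w * w') ^ 2 * (β * β') - (s * s') ^ 2 = (w ^ 2 * β) * (w' ^ 2 * β' - s' ^ 2)
      + s' ^ 2 * (w ^ 2 * β - s ^ 2) by ring]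
    refine (norm_add_le_max _ _).trans (max_le ?_ ?_)
    · rw [norm_mul, h1, one_mul]; exact h3'
    · rw [norm_mul, norm_pow]
      exact (mul_le_of_le_one_left (norm_nonneg _) (pow_le_one₀ (norm_nonneg _) h2')).trans h3

theorem sq {r : PadicAlgCl p} (hr : r ∈ L) (hr0 : r ≠ 0) : UnrClass L (r ^ 2) := by
  refine ⟨r⁻¹, inv_mem hr, 1, one_mem _, ?_, by simp, ?_⟩
  · rw [← mul_pow, inv_mul_cancel₀ hr0]; simp
  · rw [← mul_pow, inv_mul_cancel₀ hr0]; simp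

theorem ne_zero (h : UnrClass L β) : β ≠ 0 := by
  rintro rfl
  obtain ⟨w, _, s, _, h1, _⟩ := h
  simp at h1

theorem mul_sq_iff {r : PadicAlgCl p} (hr : r ∈ L) (hr0 : r ≠ 0) :
    UnrClass L (r ^ 2 * β) ↔ UnrClass L β := by
  refine ⟨fun h => ?_, fun h => (sq hr hr0).mul h⟩
  have := (sq (inv_mem hr) (inv_ne_zero hr0)).mul h
  rwa [← mul_assoc, ← mul_pow, inv_mul_cancel₀ hr0, one_pow, one_mul] at this

theorem of_mul_eq_sq (h : UnrClass L β) (hβ : β ∈ L) {c : PadicAlgCl p} (hc : c ∈ L) (hc0 : c ≠ 0)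
    (e : β * β' = c ^ 2) : UnrClass L β' := by
  have h0 := h.ne_zero
  have : β' = (c / β) ^ 2 * β := by field_simp; linear_combination e
  rw [this]
  exact (mul_sq_iff (div_mem hc hβ) (div_ne_zero hc0 h0)).2 h

theorem mul_iff (h : UnrClass L β) (hβ : β ∈ L) : UnrClass L (β' * β) ↔ UnrClass L β' := by
  refine ⟨fun h' => ?_, fun h' => h'.mul h⟩
  have := h'.mul h
  rw [show β' * β * β = β ^ 2 * β' by ring] at this
  exact (mul_sq_iff hβ h.ne_zero).1 this

/-- The number (s + wg)/2 is a root of X² - sX - (w²g² - s²)/4, which has integral coefficients. Its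
difference with its conjugate is the unit wg, so it witnesses that adjoining g is unramified. -/
theorem of_exists (g : PadicAlgCl p) {w s : PadicAlgCl p} (h1 : ‖w ^ 2 * g ^ 2‖ = 1)
    (h2 : ‖s‖ ≤ 1) (h3 : ‖w ^ 2 * g ^ 2 - s ^ 2‖ ≤ ‖(4 : PadicAlgCl p)‖) :
    ‖(s + w * g) / 2‖ ≤ 1 ∧ ‖w * g‖ = 1 := by
  have h4 : ‖w * g‖ = 1 := by
    rw [← mul_pow, norm_pow] at h1
    exact (pow_eq_one_iff_of_nonneg (norm_nonneg _) two_ne_zero).1 h1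
  refine ⟨?_, h4⟩
  set θ := (s + w * g) / 2 with hθ
  have e : θ ^ 2 = s * θ + (w ^ 2 * g ^ 2 - s ^ 2) / 4 := by
    rw [hθ]; ring
  by_contra! hlt
  have h5 : ‖θ‖ ^ 2 ≤ max ‖θ‖ 1 := by
    rw [← norm_pow, e]
    refine (norm_add_le_max _ _).trans (max_le_max ?_ ?_)
    · rw [norm_mul]; exact mul_le_of_le_one_left (norm_nonneg _) h2
    · rw [norm_div]
      exact div_le_one_of_le₀ h3 (norm_nonneg _)
  rw [max_eq_left hlt.le] at h5
  nlinarith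

end UnrClass

/-- Since ℚ is dense in ℚ_p, the closure of the image of ℚ[S] is a ring containing ℚ_p and φ(S). -/
theorem exists_near {F : Type*} [Field F] [Algebra ℚ F] (φ : F →+* PadicAlgCl p) (S : Set F)
    {w : PadicAlgCl p} (hw : w ∈ Algebra.adjoin ℚ_[p] (φ '' S)) {ε : ℝ} (hε : 0 < ε) :
    ∃ v ∈ Algebra.adjoin ℚ S, ‖φ v - w‖ < ε := by
  let T : Subring (PadicAlgCl p) :=
    ((Algebra.adjoin ℚ S).toSubring.map φ).topologicalClosure
  have hT : w ∈ T := by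
    induction hw using Algebra.adjoin_induction with
    | mem u hu =>
      obtain ⟨v, hv, rfl⟩ := hu
      exact Subring.le_topologicalClosure _ ⟨v, Algebra.subset_adjoin hv, rfl⟩
    | algebraMap c =>
      change _ ∈ closure (((Algebra.adjoin ℚ S).toSubring.map φ : Subring _) : Set (PadicAlgCl p))
      rw [Metric.mem_closure_iff]
      intro ε hε
      obtain ⟨q, hq⟩ := Padic.rat_dense p c hε
      refine ⟨φ (algebraMap ℚ F q), ⟨_, Subalgebra.algebraMap_mem _ q, rfl⟩, ?_⟩
      rw [dist_eq_norm, eq_ratCast, map_ratCast, ← map_ratCast (algebraMap ℚ_[p] (PadicAlgCl p)),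
        ← map_sub, PadicAlgCl.norm_extends]
      exact hq
    | add u v _ _ hu hv => exact add_mem hu hv
    | mul u v _ _ hu hv => exact mul_mem hu hv
  change _ ∈ closure (((Algebra.adjoin ℚ S).toSubring.map φ : Subring _) : Set (PadicAlgCl p)) at hT
  rw [Metric.mem_closure_iff] at hT
  obtain ⟨_, ⟨v, hv, rfl⟩, h⟩ := hT ε hε
  refine ⟨v, hv, ?_⟩
  rwa [dist_eq_norm, norm_sub_rev] at h

/-- For θ = u + vγ one has σθ - θ = -2vγ. If φγ is not in L, then with w = 2v and s = 2u the
difference w²γ² - s² is -4 times the norm of θ, which gives the congruence modulo 4; if φγ is in L,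
its square is trivially good. Conversely (s + wγ)/2 has the required properties over ℚ_p, and an
element of F close to it inherits them. -/
theorem exists_theta_iff_unrClass {F : Type*} [Field F] [Algebra ℚ F] (φ : F →+* PadicAlgCl p)
    {S : Set F} {γ : F} (hγ : γ ^ 2 ∈ Algebra.adjoin ℚ S)
    (hgen : Algebra.adjoin ℚ (insert γ S) = ⊤) (hγ0 : γ ≠ 0) (σ : F →+* F)
    (hσ : ∀ u ∈ Algebra.adjoin ℚ S, σ u = u) (hσγ : σ γ = -γ) :
    (∃ θ : F, ‖φ θ‖ ≤ 1 ∧ 1 ≤ ‖φ (σ θ - θ)‖) ↔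
      UnrClass (IntermediateField.adjoin ℚ_[p] (φ '' S)) (φ γ ^ 2) := by
  set L := IntermediateField.adjoin ℚ_[p] (φ '' S) with hL
  have hmemL : ∀ w, w ∈ L ↔ w ∈ Algebra.adjoin ℚ_[p] (φ '' S) := by
    intro w; rw [← adjoin_toSubalgebra_eq]; rfl
  have hφL : ∀ u ∈ Algebra.adjoin ℚ S, φ u ∈ L := by
    intro u hu
    induction hu using Algebra.adjoin_induction with
    | mem u hu => exact IntermediateField.subset_adjoin _ _ ⟨u, hu, rfl⟩
    | algebraMap c => rw [eq_ratCast, map_ratCast]; exact SubfieldClass.ratCast_mem L c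
    | add u v _ _ hu hv => rw [map_add]; exact add_mem hu hv
    | mul u v _ _ hu hv => rw [map_mul]; exact mul_mem hu hv
  have hg0 : φ γ ≠ 0 := (map_ne_zero φ).2 hγ0
  constructor
  · rintro ⟨θ, h1, h2⟩
    have hg2 : φ γ ^ 2 ∈ L := by rw [← map_pow]; exact hφL _ hγ
    by_cases hgL : φ γ ∈ L
    · exact UnrClass.sq hgL hg0
    obtain ⟨u, hu, v, hv, rfl⟩ := mem_adjoin_insert_sqrt hγ (w := θ) (hgen ▸ Algebra.mem_top)
    have e1 : σ (u + v * γ) - (u + v * γ) = -(2 * v * γ) := by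
      rw [map_add, map_mul, hσ u hu, hσ v hv, hσγ]; ring
    rw [e1, map_neg, norm_neg, map_mul, map_mul, map_ofNat] at h2
    rw [map_add, map_mul] at h1
    have h3 := norm_conj hgL hg2 (hφL u hu) (hφL v hv)
    have h4 : ‖φ u - φ v * φ γ‖ ≤ 1 := h3.trans_le h1
    have h5 : ‖2 * φ u‖ ≤ 1 := by
      rw [show 2 * φ u = (φ u + φ v * φ γ) + (φ u - φ v * φ γ) by ring]
      exact (norm_add_le_max _ _).trans (max_le h1 h4)
    have h6 : ‖2 * φ v * φ γ‖ = 1 := by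
      refine le_antisymm ?_ h2
      rw [show 2 * φ v * φ γ = (φ u + φ v * φ γ) - (φ u - φ v * φ γ) by ring]
      exact (norm_sub_le_max _ _).trans (max_le h1 h4)
    have h2L : (2 : PadicAlgCl p) ∈ L := ofNat_mem L 2
    refine ⟨2 * φ v, mul_mem h2L (hφL v hv), 2 * φ u, mul_mem h2L (hφL u hu), ?_, h5, ?_⟩
    · rw [← mul_pow, norm_pow, h6, one_pow]
    · rw [show (2 * φ v) ^ 2 * φ γ ^ 2 - (2 * φ u) ^ 2
        = 4 * (-((φ u + φ v * φ γ) * (φ u - φ v * φ γ))) by ring, norm_mul]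
      refine mul_le_of_le_one_right (norm_nonneg _) ?_
      rw [norm_neg, norm_mul]
      exact mul_le_one₀ h1 (norm_nonneg _) h4
  · rintro ⟨w, hw, s, hs, h1, h2, h3⟩
    obtain ⟨h4, h5⟩ := UnrClass.of_exists _ h1 h2 h3
    have hg : 0 < ‖φ γ‖ := norm_pos_iff.2 hg0
    have h20 : (0 : ℝ) < ‖(2 : PadicAlgCl p)‖ := norm_pos_iff.2 two_ne_zero
    have h21 : ‖(2 : PadicAlgCl p)‖ ≤ 1 := by
      have := norm_le_one_of_isIntegral (p := p) (w := 2) (isIntegral_algebraMap (x := (2 : ℤ)))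
      exact this
    -- Errors smaller than |2| in s and in wγ leave half of their sum integral.
    obtain ⟨s', hs', hs1⟩ := exists_near φ S ((hmemL s).1 hs) h20
    obtain ⟨w', hw', hw1⟩ := exists_near φ S ((hmemL w).1 hw) (div_pos h20 hg)
    have hw2 : ‖(φ w' - w) * φ γ‖ < ‖(2 : PadicAlgCl p)‖ := by
      rw [norm_mul]; exact (lt_div_iff₀ hg).1 hw1
    have : CharZero F := charZero_of_injective_algebraMap (algebraMap ℚ F).injective
    have hF2 : (2 : F) ≠ 0 := two_ne_zero
    refine ⟨(s' + w' * γ) / 2, ?_, ?_⟩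
    · rw [map_div₀, map_add, map_mul, map_ofNat,
        show (φ s' + φ w' * φ γ) / 2 = (s + w * φ γ) / 2
          + ((φ s' - s) + (φ w' - w) * φ γ) / 2 by ring]
      refine (norm_add_le_max _ _).trans (max_le h4 ?_)
      rw [norm_div, div_le_one h20]
      exact (norm_add_le_max _ _).trans (max_le hs1.le hw2.le)
    · have e1 : σ ((s' + w' * γ) / 2) - (s' + w' * γ) / 2 = -(w' * γ) := by
        rw [map_div₀, map_add, map_mul, hσ s' hs', hσ w' hw', hσγ, map_ofNat]; field_simp; ring
      rw [e1, map_neg, norm_neg, map_mul]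
      have h6 := norm_sub_le_max (φ w' * φ γ) ((φ w' - w) * φ γ)
      rw [show φ w' * φ γ - (φ w' - w) * φ γ = w * φ γ by ring, h5] at h6
      rcases le_max_iff.1 h6 with h7 | h7
      · exact h7
      · exact absurd (h7.trans_lt hw2) (not_lt.2 h21)

theorem adjoin_pair_eq_of_sq_eq {A B A' B' : PadicAlgCl p} (hA : A ^ 2 = A' ^ 2)
    (hB : B ^ 2 = B' ^ 2) :
    IntermediateField.adjoin ℚ_[p] {A, B} = IntermediateField.adjoin ℚ_[p] {A', B'} := by
  have key : ∀ {A B A' B' : PadicAlgCl p}, A ^ 2 = A' ^ 2 → B ^ 2 = B' ^ 2 →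
      IntermediateField.adjoin ℚ_[p] {A, B} ≤ IntermediateField.adjoin ℚ_[p] {A', B'} := by
    intro A B A' B' hA hB
    have hA' : A' ∈ IntermediateField.adjoin ℚ_[p] {A', B'} :=
      IntermediateField.subset_adjoin _ _ (by simp)
    have hB' : B' ∈ IntermediateField.adjoin ℚ_[p] {A', B'} :=
      IntermediateField.subset_adjoin _ _ (by simp)
    refine IntermediateField.adjoin_le_iff.2 ?_
    rintro w (rfl | rfl)
    · rcases sq_eq_sq_iff_eq_or_eq_neg.1 hA with h | h <;> rw [h]
      · exact hA'
      · exact neg_mem hA'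
    · rcases sq_eq_sq_iff_eq_or_eq_neg.1 hB with h | h <;> rw [h]
      · exact hB'
      · exact neg_mem hB'
  exact le_antisymm (key hA hB) (key hA.symm hB.symm)

/-- The class of a conjugate of `x + y√a` is unramified if that of `x + y√a` is. -/
theorem unrClass_conj {a b x y z : ℚ} {A B : PadicAlgCl p} (hA : A ^ 2 = a) (hB : B ^ 2 = b)
    (hz : x ^ 2 - a * y ^ 2 = b * z ^ 2) (hb : b ≠ 0) (hz0 : z ≠ 0)
    (h : UnrClass (IntermediateField.adjoin ℚ_[p] {A, B}) (x + y * A)) :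
    UnrClass (IntermediateField.adjoin ℚ_[p] {A, B}) (x - y * A) := by
  have hA' : A ∈ IntermediateField.adjoin ℚ_[p] {A, B} :=
    IntermediateField.subset_adjoin _ _ (by simp)
  have hB' : B ∈ IntermediateField.adjoin ℚ_[p] {A, B} :=
    IntermediateField.subset_adjoin _ _ (by simp)
  have hB0 : B ≠ 0 := by
    rintro rfl
    rw [zero_pow two_ne_zero, eq_comm, Rat.cast_eq_zero] at hB
    exact hb hB
  refine h.of_mul_eq_sq (add_mem (SubfieldClass.ratCast_mem _ _) (mul_mem (SubfieldClass.ratCast_mem _ _) hA'))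
    (mul_mem hB' (SubfieldClass.ratCast_mem _ z)) (mul_ne_zero hB0 (by exact_mod_cast hz0)) ?_
  have : ((x ^ 2 - a * y ^ 2 : ℚ) : PadicAlgCl p) = ((b * z ^ 2 : ℚ) : PadicAlgCl p) := by rw [hz]
  push_cast at this
  rw [mul_pow, hB, ← this, ← hA]
  ring

/-- Embeddings of F differ, as far as L and β are concerned, by the sign of the image of α. This
replaces β by its conjugate, which has the same class because the product of both is a square in L.
So one embedding decides for all primes over p. -/
theorem IsRedeiField.unramifiedOver_iff {a b x y z : ℚ} {K F : Type} [Field K] [Field F]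
    [NumberField K] [NumberField F] [Algebra K F] {α δ γ : F}
    (h : IsRedeiField a b x y z K F α δ γ) {A B : PadicAlgCl p} (hA : A ^ 2 = a) (hB : B ^ 2 = b) :
    UnramifiedOver K F p ↔ UnrClass (IntermediateField.adjoin ℚ_[p] {A, B}) (x + y * A) := by
  obtain ⟨σ, hσα, hσδ, hσγ, hσ⟩ := h.exists_algEquiv
  rw [h.unramifiedOver_iff_forall hσγ hσ]
  have hγ2 : γ ^ 2 ∈ Algebra.adjoin ℚ {α, δ} := by
    rw [h.sq_top]
    exact add_mem (Subalgebra.algebraMap_mem _ _) (mul_mem (Subalgebra.algebraMap_mem _ _)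
      (Algebra.subset_adjoin (by simp)))
  have hfix : ∀ u ∈ Algebra.adjoin ℚ {α, δ}, (σ : F →+* F) u = u := by
    intro u hu
    induction hu using Algebra.adjoin_induction with
    | mem u hu => rcases hu with rfl | rfl <;> assumption
    | algebraMap c => rw [eq_ratCast, map_ratCast]
    | add u v _ _ hu hv => rw [map_add, hu, hv]
    | mul u v _ _ hu hv => rw [map_mul, hu, hv]
  have key : ∀ φ : F →+* PadicAlgCl p, (∃ θ : F, ‖φ θ‖ ≤ 1 ∧ 1 ≤ ‖φ (σ θ - θ)‖) ↔
      UnrClass (IntermediateField.adjoin ℚ_[p] {A, B}) (x + y * A) := by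
    intro φ
    have hα : φ α ^ 2 = A ^ 2 := by rw [← map_pow, h.sq_left, eq_ratCast, map_ratCast, hA]
    have hδ : φ δ ^ 2 = B ^ 2 := by rw [← map_pow, h.sq_right, eq_ratCast, map_ratCast, hB]
    rw [show (∃ θ : F, ‖φ θ‖ ≤ 1 ∧ 1 ≤ ‖φ (σ θ - θ)‖) ↔ _ from
      exists_theta_iff_unrClass φ hγ2 h.gen h.top_ne (σ : F →+* F) hfix hσγ, Set.image_pair,
      adjoin_pair_eq_of_sq_eq hα hδ, ← map_pow, h.sq_top, map_add, map_mul, eq_ratCast, eq_ratCast,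
      map_ratCast, map_ratCast]
    rcases sq_eq_sq_iff_eq_or_eq_neg.1 hα with e | e <;> rw [e]
    constructor
    · intro h1
      have := unrClass_conj (x := x) (y := -y) hA hB (by rw [neg_sq]; exact h.eqn) h.b_ne h.z_ne
        (by push_cast; rwa [neg_mul, ← mul_neg])
      push_cast at this
      rwa [neg_mul, sub_neg_eq_add] at this
    · intro h1
      rw [mul_neg, ← sub_eq_add_neg]
      exact unrClass_conj hA hB h.eqn h.b_ne h.z_ne h1
  constructor
  · intro hall
    let φ : F →+* PadicAlgCl p :=
      (IsAlgClosed.lift (R := ℚ) (S := F) (M := PadicAlgCl p)).toRingHom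
    exact (key φ).1 (hall φ)
  · intro hU φ
    exact (key φ).2 hU

end

end Redei

/-! ### Odd primes. -/

namespace Redei

noncomputable section

variable {p : ℕ} [Fact p.Prime]

theorem norm_ratCast (c : ℚ) : ‖(c : PadicAlgCl p)‖ = ‖(c : ℚ_[p])‖ := by
  rw [← map_ratCast (algebraMap ℚ_[p] (PadicAlgCl p)), PadicAlgCl.norm_extends]

theorem norm_intCast_le_one (c : ℤ) : ‖(c : PadicAlgCl p)‖ ≤ 1 :=
  norm_le_one_of_isIntegral (isIntegral_algebraMap (x := c))

theorem norm_natCast_self : ‖(p : PadicAlgCl p)‖ = (p : ℝ)⁻¹ := by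
  have := norm_ratCast (p := p) p
  rw [Rat.cast_natCast, Rat.cast_natCast, Padic.norm_p] at this
  exact this

theorem norm_intCast_eq_one {c : ℤ} (hc : ¬ (p : ℤ) ∣ c) : ‖(c : PadicAlgCl p)‖ = 1 := by
  have := norm_ratCast (p := p) c
  rw [Rat.cast_intCast, Rat.cast_intCast] at this
  rw [this]
  exact le_antisymm (Padic.norm_int_le_one c)
    (not_lt.1 fun h => hc (Padic.norm_intCast_lt_one_iff.1 h))

theorem norm_two_eq_one (hp : p ≠ 2) : ‖(2 : PadicAlgCl p)‖ = 1 := by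
  have : ¬ (p : ℤ) ∣ 2 := by
    intro h
    have h' : p ∣ 2 := by exact_mod_cast h
    exact hp ((Nat.prime_dvd_prime_iff_eq Fact.out Nat.prime_two).1 h')
  exact_mod_cast norm_intCast_eq_one this

theorem norm_four_eq_one (hp : p ≠ 2) : ‖(4 : PadicAlgCl p)‖ = 1 := by
  rw [show (4 : PadicAlgCl p) = 2 ^ 2 by norm_num, norm_pow, norm_two_eq_one hp, one_pow]

/-- All non-zero elements of `L` have absolute value an integral power of `p`. -/
def HasIntVal (L : IntermediateField ℚ_[p] (PadicAlgCl p)) : Prop :=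
  ∀ w ∈ L, w ≠ 0 → ∃ n : ℤ, ‖w‖ = (p : ℝ) ^ n

theorem exists_norm_eq_zpow {c : ℚ_[p]} (hc : c ≠ 0) : ∃ n : ℤ, ‖c‖ = (p : ℝ) ^ n :=
  ⟨_, Padic.norm_eq_zpow_neg_valuation hc⟩

theorem hasIntVal_adjoin_empty :
    HasIntVal (IntermediateField.adjoin ℚ_[p] (∅ : Set (PadicAlgCl p))) := by
  intro w hw hw0
  rw [IntermediateField.adjoin_empty, IntermediateField.mem_bot] at hw
  obtain ⟨c, rfl⟩ := hw
  rw [PadicAlgCl.norm_extends]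
  exact exists_norm_eq_zpow (fun h => hw0 (by rw [h, map_zero]))

/-- Adjoining a unit A with A² ≡ 1 mod 4 is unramified, with orthonormal basis 1, (1 + A)/2.
Subtracting its conjugate from the element isolates tA, which bounds |t| and then |r|. In
consequence no new absolute values arise. For odd p the congruence modulo 4 is empty. -/
theorem norm_add_mul_omega {L : IntermediateField ℚ_[p] (PadicAlgCl p)} {A : PadicAlgCl p}
    (hA1 : ‖A‖ = 1) (hA4 : ‖A ^ 2 - 1‖ ≤ ‖(4 : PadicAlgCl p)‖) (hA : A ∉ L) (hA2 : A ^ 2 ∈ L)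
    {r t : PadicAlgCl p} (hr : r ∈ L) (ht : t ∈ L) :
    ‖r + t * ((1 + A) / 2)‖ = max ‖r‖ ‖t‖ := by
  have hω : ‖(1 + A) / 2‖ ≤ 1 := by
    have := (UnrClass.of_exists (p := p) A (w := 1) (s := 1) (by simp [hA1]) (by simp)
      (by simpa using hA4)).1
    simpa using this
  have h2 : (2 : PadicAlgCl p) ∈ L := ofNat_mem L 2
  have hc := norm_conj hA hA2 (add_mem hr (div_mem ht h2)) (div_mem ht h2)
  rw [show r + t / 2 + t / 2 * A = r + t * ((1 + A) / 2) by ring] at hc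
  set N := ‖r + t * ((1 + A) / 2)‖ with hN
  have h1 : ‖t‖ ≤ N := by
    have := norm_sub_le_max (r + t * ((1 + A) / 2)) (r + t / 2 - t / 2 * A)
    rwa [hc, max_self, show r + t * ((1 + A) / 2) - (r + t / 2 - t / 2 * A) = t * A by ring,
      norm_mul, hA1, mul_one] at this
  apply le_antisymm
  · refine (norm_add_le_max _ _).trans (max_le_max le_rfl ?_)
    rw [norm_mul]
    exact mul_le_of_le_one_right (norm_nonneg _) hω
  · refine max_le ?_ h1
    have := norm_sub_le_max (r + t * ((1 + A) / 2)) (t * ((1 + A) / 2))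
    rw [add_sub_cancel_right, norm_mul] at this
    refine this.trans (max_le le_rfl ?_)
    exact (mul_le_of_le_one_right (norm_nonneg _) hω).trans h1

theorem HasIntVal.adjoin_insert {S : Set (PadicAlgCl p)} {A : PadicAlgCl p}
    (hS : HasIntVal (IntermediateField.adjoin ℚ_[p] S)) (hA1 : ‖A‖ = 1)
    (hA4 : ‖A ^ 2 - 1‖ ≤ ‖(4 : PadicAlgCl p)‖) (hA2 : A ^ 2 ∈ IntermediateField.adjoin ℚ_[p] S) :
    HasIntVal (IntermediateField.adjoin ℚ_[p] (insert A S)) := by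
  intro w hw hw0
  have hmem : ∀ (T : Set (PadicAlgCl p)) (w), w ∈ IntermediateField.adjoin ℚ_[p] T ↔
      w ∈ Algebra.adjoin ℚ_[p] T := by
    intro T w; rw [← adjoin_toSubalgebra_eq]; rfl
  obtain ⟨u, hu, v, hv, rfl⟩ := mem_adjoin_insert_sqrt ((hmem _ _).1 hA2) ((hmem _ _).1 hw)
  rw [← hmem] at hu hv
  by_cases hA : A ∈ IntermediateField.adjoin ℚ_[p] S
  · exact hS _ (add_mem hu (mul_mem hv hA)) hw0
  have h2 : (2 : PadicAlgCl p) ∈ IntermediateField.adjoin ℚ_[p] S := ofNat_mem _ 2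
  have h2v : 2 * v ∈ IntermediateField.adjoin ℚ_[p] S := mul_mem h2 hv
  have key := norm_add_mul_omega hA1 hA4 hA hA2 (sub_mem hu hv) h2v
  rw [show u - v + 2 * v * ((1 + A) / 2) = u + v * A by ring] at key
  rw [key]
  have hpos : 0 < max ‖u - v‖ ‖2 * v‖ := by rw [← key]; exact norm_pos_iff.2 hw0
  rcases max_cases ‖u - v‖ ‖2 * v‖ with ⟨h, -⟩ | ⟨h, -⟩ <;> rw [h] at hpos ⊢
  · exact hS _ (sub_mem hu hv) (norm_pos_iff.1 hpos)
  · exact hS _ h2v (norm_pos_iff.1 hpos)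

theorem sq_mem_adjoin {S : Set (PadicAlgCl p)} {A : PadicAlgCl p} {a : ℚ} (hA : A ^ 2 = a) :
    A ^ 2 ∈ IntermediateField.adjoin ℚ_[p] S := by
  rw [hA]; exact SubfieldClass.ratCast_mem _ _

theorem hasIntVal_pair {A B : PadicAlgCl p} {a b : ℚ} (hA : A ^ 2 = a) (hB : B ^ 2 = b)
    (hA1 : ‖A‖ = 1) (hA4 : ‖A ^ 2 - 1‖ ≤ ‖(4 : PadicAlgCl p)‖)
    (hB1 : ‖B‖ = 1) (hB4 : ‖B ^ 2 - 1‖ ≤ ‖(4 : PadicAlgCl p)‖) :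
    HasIntVal (IntermediateField.adjoin ℚ_[p] {A, B}) := by
  refine HasIntVal.adjoin_insert ?_ hA1 hA4 (sq_mem_adjoin hA)
  rw [← insert_empty_eq]
  exact HasIntVal.adjoin_insert hasIntVal_adjoin_empty hB1 hB4 (sq_mem_adjoin hB)

theorem hasIntVal_singleton {A : PadicAlgCl p} {a : ℚ} (hA : A ^ 2 = a)
    (hA1 : ‖A‖ = 1) (hA4 : ‖A ^ 2 - 1‖ ≤ ‖(4 : PadicAlgCl p)‖) :
    HasIntVal (IntermediateField.adjoin ℚ_[p] {A}) := by
  rw [← insert_empty_eq]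
  exact HasIntVal.adjoin_insert hasIntVal_adjoin_empty hA1 hA4 (sq_mem_adjoin hA)

theorem norm_sq_sub_one_le (hp : p ≠ 2) {A : PadicAlgCl p} (hA1 : ‖A‖ ≤ 1) :
    ‖A ^ 2 - 1‖ ≤ ‖(4 : PadicAlgCl p)‖ := by
  rw [norm_four_eq_one hp]
  refine (norm_sub_le_max _ _).trans (max_le ?_ (by simp))
  rw [norm_pow]; exact pow_le_one₀ (norm_nonneg _) hA1

theorem unrClass_of_norm (hp : p ≠ 2) {L : IntermediateField ℚ_[p] (PadicAlgCl p)}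
    {w β : PadicAlgCl p} (hw : w ∈ L) (h : ‖w‖ ^ 2 * ‖β‖ = 1) : UnrClass L β := by
  have h' : ‖w ^ 2 * β‖ = 1 := by rw [norm_mul, norm_pow, h]
  exact ⟨w, hw, 0, zero_mem _, h', by simp, by simp [norm_four_eq_one hp, h']⟩

theorem one_lt_natCast_prime : (1 : ℝ) < p := by exact_mod_cast (Fact.out : p.Prime).one_lt

/-- For odd p the number 4 is a unit, so s = 0 serves in the congruence and only the parity of the
valuation remains. -/
theorem unrClass_iff_even (hp : p ≠ 2) {L : IntermediateField ℚ_[p] (PadicAlgCl p)}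
    (hL : HasIntVal L) {β : PadicAlgCl p} {k : ℤ} (hk : ‖β‖ = (p : ℝ) ^ k) :
    UnrClass L β ↔ Even k := by
  have hp0 : (p : ℝ) ≠ 0 := by exact_mod_cast (Fact.out : p.Prime).ne_zero
  constructor
  · rintro ⟨w, hw, s, hs, h1, -, -⟩
    have hw0 : w ≠ 0 := by rintro rfl; simp at h1
    obtain ⟨n, hn⟩ := hL w hw hw0
    rw [norm_mul, norm_pow, hn, hk, ← zpow_natCast, ← zpow_mul, ← zpow_add₀ hp0] at h1
    have h2 := (zpow_eq_one_iff_right₀ (by positivity) (one_lt_natCast_prime (p := p)).ne').1 h1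
    push_cast at h2
    exact ⟨-n, by linarith⟩
  · rintro ⟨n, rfl⟩
    refine unrClass_of_norm hp (w := (p : PadicAlgCl p) ^ n)
      (zpow_mem (by exact_mod_cast natCast_mem L p) n) ?_
    rw [norm_zpow, norm_natCast_self, hk, ← zpow_natCast, ← zpow_mul, inv_zpow', ← zpow_add₀ hp0]
    simp [mul_two]

theorem norm_eq_one_of_sq {A : PadicAlgCl p} {a : ℤ} (hA : A ^ 2 = a) (ha : ¬ (p : ℤ) ∣ a) :
    ‖A‖ = 1 := by
  have : ‖A‖ ^ 2 = 1 := by rw [← norm_pow, hA, norm_intCast_eq_one ha]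
  exact (pow_eq_one_iff_of_nonneg (norm_nonneg _) two_ne_zero).1 this

theorem norm_intCast_of_squarefree {a : ℤ} (ha : Squarefree a) (hpa : (p : ℤ) ∣ a) :
    ‖(a : PadicAlgCl p)‖ = (p : ℝ)⁻¹ := by
  obtain ⟨c, rfl⟩ := hpa
  have hc : ¬ (p : ℤ) ∣ c := by
    intro h
    have := ha p (mul_dvd_mul_left _ h)
    exact (Nat.prime_iff_prime_int.1 (Fact.out : p.Prime)).not_isUnit this
  push_cast
  rw [norm_mul, norm_natCast_self, norm_intCast_eq_one hc, mul_one]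

/-- A number whose square has odd valuation is not in a field with integral valuations. -/
theorem notMem_of_norm_sq {L : IntermediateField ℚ_[p] (PadicAlgCl p)} (hL : HasIntVal L)
    {A : PadicAlgCl p} {k : ℤ} (hA : ‖A‖ ^ 2 = (p : ℝ) ^ (2 * k + 1)) : A ∉ L := by
  intro hAL
  have hp0 : (p : ℝ) ≠ 0 := by exact_mod_cast (Fact.out : p.Prime).ne_zero
  have hA0 : A ≠ 0 := by
    rintro rfl
    rw [norm_zero, zero_pow two_ne_zero, eq_comm] at hA
    exact zpow_ne_zero _ hp0 hA
  obtain ⟨n, hn⟩ := hL A hAL hA0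
  rw [hn, ← zpow_natCast, ← zpow_mul] at hA
  have := zpow_right_injective₀ (by positivity) (one_lt_natCast_prime (p := p)).ne' hA
  push_cast at this
  omega

theorem map_eqn {a b x y z : ℚ} {A : PadicAlgCl p} (hA : A ^ 2 = a)
    (h : x ^ 2 - a * y ^ 2 = b * z ^ 2) :
    ((x : PadicAlgCl p) + y * A) * (x - y * A) = b * z ^ 2 := by
  have : ((x ^ 2 - a * y ^ 2 : ℚ) : PadicAlgCl p) = ((b * z ^ 2 : ℚ) : PadicAlgCl p) := by rw [h]
  push_cast at this
  rw [← this, ← hA]; ring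

theorem ratCast_ne_zero' {z : ℚ} (hz : z ≠ 0) : (z : PadicAlgCl p) ≠ 0 := by exact_mod_cast hz

theorem exists_norm_ratCast {z : ℚ} (hz : z ≠ 0) : ∃ n : ℤ, ‖(z : PadicAlgCl p)‖ = (p : ℝ) ^ n := by
  rw [norm_ratCast]; exact exists_norm_eq_zpow (by exact_mod_cast hz)

theorem norm_zpow_sq {A : PadicAlgCl p} (hA : ‖A‖ ^ 2 = (p : ℝ)⁻¹) (k : ℤ) :
    ‖A ^ k‖ ^ 2 * (p : ℝ) ^ k = 1 := by
  have hp0 : (p : ℝ) ≠ 0 := by exact_mod_cast (Fact.out : p.Prime).ne_zero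
  rw [norm_zpow, ← zpow_natCast, ← zpow_mul, mul_comm k, zpow_mul, zpow_natCast, hA, inv_zpow,
    inv_mul_cancel₀ (zpow_ne_zero _ hp0)]

section odd

variable {a b : ℤ} {x y z : ℚ} {A B : PadicAlgCl p}

/-- As √a is not in ℚ_p, β and its conjugate have equal size, and their product bz² has the size of
z². So |β| = |z|, and a power of √a, of valuation 1/2, squares to the inverse size. -/
theorem unrClass_of_dvd_left (hp : p ≠ 2) (ha : Squarefree a) (hpa : (p : ℤ) ∣ a)
    (hpb : ¬ (p : ℤ) ∣ b) (hA : A ^ 2 = a) (h : x ^ 2 - a * y ^ 2 = b * z ^ 2)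
    (hz : z ≠ 0) : UnrClass (IntermediateField.adjoin ℚ_[p] {A, B}) (x + y * A) := by
  have hA' : ‖A‖ ^ 2 = (p : ℝ)⁻¹ := by rw [← norm_pow, hA, norm_intCast_of_squarefree ha hpa]
  have hAn := notMem_of_norm_sq (k := -1) hasIntVal_adjoin_empty (A := A) (by rw [hA']; norm_num)
  have hAq : A ^ 2 = ((a : ℚ) : PadicAlgCl p) := by rw [hA, Rat.cast_intCast]
  have h1 := norm_conj hAn (sq_mem_adjoin hAq) (SubfieldClass.ratCast_mem _ x)
    (SubfieldClass.ratCast_mem _ y)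
  have h2 := congrArg norm (map_eqn hAq h)
  rw [norm_mul, h1, norm_mul, Rat.cast_intCast, norm_intCast_eq_one hpb, one_mul, norm_pow,
    ← sq] at h2
  have h3 : ‖(x : PadicAlgCl p) + y * A‖ = ‖(z : PadicAlgCl p)‖ :=
    (pow_left_inj₀ (norm_nonneg _) (norm_nonneg _) two_ne_zero).1 h2
  obtain ⟨k, hk⟩ := exists_norm_ratCast (p := p) hz
  refine unrClass_of_norm hp (w := A ^ k)
    (zpow_mem (IntermediateField.subset_adjoin _ _ (by simp)) k) ?_
  rw [h3, hk, norm_zpow_sq hA']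

theorem norm_add_eq_zpow (hp : p ≠ 2) (hpa : ¬ (p : ℤ) ∣ a) (hA : A ^ 2 = a)
    (h : x ^ 2 - a * y ^ 2 = b * z ^ 2) (hz : z ≠ 0) (hb : b ≠ 0) :
    ∃ k : ℤ, ‖(x : PadicAlgCl p) + y * A‖ = (p : ℝ) ^ k := by
  have hAq : A ^ 2 = ((a : ℚ) : PadicAlgCl p) := by rw [hA, Rat.cast_intCast]
  have hA1 := norm_eq_one_of_sq hA hpa
  refine hasIntVal_singleton hAq hA1 (norm_sq_sub_one_le hp hA1.le) _ (add_mem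
    (SubfieldClass.ratCast_mem _ x) (mul_mem (SubfieldClass.ratCast_mem _ y)
      (IntermediateField.subset_adjoin _ _ rfl))) ?_
  intro h0
  have h2 := map_eqn hAq h
  rw [h0, zero_mul] at h2
  have hb' : ((b : ℚ) : PadicAlgCl p) ≠ 0 := ratCast_ne_zero' (by exact_mod_cast hb)
  exact mul_ne_zero hb' (pow_ne_zero 2 (ratCast_ne_zero' hz)) h2.symm

/-- The valuation of β is integral because ℚ_p(√a) is unramified, and √b has valuation 1/2, so the
square of a power of √b makes β a unit. -/
theorem unrClass_of_dvd_right (hp : p ≠ 2) (hb : Squarefree b) (hpa : ¬ (p : ℤ) ∣ a)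
    (hpb : (p : ℤ) ∣ b) (hA : A ^ 2 = a) (hB : B ^ 2 = b) (h : x ^ 2 - a * y ^ 2 = b * z ^ 2)
    (hz : z ≠ 0) : UnrClass (IntermediateField.adjoin ℚ_[p] {A, B}) (x + y * A) := by
  have hB' : ‖B‖ ^ 2 = (p : ℝ)⁻¹ := by rw [← norm_pow, hB, norm_intCast_of_squarefree hb hpb]
  obtain ⟨k, hk⟩ := norm_add_eq_zpow (A := A) hp hpa hA h hz hb.ne_zero
  refine unrClass_of_norm hp (w := B ^ k)
    (zpow_mem (IntermediateField.subset_adjoin _ _ (by simp)) k) ?_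
  rw [hk, norm_zpow_sq hB']

theorem hasIntVal_of_not_dvd (hp : p ≠ 2) (hpa : ¬ (p : ℤ) ∣ a) (hpb : ¬ (p : ℤ) ∣ b)
    (hA : A ^ 2 = a) (hB : B ^ 2 = b) : HasIntVal (IntermediateField.adjoin ℚ_[p] {A, B}) := by
  have hA1 := norm_eq_one_of_sq hA hpa
  have hB1 := norm_eq_one_of_sq hB hpb
  exact hasIntVal_pair (a := a) (b := b) (by rw [hA, Rat.cast_intCast]) (by rw [hB, Rat.cast_intCast])
    hA1 (norm_sq_sub_one_le hp hA1.le) hB1 (norm_sq_sub_one_le hp hB1.le)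

theorem unrClass_or (hp : p ≠ 2) (hpa : ¬ (p : ℤ) ∣ a) (hpb : ¬ (p : ℤ) ∣ b)
    (hA : A ^ 2 = a) (hB : B ^ 2 = b) (h : x ^ 2 - a * y ^ 2 = b * z ^ 2)
    (hz : z ≠ 0) (hb : b ≠ 0) : UnrClass (IntermediateField.adjoin ℚ_[p] {A, B}) (x + y * A) ∨
      UnrClass (IntermediateField.adjoin ℚ_[p] {A, B}) (p * (x + y * A)) := by
  have hp0 : (p : ℝ) ≠ 0 := by exact_mod_cast (Fact.out : p.Prime).ne_zero
  have hL := hasIntVal_of_not_dvd hp hpa hpb hA hB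
  obtain ⟨k, hk⟩ := norm_add_eq_zpow (A := A) hp hpa hA h hz hb
  rcases Int.even_or_odd k with hk' | hk'
  · exact Or.inl ((unrClass_iff_even hp hL hk).2 hk')
  · right
    refine (unrClass_iff_even hp hL (k := k - 1) ?_).2 (by grind)
    rw [norm_mul, hk, norm_natCast_self, zpow_sub_one₀ hp0, mul_comm]

theorem unrClass_ratCast_iff (hp : p ≠ 2) (hpa : ¬ (p : ℤ) ∣ a) (hpb : ¬ (p : ℤ) ∣ b)
    (hA : A ^ 2 = a) (hB : B ^ 2 = b) {t : ℚ} (ht : t ≠ 0) :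
    UnrClass (IntermediateField.adjoin ℚ_[p] {A, B}) (t : PadicAlgCl p) ↔
      Even (padicValRat p t) := by
  have hL := hasIntVal_of_not_dvd hp hpa hpb hA hB
  rw [unrClass_iff_even hp hL (k := -padicValRat p t), even_neg]
  rw [norm_ratCast, Padic.norm_eq_zpow_neg_valuation (by exact_mod_cast ht), Padic.valuation_ratCast]

/-- Both β and its conjugate are integral and their product is a unit. The hypotheses hold at all
but finitely many p, which bounds the set of primes where a twist is needed. -/
theorem unrClass_of_norm_le (hp : p ≠ 2) (hpb : ¬ (p : ℤ) ∣ b)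
    (hA : A ^ 2 = a) (h : x ^ 2 - a * y ^ 2 = b * z ^ 2) (hx : ‖(x : PadicAlgCl p)‖ ≤ 1)
    (hy : ‖(y : PadicAlgCl p)‖ ≤ 1) (hz : ‖(z : PadicAlgCl p)‖ = 1) :
    UnrClass (IntermediateField.adjoin ℚ_[p] {A, B}) (x + y * A) := by
  have hAq : A ^ 2 = ((a : ℚ) : PadicAlgCl p) := by rw [hA, Rat.cast_intCast]
  have hA1 : ‖A‖ ≤ 1 := by
    have : ‖A‖ ^ 2 ≤ 1 := by rw [← norm_pow, hA]; exact norm_intCast_le_one a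
    exact (sq_le_one_iff₀ (norm_nonneg _)).1 this
  have hyA : ‖(y : PadicAlgCl p) * A‖ ≤ 1 := by
    rw [norm_mul]; exact mul_le_one₀ hy (norm_nonneg _) hA1
  have h1 : ‖(x : PadicAlgCl p) + y * A‖ ≤ 1 := (norm_add_le_max _ _).trans (max_le hx hyA)
  have h2 : ‖(x : PadicAlgCl p) - y * A‖ ≤ 1 := (norm_sub_le_max _ _).trans (max_le hx hyA)
  have h3 := congrArg norm (map_eqn hAq h)
  rw [norm_mul, norm_mul, Rat.cast_intCast, norm_intCast_eq_one hpb, one_mul, norm_pow, hz,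
    one_pow] at h3
  refine unrClass_of_norm hp (w := 1) (one_mem _) ?_
  rw [norm_one, one_pow, one_mul]
  refine le_antisymm h1 ?_
  nlinarith [norm_nonneg ((x : PadicAlgCl p) + y * A)]

end odd

end

end Redei

/-! ### The prime 2: unramified classes and the four sign twists. -/

namespace Redei

noncomputable section

theorem norm_two : ‖(2 : PadicAlgCl 2)‖ = 2⁻¹ := by
  have := norm_natCast_self (p := 2)
  exact_mod_cast this

theorem norm_four : ‖(4 : PadicAlgCl 2)‖ = 4⁻¹ := by
  rw [show (4 : PadicAlgCl 2) = 2 ^ 2 by norm_num, norm_pow, norm_two]; norm_num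

theorem unrClass_of_norm_sub_one {L : IntermediateField ℚ_[2] (PadicAlgCl 2)}
    {w β : PadicAlgCl 2} (hw : w ∈ L) (h : ‖w ^ 2 * β - 1‖ ≤ 4⁻¹) : UnrClass L β := by
  refine ⟨w, hw, 1, one_mem _, ?_, by simp, by rwa [norm_four, one_pow]⟩
  have h1 : ‖w ^ 2 * β‖ ≤ max ‖w ^ 2 * β - 1‖ ‖(1 : PadicAlgCl 2)‖ := by
    have := norm_add_le_max (w ^ 2 * β - 1) 1
    rwa [sub_add_cancel] at this
  have h2 : ‖(1 : PadicAlgCl 2)‖ ≤ max ‖w ^ 2 * β‖ ‖w ^ 2 * β - 1‖ := by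
    have := norm_sub_le_max (w ^ 2 * β) (w ^ 2 * β - 1)
    rwa [sub_sub_cancel] at this
  rw [norm_one] at h1 h2
  refine le_antisymm (h1.trans (max_le (h.trans (by norm_num)) le_rfl)) ?_
  rcases le_max_iff.1 h2 with h3 | h3
  · exact h3
  · linarith

theorem UnrClass.exists_norm_sub_one {L : IntermediateField ℚ_[2] (PadicAlgCl 2)}
    {β : PadicAlgCl 2} (h : UnrClass L β) : ∃ w ∈ L, ‖w ^ 2 * β - 1‖ ≤ 4⁻¹ := by
  obtain ⟨w, hw, s, hs, h1, h2, h3⟩ := h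
  rw [norm_four] at h3
  have hs1 : ‖s‖ = 1 := by
    refine le_antisymm h2 ?_
    have h4 := norm_sub_le_max (w ^ 2 * β) (w ^ 2 * β - s ^ 2)
    rw [sub_sub_cancel, norm_pow] at h4
    have h5 := norm_add_le_max (s ^ 2) (w ^ 2 * β - s ^ 2)
    rw [add_sub_cancel, h1, norm_pow] at h5
    rcases le_max_iff.1 h5 with h6 | h6
    · by_contra! hlt
      nlinarith [norm_nonneg s]
    · linarith
  have hs0 : s ≠ 0 := by rintro rfl; simp at hs1
  refine ⟨w / s, div_mem hw hs, ?_⟩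
  rw [show (w / s) ^ 2 * β - 1 = (w ^ 2 * β - s ^ 2) / s ^ 2 by field_simp, norm_div, norm_pow, hs1,
    one_pow, div_one]
  exact h3

theorem norm_intCast_le_of_dvd {n : ℤ} {k : ℕ} (h : (2 : ℤ) ^ k ∣ n) :
    ‖(n : PadicAlgCl 2)‖ ≤ (2⁻¹ : ℝ) ^ k := by
  obtain ⟨c, rfl⟩ := h
  push_cast
  rw [norm_mul, norm_pow, norm_two]
  exact mul_le_of_le_one_right (by positivity) (norm_intCast_le_one c)

theorem norm_intCast_sub_le {n m : ℤ} {k : ℕ} (h : (2 : ℤ) ^ k ∣ n - m) :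
    ‖(n : PadicAlgCl 2) - m‖ ≤ (2⁻¹ : ℝ) ^ k := by
  exact_mod_cast norm_intCast_le_of_dvd h

theorem unrClass_intCast (L : IntermediateField ℚ_[2] (PadicAlgCl 2)) {n : ℤ} (hn : n % 4 = 1) :
    UnrClass L (n : PadicAlgCl 2) := by
  refine unrClass_of_norm_sub_one (one_mem L) ?_
  have := norm_intCast_sub_le (n := n) (m := 1) (k := 2) (by omega)
  norm_num at this ⊢
  exact this

theorem norm_odd_sub_one {A : PadicAlgCl 2} {a : ℤ} (hA : A ^ 2 = a) (ha : a % 4 = 1) :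
    ‖A‖ = 1 ∧ ‖A ^ 2 - 1‖ ≤ ‖(4 : PadicAlgCl 2)‖ := by
  refine ⟨norm_eq_one_of_sq hA (by omega), ?_⟩
  have := norm_intCast_sub_le (n := a) (m := 1) (k := 2) (by omega)
  rw [hA, norm_four]
  norm_num at this ⊢
  exact this

theorem mem_adjoin_empty_iff {p : ℕ} [Fact p.Prime] {w : PadicAlgCl p} :
    w ∈ IntermediateField.adjoin ℚ_[p] (∅ : Set (PadicAlgCl p)) ↔
      ∃ c : ℚ_[p], algebraMap ℚ_[p] (PadicAlgCl p) c = w := by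
  rw [IntermediateField.adjoin_empty, IntermediateField.mem_bot]; rfl

theorem exists_root_of_mod_eight {A : PadicAlgCl 2} {a : ℤ} (hA : A ^ 2 = a) (ha : a % 8 = 1) :
    ∃ c : ℚ_[2], algebraMap ℚ_[2] (PadicAlgCl 2) c = A := by
  rw [← mem_adjoin_empty_iff]
  refine mem_of_norm_sq_sub_lt (c := 1) ?_ (one_mem _) ?_
  · rw [hA]; exact intCast_mem _ a
  · have := norm_intCast_sub_le (n := a) (m := 1) (k := 3) (by omega)
    rw [hA, mul_one, norm_two]
    norm_num at this ⊢
    linarith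

theorem exists_padicInt {c : ℚ_[2]} (h : ‖algebraMap ℚ_[2] (PadicAlgCl 2) c‖ ≤ 1) :
    ∃ u : ℤ_[2], (u : ℚ_[2]) = c := ⟨⟨c, by rwa [PadicAlgCl.norm_extends] at h⟩, rfl⟩

theorem not_exists_root_of_mod_eight {A : PadicAlgCl 2} {a : ℤ} (hA : A ^ 2 = a)
    (ha : a % 8 ≠ 1) (ha' : a % 4 ≠ 0) (c : ℚ_[2]) : algebraMap ℚ_[2] (PadicAlgCl 2) c ≠ A := by
  rintro rfl
  have h1 : ‖algebraMap ℚ_[2] (PadicAlgCl 2) c‖ ^ 2 ≤ 1 := by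
    rw [← norm_pow, hA]; exact norm_intCast_le_one a
  obtain ⟨u, rfl⟩ := exists_padicInt ((sq_le_one_iff₀ (norm_nonneg _)).1 h1)
  have h2 : u ^ 2 = (a : ℤ_[2]) := by
    have : algebraMap ℚ_[2] (PadicAlgCl 2) ((u ^ 2 : ℤ_[2]) : ℚ_[2])
      = algebraMap ℚ_[2] (PadicAlgCl 2) ((a : ℤ_[2]) : ℚ_[2]) := by
      rw [PadicInt.coe_pow, PadicInt.coe_intCast, map_pow, hA, map_intCast]
    exact PadicInt.ext ((algebraMap ℚ_[2] (PadicAlgCl 2)).injective this)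
  have h3 := congrArg (PadicInt.toZModPow 3) h2
  rw [map_pow, map_intCast] at h3
  have h4 : ∀ z : ZMod (2 ^ 3), z ^ 2 = 0 ∨ z ^ 2 = 1 ∨ z ^ 2 = 4 := by decide
  have h5 : ∀ m : ℤ, (a : ZMod (2 ^ 3)) = m → a % 8 = m % 8 := by
    intro m hm
    have := (ZMod.intCast_eq_intCast_iff_dvd_sub a m (2 ^ 3)).1 hm
    norm_num at this
    omega
  rcases h4 (PadicInt.toZModPow 3 u) with h | h | h <;> rw [h3] at h
  · have := h5 0 (by simpa using h); omega
  · have := h5 1 (by simpa using h); omega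
  · have := h5 4 (by simpa using h); omega

/-- The square classes of ℚ₂ are generated by -1, 2 and 5, and 5 ≡ 1 mod 4 is unramified. The
multiplier w is rational, so the same sign works for every L. -/
theorem exists_sign_unrClass {c : ℚ_[2]} (hc : c ≠ 0) :
    ∃ s : ℚ, (s = 1 ∨ s = -1 ∨ s = 2 ∨ s = -2) ∧
      ∀ L : IntermediateField ℚ_[2] (PadicAlgCl 2),
        UnrClass L ((s : PadicAlgCl 2) * algebraMap ℚ_[2] (PadicAlgCl 2) c) := by
  have h20 : (2 : ℚ_[2]) ≠ 0 := two_ne_zero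
  set v := c.valuation with hv
  have hu1 : ‖c * 2 ^ (-v)‖ = 1 := by
    have h2 : ‖(2 : ℚ_[2])‖ = 2⁻¹ := by simpa using Padic.norm_p (p := 2)
    rw [norm_mul, Padic.norm_eq_zpow_neg_valuation hc, norm_zpow, h2, ← hv, inv_zpow', neg_neg]
    push_cast
    rw [← zpow_add₀ two_ne_zero, neg_add_cancel, zpow_zero]
  set u : ℤ_[2] := ⟨c * 2 ^ (-v), hu1.le⟩ with hu
  have huc : c = (u : ℚ_[2]) * 2 ^ v := by
    rw [hu]
    simp only
    rw [mul_assoc, ← zpow_add₀ h20, neg_add_cancel, zpow_zero, mul_one]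
  have hunit : IsUnit u := PadicInt.isUnit_iff.2 hu1
  have hz : ∀ z : ZMod (2 ^ 2), IsUnit z → z = 1 ∨ -z = 1 := by decide
  have hker : ∀ w : ℤ_[2], PadicInt.toZModPow 2 w = 0 →
      ‖algebraMap ℚ_[2] (PadicAlgCl 2) (w : ℚ_[2])‖ ≤ 4⁻¹ := by
    intro w hw
    have h1 : w ∈ RingHom.ker (PadicInt.toZModPow (p := 2) 2) := hw
    rw [PadicInt.ker_toZModPow, ← PadicInt.norm_le_pow_iff_mem_span_pow] at h1
    rw [PadicAlgCl.norm_extends]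
    refine le_trans h1 (by norm_num)
  have he : ∃ e : ℤ, (e = 1 ∨ e = -1) ∧
      ‖(e : PadicAlgCl 2) * algebraMap ℚ_[2] (PadicAlgCl 2) (u : ℚ_[2]) - 1‖ ≤ 4⁻¹ := by
    rcases hz _ (hunit.map (PadicInt.toZModPow 2)) with h | h
    · refine ⟨1, Or.inl rfl, ?_⟩
      have := hker (u - 1) (by rw [map_sub, h, map_one, sub_self])
      rw [PadicInt.coe_sub, PadicInt.coe_one, map_sub, map_one] at this
      rwa [Int.cast_one, one_mul]
    · refine ⟨-1, Or.inr rfl, ?_⟩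
      have := hker (-u - 1) (by rw [map_sub, map_neg, h, map_one, sub_self])
      rw [PadicInt.coe_sub, PadicInt.coe_neg, PadicInt.coe_one, map_sub, map_neg, map_one] at this
      rwa [Int.cast_neg, Int.cast_one, neg_one_mul]
  obtain ⟨e, he, hle⟩ := he
  have h20' : (2 : PadicAlgCl 2) ≠ 0 := two_ne_zero
  rcases Int.even_or_odd' v with ⟨m, hm | hm⟩
  · refine ⟨e, by rcases he with rfl | rfl <;> simp, fun L => ?_⟩
    refine unrClass_of_norm_sub_one (w := 2 ^ (-m)) (zpow_mem (ofNat_mem L 2) _) ?_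
    convert hle using 3
    rw [huc, hm, map_mul, map_zpow₀, map_ofNat, Rat.cast_intCast, ← zpow_natCast, ← zpow_mul]
    rw [show (2 : PadicAlgCl 2) ^ (-m * ((2 : ℕ) : ℤ)) * (e * (algebraMap ℚ_[2] (PadicAlgCl 2) u *
      2 ^ (2 * m))) = e * algebraMap ℚ_[2] (PadicAlgCl 2) u *
      (2 ^ (-m * ((2 : ℕ) : ℤ)) * 2 ^ (2 * m)) by ring, ← zpow_add₀ h20',
      show -m * ((2 : ℕ) : ℤ) + 2 * m = 0 by push_cast; ring, zpow_zero, mul_one]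
  · refine ⟨2 * e, by rcases he with rfl | rfl <;> simp, fun L => ?_⟩
    refine unrClass_of_norm_sub_one (w := 2 ^ (-m - 1)) (zpow_mem (ofNat_mem L 2) _) ?_
    convert hle using 3
    rw [huc, hm, map_mul, map_zpow₀, map_ofNat, Rat.cast_mul, Rat.cast_intCast, Rat.cast_ofNat,
      ← zpow_natCast, ← zpow_mul]
    rw [show (2 : PadicAlgCl 2) ^ ((-m - 1) * ((2 : ℕ) : ℤ)) * (2 * e *
      (algebraMap ℚ_[2] (PadicAlgCl 2) u *
      2 ^ (2 * m + 1))) = e * algebraMap ℚ_[2] (PadicAlgCl 2) u *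
      (2 ^ ((-m - 1) * ((2 : ℕ) : ℤ)) * (2 ^ (2 * m + 1) * 2)) by ring, ← zpow_add_one₀ h20',
      ← zpow_add₀ h20',
      show (-m - 1) * ((2 : ℕ) : ℤ) + (2 * m + 1 + 1) = 0 by push_cast; ring, zpow_zero, mul_one]

/-- Hilbert 90 in explicit form: ββ' = r² gives β(β + β' + 2r) = (β + r)², so β is rational up to
squares, unless β = -r, which is rational already. -/
theorem exists_sign_unrClass_of_norm {L : IntermediateField ℚ_[2] (PadicAlgCl 2)}
    {β β' : PadicAlgCl 2} {r t : ℚ_[2]} (hβ : β ∈ L) (hβ0 : β ≠ 0)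
    (hN : β * β' = algebraMap ℚ_[2] (PadicAlgCl 2) r ^ 2)
    (hT : β + β' = algebraMap ℚ_[2] (PadicAlgCl 2) t) :
    ∃ s : ℚ, (s = 1 ∨ s = -1 ∨ s = 2 ∨ s = -2) ∧ UnrClass L ((s : PadicAlgCl 2) * β) := by
  set ι := algebraMap ℚ_[2] (PadicAlgCl 2) with hι
  by_cases h0 : β + ι r = 0
  · have h1 : β = ι (-r) := by rw [map_neg]; linear_combination h0
    have hr : -r ≠ 0 := by
      intro h; rw [h, map_zero] at h1; exact hβ0 h1
    obtain ⟨s, hs, hu⟩ := exists_sign_unrClass hr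
    exact ⟨s, hs, by rw [h1]; exact hu L⟩
  · have h1 : β * ι (t + 2 * r) = (β + ι r) ^ 2 := by
      rw [map_add, map_mul, ← hT, map_ofNat]; linear_combination hN
    have hc : t + 2 * r ≠ 0 := by
      intro h
      rw [h, map_zero, mul_zero, eq_comm] at h1
      exact h0 (pow_eq_zero_iff two_ne_zero |>.1 h1)
    obtain ⟨s, hs, hu⟩ := exists_sign_unrClass hc
    have hs0 : (s : PadicAlgCl 2) ≠ 0 := by
      have : s ≠ 0 := by rcases hs with rfl | rfl | rfl | rfl <;> norm_num
      exact ratCast_ne_zero' this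
    refine ⟨s, hs, (hu L).of_mul_eq_sq (mul_mem (SubfieldClass.ratCast_mem _ _)
      (IntermediateField.algebraMap_mem _ _)) (c := s * (β + ι r)) (mul_mem
      (SubfieldClass.ratCast_mem _ _) (add_mem hβ (IntermediateField.algebraMap_mem _ _)))
      (mul_ne_zero hs0 h0) ?_⟩
    linear_combination (s : PadicAlgCl 2) ^ 2 * h1

/-- For ±2 the valuation is odd and w² cannot correct it. For -1 the product (w - 1)(w + 1) would
have valuation 1; its factors differ by 2, so both would have valuation 1/2. -/
theorem not_unrClass_of_hasIntVal {L : IntermediateField ℚ_[2] (PadicAlgCl 2)} (hL : HasIntVal L)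
    {s : ℚ} (hs : s = -1 ∨ s = 2 ∨ s = -2) : ¬ UnrClass L (s : PadicAlgCl 2) := by
  intro h
  obtain ⟨w, hw, hw1⟩ := h.exists_norm_sub_one
  have hns : ∀ k : ℤ, (2 : ℝ) ^ (2 * k) ≠ 2 ∧ (2 : ℝ) ^ (2 * k) ≠ 2⁻¹ := by
    intro k
    have inj := zpow_right_injective₀ (a := (2 : ℝ)) (by norm_num) (by norm_num)
    constructor
    · intro h
      have : 2 * k = 1 := inj (by simpa using h)
      omega
    · intro h
      have : 2 * k = -1 := inj (by simpa using h)
      omega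
  have hval : ∀ w ∈ L, ‖w‖ ^ 2 ≠ 2 ∧ ‖w‖ ^ 2 ≠ 2⁻¹ := by
    intro w hw
    by_cases h0 : w = 0
    · rw [h0, norm_zero]; norm_num
    · obtain ⟨n, hn⟩ := hL w hw h0
      have := hns n
      rw [hn, ← zpow_natCast, ← zpow_mul, mul_comm]
      exact_mod_cast this
  have hone : ‖w ^ 2 * (s : PadicAlgCl 2)‖ = 1 := by
    have h1 : ‖w ^ 2 * (s : PadicAlgCl 2)‖ ≤ max 4⁻¹ 1 := by
      have := norm_add_le_max (w ^ 2 * (s : PadicAlgCl 2) - 1) 1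
      rw [sub_add_cancel, norm_one] at this
      exact this.trans (max_le_max hw1 le_rfl)
    have h2 : (1 : ℝ) ≤ max ‖w ^ 2 * (s : PadicAlgCl 2)‖ 4⁻¹ := by
      have := norm_sub_le_max (w ^ 2 * (s : PadicAlgCl 2)) (w ^ 2 * (s : PadicAlgCl 2) - 1)
      rw [sub_sub_cancel, norm_one] at this
      exact this.trans (max_le_max le_rfl hw1)
    refine le_antisymm (h1.trans (by norm_num)) ?_
    rcases le_max_iff.1 h2 with h3 | h3
    · exact h3
    · norm_num at h3
  have h2case : s = 2 ∨ s = -2 → False := by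
    intro h2
    have : ‖(s : PadicAlgCl 2)‖ = 2⁻¹ := by
      rcases h2 with rfl | rfl
      · push_cast; exact norm_two
      · push_cast; rw [norm_neg]; exact norm_two
    rw [norm_mul, this, norm_pow] at hone
    exact (hval w hw).1 (by linarith)
  rcases hs with rfl | hs
  · push_cast at hw1
    have h1 : ‖(w - 1) * (w + 1)‖ = 2⁻¹ := by
      rw [show (w - 1) * (w + 1) = -2 - (w ^ 2 * -1 - 1) by ring]
      have hne : ‖-2 - (w ^ 2 * -1 - 1)‖ = ‖(-2 : PadicAlgCl 2)‖ := by
        rw [sub_eq_add_neg]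
        rw [IsUltrametricDist.norm_add_eq_max_of_norm_ne_norm]
        · rw [norm_neg, norm_neg, norm_two]
          exact max_eq_left (hw1.trans (by norm_num))
        · rw [norm_neg, norm_neg, norm_two]
          intro h
          rw [← h] at hw1
          norm_num at hw1
      rw [hne, norm_neg, norm_two]
    rw [norm_mul] at h1
    have h3 : ‖w + 1‖ ≤ max ‖w - 1‖ 2⁻¹ := by
      rw [show w + 1 = (w - 1) + 2 by ring, ← norm_two]; exact norm_add_le_max _ _
    have h4 : ‖w - 1‖ ≤ max ‖w + 1‖ 2⁻¹ := by
      rw [show w - 1 = (w + 1) - 2 by ring, ← norm_two]; exact norm_sub_le_max _ _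
    rcases le_or_gt ‖w - 1‖ 2⁻¹ with h5 | h5
    · rw [max_eq_right h5] at h3
      nlinarith [norm_nonneg (w - 1), norm_nonneg (w + 1)]
    · have h6 : ‖w - 1‖ = ‖w + 1‖ := by
        rw [max_eq_left h5.le] at h3
        refine le_antisymm ?_ h3
        rcases le_max_iff.1 h4 with h7 | h7
        · exact h7
        · linarith
      rw [← h6, ← sq] at h1
      exact (hval _ (sub_mem hw (one_mem L))).2 h1
  · exact h2case hs

end

end Redei

/-! ### The prime 2: ramified quadratic extensions, and the class of β. -/

namespace Redei

noncomputable section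

local notation "ι" => algebraMap ℚ_[2] (PadicAlgCl 2)

theorem padic_le_one_of_sq_le_two {v : ℚ_[2]} (h : ‖v‖ ^ 2 ≤ 2) : ‖v‖ ≤ 1 := by
  have h2 : ‖v‖ < (2 : ℕ) ^ ((0 : ℤ) + 1) := by
    norm_num; nlinarith [norm_nonneg v]
  simpa using (Padic.norm_le_pow_iff_norm_lt_pow_add_one v 0).2 h2

/-- Counted in multiples of the valuation of ϖ, u has even and vϖ odd valuation, so they never
cancel. Squared absolute values keep the exponents integral. -/
theorem sq_norm_add_mul_uniformizer {ϖ : PadicAlgCl 2} (hϖ : ‖ϖ‖ ^ 2 = 2⁻¹) (u v : ℚ_[2]) :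
    ‖ι u + ι v * ϖ‖ ^ 2 = max (‖u‖ ^ 2) (‖v‖ ^ 2 * 2⁻¹) := by
  have hv : ‖ι v * ϖ‖ ^ 2 = ‖v‖ ^ 2 * 2⁻¹ := by
    rw [norm_mul, mul_pow, PadicAlgCl.norm_extends, hϖ]
  have hu : ‖ι u‖ ^ 2 = ‖u‖ ^ 2 := by rw [PadicAlgCl.norm_extends]
  by_cases hv0 : v = 0
  · rw [hv0]; simp
  by_cases hu0 : u = 0
  · rw [hu0, map_zero, zero_add, hv, norm_zero, max_eq_right (by rw [zero_pow two_ne_zero]; positivity)]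
  have hne : ‖ι u‖ ≠ ‖ι v * ϖ‖ := by
    intro h
    obtain ⟨n, hn⟩ := exists_norm_eq_zpow hu0
    obtain ⟨m, hm⟩ := exists_norm_eq_zpow hv0
    have h2 : ‖u‖ ^ 2 = ‖v‖ ^ 2 * 2⁻¹ := by rw [← hu, h, hv]
    rw [hn, hm, ← zpow_natCast, ← zpow_mul, ← zpow_natCast, ← zpow_mul] at h2
    push_cast at h2
    rw [← zpow_sub_one₀ two_ne_zero] at h2
    have := zpow_right_injective₀ (a := (2 : ℝ)) (by norm_num) (by norm_num) h2
    omega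
  rw [IsUltrametricDist.norm_add_eq_max_of_norm_ne_norm hne, ← hu, ← hv]
  rcases le_total ‖ι u‖ ‖ι v * ϖ‖ with h | h
  · rw [max_eq_right h, max_eq_right (by gcongr)]
  · rw [max_eq_left h, max_eq_left (by gcongr)]

/-- The norm of √a, or of 1 + √a when a ≡ 3 mod 4, is 2 times a unit. -/
theorem exists_uniformizer {A : PadicAlgCl 2} {a : ℤ} (hA : A ^ 2 = a)
    (ha : a % 4 = 2 ∨ a % 4 = 3) : ∃ e : ℤ, ‖A + e‖ ^ 2 = 2⁻¹ := by
  have hn : ∀ n : ℤ, n % 4 = 2 → ‖(n : PadicAlgCl 2)‖ = 2⁻¹ := by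
    intro n hn
    rw [show n = 2 * (n / 2) by omega, Int.cast_mul, norm_mul,
      norm_intCast_eq_one (p := 2) (c := n / 2) (by omega), mul_one, Int.cast_ofNat, norm_two]
  rcases ha with ha | ha
  · exact ⟨0, by rw [Int.cast_zero, add_zero, ← norm_pow, hA, hn a ha]⟩
  · refine ⟨1, ?_⟩
    have hA0 : A ∉ IntermediateField.adjoin ℚ_[2] (∅ : Set (PadicAlgCl 2)) := by
      rw [mem_adjoin_empty_iff]
      rintro ⟨c, hc⟩
      exact not_exists_root_of_mod_eight hA (by omega) (by omega) c hc
    have h1 := norm_conj hA0 (sq_mem_adjoin (a := a) (by rw [hA, Rat.cast_intCast])) (one_mem _)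
      (one_mem _)
    rw [one_mul] at h1
    have h2 : ‖(1 - A) * (1 + A)‖ = 2⁻¹ := by
      rw [show (1 - A) * (1 + A) = ((1 - a : ℤ) : PadicAlgCl 2) by push_cast; rw [← hA]; ring]
      exact hn _ (by omega)
    rw [norm_mul, h1] at h2
    rw [Int.cast_one, add_comm, sq, h2]

/-- The ring of integers of `ℚ₂(√a)` for `a ≡ 2, 3 mod 4`. -/
theorem norm_coord_le_one {A : PadicAlgCl 2} {a : ℤ} (hA : A ^ 2 = a)
    (ha : a % 4 = 2 ∨ a % 4 = 3) {u v : ℚ_[2]} (h : ‖ι u + ι v * A‖ ≤ 1) :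
    ‖u‖ ≤ 1 ∧ ‖v‖ ≤ 1 := by
  obtain ⟨e, he⟩ := exists_uniformizer hA ha
  have h1 := sq_norm_add_mul_uniformizer he (u - e * v) v
  rw [map_sub, map_mul, map_intCast,
    show ι u - e * ι v + ι v * (A + e) = ι u + ι v * A by ring] at h1
  have h2 : max (‖u - e * v‖ ^ 2) (‖v‖ ^ 2 * 2⁻¹) ≤ 1 := by
    rw [← h1]; exact pow_le_one₀ (norm_nonneg _) h
  have h3 := (le_max_left _ _).trans h2
  have h4 := (le_max_right _ _).trans h2
  have hv : ‖v‖ ≤ 1 := padic_le_one_of_sq_le_two (by linarith)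
  refine ⟨?_, hv⟩
  have h5 : ‖u - e * v‖ ≤ 1 := (sq_le_one_iff₀ (norm_nonneg _)).1 h3
  rw [show u = (u - e * v) + e * v by ring]
  refine (Padic.nonarchimedean _ _).trans (max_le h5 ?_)
  rw [norm_mul]
  exact mul_le_one₀ (Padic.norm_int_le_one e) (norm_nonneg _) hv

theorem exists_coord {A : PadicAlgCl 2} {a : ℤ} (hA : A ^ 2 = a) {w : PadicAlgCl 2}
    (hw : w ∈ IntermediateField.adjoin ℚ_[2] {A}) : ∃ u v : ℚ_[2], w = ι u + ι v * A := by
  have hw' : w ∈ Algebra.adjoin ℚ_[2] {A} := by rw [← adjoin_toSubalgebra_eq]; exact hw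
  exact mem_adjoin_singleton_sqrt (c := (a : ℚ_[2])) (by rw [hA, map_intCast]) hw'

theorem exists_padicInt_coord {A : PadicAlgCl 2} {a : ℤ} (hA : A ^ 2 = a)
    (ha : a % 4 = 2 ∨ a % 4 = 3) {w : PadicAlgCl 2}
    (hw : w ∈ IntermediateField.adjoin ℚ_[2] {A}) (hw1 : ‖w‖ ≤ 1) :
    ∃ u v : ℤ_[2], w = ι u + ι v * A := by
  obtain ⟨u, v, rfl⟩ := exists_coord hA hw
  obtain ⟨hu, hv⟩ := norm_coord_le_one hA ha hw1
  exact ⟨⟨u, hu⟩, ⟨v, hv⟩, rfl⟩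

theorem coord_ext {A : PadicAlgCl 2} (hA : ∀ c : ℚ_[2], ι c ≠ A) {u v u' v' : ℚ_[2]}
    (h : ι u + ι v * A = ι u' + ι v' * A) : u = u' ∧ v = v' := by
  have hv : v = v' := by
    by_contra hne
    have hne' : ι (v - v') ≠ 0 := (map_ne_zero _).2 (sub_ne_zero.2 hne)
    apply hA ((u' - u) / (v - v'))
    rw [map_div₀, div_eq_iff hne', map_sub, map_sub]
    linear_combination -h
  subst hv
  exact ⟨(ι).injective (add_right_cancel h), rfl⟩

theorem adjoin_pair_eq_of_right {A B : PadicAlgCl 2} (hB : ∃ c : ℚ_[2], ι c = B) :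
    IntermediateField.adjoin ℚ_[2] {A, B} = IntermediateField.adjoin ℚ_[2] {A} := by
  obtain ⟨c, rfl⟩ := hB
  refine le_antisymm (IntermediateField.adjoin_le_iff.2 ?_) (IntermediateField.adjoin.mono _ _ _
    (by simp))
  rintro w (rfl | rfl)
  · exact IntermediateField.subset_adjoin _ _ rfl
  · exact IntermediateField.algebraMap_mem _ _

/-- The integers of ℚ₂(A) are ℤ₂[A], so the congruence modulo 4 becomes two equations between
coordinates, which are checked modulo 8. The cases that survive are those where sa is a unit ≡ 1 mod
4 up to squares. -/
theorem sign_of_unrClass_ramified {A : PadicAlgCl 2} {a : ℤ} (hA : A ^ 2 = a)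
    (ha : a % 4 = 2 ∨ a % 4 = 3) {s : ℤ} (hs : s = -1 ∨ s = 2 ∨ s = -2)
    (h : UnrClass (IntermediateField.adjoin ℚ_[2] {A}) (s : PadicAlgCl 2)) :
    (s = -1 ∧ a % 4 = 3) ∨ (s = 2 ∧ a % 8 = 2) ∨ (s = -2 ∧ a % 8 = 6) := by
  obtain ⟨w, hw, hw1⟩ := h.exists_norm_sub_one
  have hAn := not_exists_root_of_mod_eight hA (by omega) (by omega)
  have hs0 : (s : PadicAlgCl 2) ≠ 0 := by rcases hs with rfl | rfl | rfl <;> norm_num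
  have hc1 : ‖(w ^ 2 * s - 1) / 4‖ ≤ 1 := by
    rw [norm_div, norm_four]
    exact div_le_one_of_le₀ hw1 (by norm_num)
  have h4 : (4 : PadicAlgCl 2) ∈ IntermediateField.adjoin ℚ_[2] {A} := ofNat_mem _ 4
  obtain ⟨c₀, c₁, hc⟩ := exists_padicInt_coord hA ha (div_mem (sub_mem (mul_mem (pow_mem hw 2)
    (intCast_mem _ s)) (one_mem _)) h4) hc1
  -- For s = ±2 the multiplier w is not integral, but sw is.
  have hsq : (s * w) ^ 2 = s + 4 * s * (ι c₀ + ι c₁ * A) := by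
    rw [← hc]; field_simp; ring
  have hW1 : ‖s * w‖ ≤ 1 := by
    rw [← sq_le_one_iff₀ (norm_nonneg _), ← norm_pow, hsq, ← hc,
      show (s : PadicAlgCl 2) + 4 * s * ((w ^ 2 * s - 1) / 4)
        = s * (1 + 4 * ((w ^ 2 * s - 1) / 4)) by ring, norm_mul]
    refine mul_le_one₀ (norm_intCast_le_one s) (norm_nonneg _) ((norm_add_le_max _ _).trans
      (max_le (by simp) ?_))
    rw [norm_mul]
    exact mul_le_one₀ (by rw [norm_four]; norm_num) (norm_nonneg _) hc1
  obtain ⟨u, v, huv⟩ := exists_padicInt_coord hA ha (mul_mem (intCast_mem _ s) hw) hW1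
  rw [huv] at hsq
  have hco := coord_ext hAn (u := u ^ 2 + a * v ^ 2) (v := 2 * u * v)
    (u' := s + 4 * s * c₀) (v' := 4 * s * c₁) (by
      simp only [map_add, map_mul, map_pow, map_intCast, map_ofNat]
      rw [← hA]
      linear_combination hsq)
  have h1 : u ^ 2 + a * v ^ 2 = s + 4 * s * c₀ := PadicInt.ext (by
    simpa only [PadicInt.coe_add, PadicInt.coe_mul, PadicInt.coe_pow, PadicInt.coe_intCast,
      show ((4 : ℤ_[2]) : ℚ_[2]) = 4 from rfl, show ((2 : ℤ_[2]) : ℚ_[2]) = 2 from rfl] using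
      hco.1)
  have h2 : 2 * u * v = 4 * s * c₁ := PadicInt.ext (by
    simpa only [PadicInt.coe_add, PadicInt.coe_mul, PadicInt.coe_pow, PadicInt.coe_intCast,
      show ((4 : ℤ_[2]) : ℚ_[2]) = 4 from rfl, show ((2 : ℤ_[2]) : ℚ_[2]) = 2 from rfl] using
      hco.2)
  have e1 := congrArg (PadicInt.toZModPow 3) h1
  have e2 := congrArg (PadicInt.toZModPow 3) h2
  simp only [map_add, map_mul, map_pow, map_intCast, map_ofNat] at e1 e2
  generalize PadicInt.toZModPow 3 u = u at e1 e2
  generalize PadicInt.toZModPow 3 v = v at e1 e2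
  generalize PadicInt.toZModPow 3 c₀ = c₀ at e1 e2
  generalize PadicInt.toZModPow 3 c₁ = c₁ at e1 e2
  have h8 : (8 : ZMod (2 ^ 3)) = 0 := by decide
  have ha8 : ∀ m : ℤ, (a : ZMod (2 ^ 3)) = m → a % 8 = m % 8 := by
    intro m hm
    have := (ZMod.intCast_eq_intCast_iff_dvd_sub a m (2 ^ 3)).1 hm
    norm_num at this
    omega
  have ha8' : ∀ m : ℤ, a % 8 = m % 8 → (a : ZMod (2 ^ 3)) = m := by
    intro m hm
    refine (ZMod.intCast_eq_intCast_iff_dvd_sub a m (2 ^ 3)).2 ?_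
    norm_num
    omega
  rcases hs with rfl | rfl | rfl
  · left
    refine ⟨rfl, ?_⟩
    have e3 : 2 * (u ^ 2 + a * v ^ 2 + 1) = 0 := by
      rw [e1]; push_cast; linear_combination (-c₀) * h8
    have e4 : 4 * u * v = 0 := by
      rw [show 4 * u * v = 2 * (2 * u * v) by ring, e2]; push_cast; linear_combination (-c₁) * h8
    have key : ∀ u v : ZMod (2 ^ 3), (2 * (u ^ 2 + 2 * v ^ 2 + 1) = 0 → 4 * u * v ≠ 0) ∧
      (2 * (u ^ 2 + 6 * v ^ 2 + 1) = 0 → 4 * u * v ≠ 0) := by decide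
    by_contra hne
    rcases (show a % 8 = 2 ∨ a % 8 = 6 by omega) with h' | h'
    · rw [ha8' 2 (by omega)] at e3
      exact (key u v).1 e3 e4
    · rw [ha8' 6 (by omega)] at e3
      exact (key u v).2 e3 e4
  · right; left
    refine ⟨rfl, ?_⟩
    have e3 : u ^ 2 + a * v ^ 2 = 2 := by
      rw [e1]; push_cast; linear_combination c₀ * h8
    have e4 : 2 * u * v = 0 := by
      rw [e2]; push_cast; linear_combination c₁ * h8
    have key : ∀ u v : ZMod (2 ^ 3), (u ^ 2 + 3 * v ^ 2 = 2 → 2 * u * v ≠ 0) ∧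
      (u ^ 2 + 6 * v ^ 2 = 2 → 2 * u * v ≠ 0) ∧ (u ^ 2 + 7 * v ^ 2 = 2 → 2 * u * v ≠ 0) := by decide
    by_contra hne
    rcases (show a % 8 = 3 ∨ a % 8 = 6 ∨ a % 8 = 7 by omega) with h' | h' | h'
    · rw [ha8' 3 (by omega)] at e3
      exact (key u v).1 e3 e4
    · rw [ha8' 6 (by omega)] at e3
      exact (key u v).2.1 e3 e4
    · rw [ha8' 7 (by omega)] at e3
      exact (key u v).2.2 e3 e4
  · right; right
    refine ⟨rfl, ?_⟩
    have e3 : u ^ 2 + a * v ^ 2 = -2 := by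
      rw [e1]; push_cast; linear_combination (-c₀) * h8
    have e4 : 2 * u * v = 0 := by
      rw [e2]; push_cast; linear_combination (-c₁) * h8
    have key : ∀ u v : ZMod (2 ^ 3), (u ^ 2 + 3 * v ^ 2 = -2 → 2 * u * v ≠ 0) ∧
      (u ^ 2 + 2 * v ^ 2 = -2 → 2 * u * v ≠ 0) ∧ (u ^ 2 + 7 * v ^ 2 = -2 → 2 * u * v ≠ 0) := by
        decide
    by_contra hne
    rcases (show a % 8 = 3 ∨ a % 8 = 2 ∨ a % 8 = 7 by omega) with h' | h' | h'
    · rw [ha8' 3 (by omega)] at e3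
      exact (key u v).1 e3 e4
    · rw [ha8' 2 (by omega)] at e3
      exact (key u v).2.1 e3 e4
    · rw [ha8' 7 (by omega)] at e3
      exact (key u v).2.2 e3 e4

/-- If a is a square in ℚ₂, then β itself lies in ℚ₂. If b is a square, then β has square norm and
Hilbert 90 applies. -/
theorem exists_sign_unrClass_add {a b : ℤ} {x y z : ℚ} {A B : PadicAlgCl 2} (hA : A ^ 2 = a)
    (hB : B ^ 2 = b) (h : x ^ 2 - a * y ^ 2 = b * z ^ 2) (hz : z ≠ 0) (hb0 : b ≠ 0)
    (hab : a % 8 = 1 ∨ b % 8 = 1 ∨ (a % 8 = 5 ∧ b % 8 = 5)) :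
    ∃ s : ℚ, (s = 1 ∨ s = -1 ∨ s = 2 ∨ s = -2) ∧
      UnrClass (IntermediateField.adjoin ℚ_[2] {A, B}) ((s : PadicAlgCl 2) * (x + y * A)) := by
  set L := IntermediateField.adjoin ℚ_[2] {A, B} with hL
  have hAL : A ∈ L := IntermediateField.subset_adjoin _ _ (by simp)
  have hBL : B ∈ L := IntermediateField.subset_adjoin _ _ (by simp)
  have hAq : A ^ 2 = ((a : ℚ) : PadicAlgCl 2) := by rw [hA, Rat.cast_intCast]
  have hmul := map_eqn hAq h
  have hz' := ratCast_ne_zero' (p := 2) hz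
  have hb' : (((b : ℚ)) : PadicAlgCl 2) ≠ 0 := ratCast_ne_zero' (by exact_mod_cast hb0)
  have hβ0 : (x : PadicAlgCl 2) + y * A ≠ 0 := by
    intro h0
    rw [h0, zero_mul] at hmul
    exact mul_ne_zero hb' (pow_ne_zero 2 hz') hmul.symm
  have hβL : (x : PadicAlgCl 2) + y * A ∈ L :=
    add_mem (SubfieldClass.ratCast_mem _ _) (mul_mem (SubfieldClass.ratCast_mem _ _) hAL)
  rcases hab with ha | hb | ⟨ha, hb⟩
  · obtain ⟨c, hc⟩ := exists_root_of_mod_eight hA ha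
    have e : (x : PadicAlgCl 2) + y * A = ι (x + y * c) := by
      rw [map_add, map_mul, map_ratCast, map_ratCast, hc]
    obtain ⟨s, hs, hu⟩ := exists_sign_unrClass (c := x + y * c) (by
      intro h0; rw [h0, map_zero] at e; exact hβ0 e)
    exact ⟨s, hs, by rw [e]; exact hu L⟩
  · obtain ⟨c, hc⟩ := exists_root_of_mod_eight hB hb
    refine exists_sign_unrClass_of_norm (β' := x - y * A) (r := c * z) (t := 2 * x) hβL hβ0 ?_ ?_
    · rw [hmul, map_mul, map_ratCast, hc, mul_pow, hB, Rat.cast_intCast]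
    · rw [map_mul, map_ofNat, map_ratCast]; ring
  -- Here the norm class of β is 5. The auxiliary element 3 + 2A = 1 + 4(1 + A)/2 is unramified and
  -- has norm 9 - 4a ≡ 5 mod 8, so multiplying β by it gives square norm.
  · have h3 : ‖((9 - 4 * a : ℤ) : PadicAlgCl 2) * b - 1‖ < ‖(4 : PadicAlgCl 2)‖ := by
      have hmod : (9 - 4 * a) * b % 8 = 1 := by
        obtain ⟨k, rfl⟩ : ∃ k, a = 8 * k + 5 := ⟨a / 8, by omega⟩
        obtain ⟨l, rfl⟩ : ∃ l, b = 8 * l + 5 := ⟨b / 8, by omega⟩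
        ring_nf; omega
      have := norm_intCast_sub_le (n := (9 - 4 * a) * b) (m := 1) (k := 3) (by omega)
      rw [norm_four]
      norm_num at this ⊢
      linarith
    obtain ⟨d, hd, hd2⟩ := exists_sqrt_of_norm_sub_one_lt
      (L := IntermediateField.adjoin ℚ_[2] (∅ : Set (PadicAlgCl 2)))
      (mul_mem (intCast_mem _ _) (intCast_mem _ _)) h3
    obtain ⟨r, rfl⟩ := mem_adjoin_empty_iff.1 hd
    have h3L : (3 + 2 * A : PadicAlgCl 2) ∈ L := by
      have h2 : (2 : PadicAlgCl 2) ∈ L := ofNat_mem L 2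
      have h3 : (3 : PadicAlgCl 2) ∈ L := ofNat_mem L 3
      exact add_mem h3 (mul_mem h2 hAL)
    have hη : UnrClass L (3 + 2 * A) := by
      refine unrClass_of_norm_sub_one (one_mem L) ?_
      obtain ⟨h1, h4⟩ := norm_odd_sub_one hA (by omega)
      have h5 := (UnrClass.of_exists (p := 2) A (w := 1) (s := 1) (by simp [h1]) (by simp)
        (by simpa using h4)).1
      rw [one_mul] at h5
      rw [show 1 ^ 2 * (3 + 2 * A) - 1 = 4 * ((1 + A) / 2) by ring, norm_mul, norm_four]
      exact mul_le_of_le_one_right (by norm_num) h5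
    have hη0 := hη.ne_zero
    obtain ⟨s, hs, hu⟩ := exists_sign_unrClass_of_norm (L := L) (β := (x + y * A) * (3 + 2 * A))
      (β' := (x - y * A) * (3 - 2 * A)) (r := r * z) (t := 2 * (3 * x + 2 * y * a))
      (mul_mem hβL h3L) (mul_ne_zero hβ0 hη0) (by
        rw [map_mul, map_ratCast, mul_pow, hd2]
        push_cast at hmul ⊢
        rw [← hA]
        linear_combination (9 - 4 * A ^ 2) * hmul) (by
        simp only [map_mul, map_add, map_ofNat, map_ratCast, map_intCast]
        rw [← hA]; ring)
    refine ⟨s, hs, ?_⟩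
    rw [← mul_assoc] at hu
    exact (UnrClass.mul_iff hη h3L).1 hu

/-- As ay² = x² - bz² is a norm from the unramified field ℚ₂(√b), it has even valuation. This
removes a case in which minimal ramification imposes no condition at 2. -/
theorem not_solution_of_mod {a b : ℤ} {x y z : ℚ} (ha : a % 4 = 2) (hb : b % 8 = 5)
    (h : x ^ 2 - a * y ^ 2 = b * z ^ 2) (hy : y ≠ 0) : False := by
  obtain ⟨B, hB⟩ := IsAlgClosed.exists_pow_nat_eq ((b : ℤ) : PadicAlgCl 2) (n := 2) two_pos
  have hBq : B ^ 2 = ((b : ℚ) : PadicAlgCl 2) := by rw [hB, Rat.cast_intCast]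
  have hBn : B ∉ IntermediateField.adjoin ℚ_[2] (∅ : Set (PadicAlgCl 2)) := by
    rw [mem_adjoin_empty_iff]
    rintro ⟨c, hc⟩
    exact not_exists_root_of_mod_eight hB (by omega) (by omega) c hc
  obtain ⟨hB1, hB4⟩ := norm_odd_sub_one hB (by omega)
  have hval := hasIntVal_singleton hBq hB1 hB4
  have e : ((x : PadicAlgCl 2) + z * B) * (x - z * B) = (a : ℤ) * y ^ 2 := by
    have := map_eqn (p := 2) (a := b) (b := a) (x := x) (y := z) (z := y) hBq (by linarith)
    rwa [Rat.cast_intCast] at this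
  have hconj := norm_conj hBn (sq_mem_adjoin hBq) (SubfieldClass.ratCast_mem _ x)
    (SubfieldClass.ratCast_mem _ z)
  have e2 := congrArg norm e
  have han : ‖(a : PadicAlgCl 2)‖ = 2⁻¹ := by
    rw [show a = 2 * (a / 2) by omega, Int.cast_mul, norm_mul,
      norm_intCast_eq_one (p := 2) (c := a / 2) (by omega), mul_one, Int.cast_ofNat, norm_two]
  rw [norm_mul, hconj, norm_mul, han, norm_pow, ← sq] at e2
  obtain ⟨k, hk⟩ := exists_norm_ratCast (p := 2) hy
  have hne : (x : PadicAlgCl 2) + z * B ≠ 0 := by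
    intro h0
    rw [h0, norm_zero, hk] at e2
    have : (0 : ℝ) < 2⁻¹ * ((2 : ℕ) ^ k) ^ 2 := by positivity
    rw [← e2] at this
    norm_num at this
  obtain ⟨n, hn⟩ := hval _ (add_mem (SubfieldClass.ratCast_mem _ x)
    (mul_mem (SubfieldClass.ratCast_mem _ z) (IntermediateField.subset_adjoin _ _ rfl))) hne
  rw [hn, hk, ← zpow_natCast, ← zpow_mul, ← zpow_natCast, ← zpow_mul, mul_comm (2⁻¹ : ℝ)] at e2
  push_cast at e2
  rw [← zpow_sub_one₀ two_ne_zero] at e2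
  have := zpow_right_injective₀ (a := (2 : ℝ)) (by norm_num) (by norm_num) e2
  omega

end

end Redei

/-! ### Biquadratic norms, and classes of conductor dividing 2. -/

namespace Redei

noncomputable section

local notation "ι" => algebraMap ℚ_[2] (PadicAlgCl 2)

/-- `c` is a norm from the biquadratic algebra `R(√β)(√b)` over `R`. -/
def IsBiquadraticNorm {R : Type*} [CommRing R] (b β c : R) : Prop :=
  ∃ V : QuadraticAlgebra (QuadraticAlgebra R β 0) (algebraMap R _ b) 0,
    QuadraticAlgebra.norm (QuadraticAlgebra.norm V) = c

theorem norm_norm_mk {R : Type*} [CommRing R] {b β : R} (u₁ u₂ v₁ v₂ : R) :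
    QuadraticAlgebra.norm (QuadraticAlgebra.norm
      (⟨⟨u₁, u₂⟩, ⟨v₁, v₂⟩⟩ : QuadraticAlgebra (QuadraticAlgebra R β 0) (algebraMap R _ b) 0)) =
      (u₁ ^ 2 + β * u₂ ^ 2 - b * (v₁ ^ 2 + β * v₂ ^ 2)) ^ 2
        - β * (2 * u₁ * u₂ - 2 * b * v₁ * v₂) ^ 2 := by
  have inner : QuadraticAlgebra.norm
      (⟨⟨u₁, u₂⟩, ⟨v₁, v₂⟩⟩ : QuadraticAlgebra (QuadraticAlgebra R β 0) (algebraMap R _ b) 0) =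
      ⟨u₁ ^ 2 + β * u₂ ^ 2 - b * (v₁ ^ 2 + β * v₂ ^ 2), 2 * u₁ * u₂ - 2 * b * v₁ * v₂⟩ := by
    rw [QuadraticAlgebra.norm_def, QuadraticAlgebra.algebraMap_eq]
    ext <;> simp <;> ring
  rw [inner, QuadraticAlgebra.norm_def]
  ring

/-- The norm form in four variables is transported by ring homomorphisms and makes sense before the
algebra is known to be a field. -/
theorem isBiquadraticNorm_iff {R : Type*} [CommRing R] {b β c : R} :
    IsBiquadraticNorm b β c ↔ ∃ u₁ u₂ v₁ v₂ : R,
      (u₁ ^ 2 + β * u₂ ^ 2 - b * (v₁ ^ 2 + β * v₂ ^ 2)) ^ 2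
        - β * (2 * u₁ * u₂ - 2 * b * v₁ * v₂) ^ 2 = c := by
  constructor
  · rintro ⟨⟨⟨u₁, u₂⟩, ⟨v₁, v₂⟩⟩, hV⟩
    exact ⟨u₁, u₂, v₁, v₂, by rw [← norm_norm_mk, hV]⟩
  · rintro ⟨u₁, u₂, v₁, v₂, h⟩
    exact ⟨⟨⟨u₁, u₂⟩, ⟨v₁, v₂⟩⟩, by rw [norm_norm_mk, h]⟩

namespace IsBiquadraticNorm

theorem mul {R : Type*} [CommRing R] {b β c c' : R} (h : IsBiquadraticNorm b β c)
    (h' : IsBiquadraticNorm b β c') : IsBiquadraticNorm b β (c * c') := by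
  obtain ⟨V, rfl⟩ := h
  obtain ⟨V', rfl⟩ := h'
  exact ⟨V * V', by rw [map_mul, map_mul]⟩

theorem pow_four {R : Type*} [CommRing R] {b β : R} (r : R) : IsBiquadraticNorm b β (r ^ 4) :=
  isBiquadraticNorm_iff.2 ⟨r, 0, 0, 0, by ring⟩

theorem mul_sq {R : Type*} [CommRing R] {b β c w : R}
    (h : IsBiquadraticNorm b (w ^ 2 * β) c) : IsBiquadraticNorm b β c := by
  obtain ⟨u₁, u₂, v₁, v₂, h⟩ := isBiquadraticNorm_iff.1 h
  exact isBiquadraticNorm_iff.2 ⟨u₁, w * u₂, v₁, w * v₂, by rw [← h]; ring⟩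

theorem exists_quadratic_norm {R : Type*} [CommRing R] {b β c : R}
    (h : IsBiquadraticNorm b β c) : ∃ P Q : R, P ^ 2 - β * Q ^ 2 = c := by
  obtain ⟨u₁, u₂, v₁, v₂, h⟩ := isBiquadraticNorm_iff.1 h
  exact ⟨_, _, h⟩

theorem map {R R' : Type*} [CommRing R] [CommRing R'] (f : R →+* R') {b β c : R}
    (h : IsBiquadraticNorm b β c) : IsBiquadraticNorm (f b) (f β) (f c) := by
  obtain ⟨u₁, u₂, v₁, v₂, rfl⟩ := isBiquadraticNorm_iff.1 h
  exact isBiquadraticNorm_iff.2 ⟨f u₁, f u₂, f v₁, f v₂, by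
    simp only [map_sub, map_add, map_mul, map_pow, map_ofNat]⟩

end IsBiquadraticNorm

/-- The class of `β` defines an extension `L(√β)` of `L = ℚ₂(A)` of conductor dividing `2`. -/
def CondTwoClass (A β : PadicAlgCl 2) : Prop :=
  ∃ w ∈ IntermediateField.adjoin ℚ_[2] {A}, ‖w ^ 2 * β - 1‖ ^ 2 ≤ 8⁻¹

namespace CondTwoClass

variable {A β β' : PadicAlgCl 2}

theorem mul (h : CondTwoClass A β) (h' : CondTwoClass A β') : CondTwoClass A (β * β') := by
  obtain ⟨w, hw, h1⟩ := h
  obtain ⟨w', hw', h1'⟩ := h'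
  refine ⟨w * w', mul_mem hw hw', ?_⟩
  have h2 : ‖w ^ 2 * β‖ ≤ 1 := by
    rw [show w ^ 2 * β = (w ^ 2 * β - 1) + 1 by ring]
    refine (norm_add_le_max _ _).trans (max_le ?_ (by simp))
    exact (sq_le_one_iff₀ (norm_nonneg _)).1 (h1.trans (by norm_num))
  rw [show (w * w') ^ 2 * (β * β') - 1
    = w ^ 2 * β * (w' ^ 2 * β' - 1) + (w ^ 2 * β - 1) by ring]
  have h3 : ‖w ^ 2 * β * (w' ^ 2 * β' - 1)‖ ≤ ‖w' ^ 2 * β' - 1‖ := by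
    rw [norm_mul]; exact mul_le_of_le_one_left (norm_nonneg _) h2
  have h4 := (norm_add_le_max (w ^ 2 * β * (w' ^ 2 * β' - 1)) (w ^ 2 * β - 1)).trans
    (max_le_max h3 le_rfl)
  rcases le_max_iff.1 h4 with h5 | h5
  · exact (pow_le_pow_left₀ (norm_nonneg _) h5 2).trans h1'
  · exact (pow_le_pow_left₀ (norm_nonneg _) h5 2).trans h1

theorem of_sq_mul {r : PadicAlgCl 2} (hr : r ∈ IntermediateField.adjoin ℚ_[2] {A})
    (h : CondTwoClass A (r ^ 2 * β)) : CondTwoClass A β := by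
  obtain ⟨w, hw, h1⟩ := h
  exact ⟨w * r, mul_mem hw hr, by rwa [mul_pow, mul_assoc]⟩

theorem mul_iff (h : CondTwoClass A β) (hβ : β ∈ IntermediateField.adjoin ℚ_[2] {A}) :
    CondTwoClass A (β' * β) ↔ CondTwoClass A β' := by
  refine ⟨fun h' => ?_, fun h' => h'.mul h⟩
  have := h'.mul h
  rw [show β' * β * β = β ^ 2 * β' by ring] at this
  exact this.of_sq_mul hβ

end CondTwoClass

theorem condTwoClass_intCast {A : PadicAlgCl 2} {n : ℤ} (hn : n % 4 = 1) :
    CondTwoClass A (n : PadicAlgCl 2) := by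
  refine ⟨1, one_mem _, ?_⟩
  have := norm_intCast_sub_le (n := n) (m := 1) (k := 2) (by omega)
  rw [one_pow, one_mul]
  norm_num at this ⊢
  nlinarith [norm_nonneg ((n : PadicAlgCl 2) - 1)]

section core

variable {a b : ℤ} {A : PadicAlgCl 2}

theorem condTwoClass_neg_one (hA : A ^ 2 = a) (ha : a % 4 = 3) : CondTwoClass A (-1) := by
  refine CondTwoClass.of_sq_mul (r := A) (IntermediateField.subset_adjoin _ _ rfl) ?_
  rw [hA, mul_neg_one, ← Int.cast_neg]
  exact condTwoClass_intCast (by omega)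

/-- `θ = u + vA` has norm `b` times a non-zero square. -/
def HasNormClass (A : PadicAlgCl 2) (a b : ℤ) (θ : PadicAlgCl 2) : Prop :=
  ∃ u v r : ℚ_[2], θ = ι u + ι v * A ∧ r ≠ 0 ∧ u ^ 2 - a * v ^ 2 = b * r ^ 2

theorem HasNormClass.sq_mul {θ w : PadicAlgCl 2} (hA : A ^ 2 = a) (hAn : ∀ c : ℚ_[2], ι c ≠ A)
    (h : HasNormClass A a b θ) (hw : w ∈ IntermediateField.adjoin ℚ_[2] {A}) (hw0 : w ≠ 0) :
    HasNormClass A a b (w ^ 2 * θ) := by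
  obtain ⟨u, v, r, rfl, hr, h⟩ := h
  obtain ⟨s, t, rfl⟩ := exists_coord hA hw
  refine ⟨(s ^ 2 + a * t ^ 2) * u + 2 * a * s * t * v, (s ^ 2 + a * t ^ 2) * v + 2 * s * t * u,
    (s ^ 2 - a * t ^ 2) * r, ?_, mul_ne_zero ?_ hr, ?_⟩
  · simp only [map_add, map_mul, map_pow, map_ofNat, map_intCast]
    rw [← hA]; ring
  · intro h0
    have h1 : (ι s + ι t * A) * (ι s - ι t * A) = 0 := by
      rw [show (ι s + ι t * A) * (ι s - ι t * A) = ι s ^ 2 - A ^ 2 * ι t ^ 2 by ring, hA,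
        ← map_intCast ι, ← map_pow, ← map_pow, ← map_mul, ← map_sub, h0, map_zero]
    have h2 := (mul_eq_zero.1 h1).resolve_left hw0
    obtain ⟨h3, h4⟩ := coord_ext hAn (u := s) (v := -t) (u' := 0) (v' := 0) (by
      rw [map_neg, map_zero, zero_mul, add_zero, neg_mul, ← sub_eq_add_neg]; exact h2)
    rw [neg_eq_zero] at h4
    rw [h3, h4] at hw0
    simp at hw0
  · linear_combination (s ^ 2 - a * t ^ 2) ^ 2 * h

theorem HasNormClass.mem {θ : PadicAlgCl 2} (h : HasNormClass A a b θ) :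
    θ ∈ IntermediateField.adjoin ℚ_[2] {A} := by
  obtain ⟨u, v, r, rfl, hr, h⟩ := h
  exact add_mem (IntermediateField.algebraMap_mem _ _) (mul_mem (IntermediateField.algebraMap_mem _ _)
    (IntermediateField.subset_adjoin _ _ rfl))

/-- The Hilbert symbol of 2 and 5 is -1: P² - br² is a norm from the unramified ℚ₂(√b), hence of
even valuation, while 2Q² has odd valuation. -/
theorem eq_zero_of_sq_sub_two_mul_sq (hb : b % 8 = 5) {P Q r : ℚ_[2]}
    (h : P ^ 2 - 2 * Q ^ 2 = b * r ^ 2) : r = 0 := by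
  by_contra hr
  obtain ⟨B, hB⟩ := IsAlgClosed.exists_pow_nat_eq ((b : ℤ) : PadicAlgCl 2) (n := 2) two_pos
  have hBq : B ^ 2 = ((b : ℚ) : PadicAlgCl 2) := by rw [hB, Rat.cast_intCast]
  have hBr := not_exists_root_of_mod_eight hB (by omega) (by omega)
  have hBn : B ∉ IntermediateField.adjoin ℚ_[2] (∅ : Set (PadicAlgCl 2)) := by
    rw [mem_adjoin_empty_iff]
    rintro ⟨c, hc⟩
    exact hBr c hc
  obtain ⟨hB1, hB4⟩ := norm_odd_sub_one hB (by omega)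
  have hval := hasIntVal_singleton hBq hB1 hB4
  have e : (ι P + ι r * B) * (ι P - ι r * B) = 2 * ι Q ^ 2 := by
    have := congrArg ι h
    simp only [map_sub, map_mul, map_pow, map_ofNat, map_intCast, ← hB] at this
    linear_combination this
  have hconj := norm_conj hBn (sq_mem_adjoin hBq)
    (IntermediateField.algebraMap_mem _ P) (IntermediateField.algebraMap_mem _ r)
  have hne : ι P + ι r * B ≠ 0 := by
    intro h0
    obtain ⟨-, h2⟩ := coord_ext hBr (u' := 0) (v' := 0) (by rw [h0]; simp)
    exact hr h2
  have hQ : Q ≠ 0 := by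
    rintro rfl
    have h1 : ι P - ι r * B = 0 := by
      rw [map_zero, zero_pow two_ne_zero, mul_zero] at e
      exact (mul_eq_zero.1 e).resolve_left hne
    rw [h1, norm_zero] at hconj
    exact hne (norm_eq_zero.1 hconj.symm)
  have e2 := congrArg norm e
  rw [norm_mul, hconj, norm_mul, norm_two, norm_pow, ← sq, PadicAlgCl.norm_extends] at e2
  obtain ⟨k, hk⟩ := exists_norm_eq_zpow hQ
  obtain ⟨n, hn⟩ := hval _ (add_mem (IntermediateField.algebraMap_mem _ P)
    (mul_mem (IntermediateField.algebraMap_mem _ r) (IntermediateField.subset_adjoin _ _ rfl))) hne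
  rw [hn, hk, ← zpow_natCast, ← zpow_mul, ← zpow_natCast, ← zpow_mul, mul_comm (2⁻¹ : ℝ)] at e2
  push_cast at e2
  rw [← zpow_sub_one₀ two_ne_zero] at e2
  have := zpow_right_injective₀ (a := (2 : ℝ)) (by norm_num) (by norm_num) e2
  omega

/-- The norm to ℚ₂ of U² - 2V² is again of the form P² - 2Q², which cannot be b times a non-zero
square. -/
theorem HasNormClass.ne_sq_sub_two_mul_sq {θ U V : PadicAlgCl 2} (hA : A ^ 2 = a)
    (hAn : ∀ c : ℚ_[2], ι c ≠ A) (hb : b % 8 = 5) (h : HasNormClass A a b θ)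
    (hU : U ∈ IntermediateField.adjoin ℚ_[2] {A}) (hV : V ∈ IntermediateField.adjoin ℚ_[2] {A}) :
    θ ≠ U ^ 2 - 2 * V ^ 2 := by
  intro e
  obtain ⟨u, v, r, rfl, hr, h⟩ := h
  obtain ⟨u₁, u₂, rfl⟩ := exists_coord hA hU
  obtain ⟨v₁, v₂, rfl⟩ := exists_coord hA hV
  obtain ⟨h1, h2⟩ := coord_ext hAn (u := u) (v := v)
    (u' := u₁ ^ 2 + a * u₂ ^ 2 - 2 * (v₁ ^ 2 + a * v₂ ^ 2)) (v' := 2 * u₁ * u₂ - 4 * v₁ * v₂) (by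
      rw [e]
      simp only [map_sub, map_add, map_mul, map_pow, map_ofNat, map_intCast]
      rw [← hA]; ring)
  -- P + Q√2 is the product of U + V√2 with its conjugate under A ↦ -A.
  refine hr (eq_zero_of_sq_sub_two_mul_sq hb
    (P := u₁ ^ 2 - a * u₂ ^ 2 + 2 * (v₁ ^ 2 - a * v₂ ^ 2))
    (Q := 2 * (u₁ * v₁ - a * u₂ * v₂)) ?_)
  rw [← h, h1, h2]; ring

theorem two_ne_sq (hA : A ^ 2 = a) (ha : a % 4 = 3) {P : PadicAlgCl 2}
    (hP : P ∈ IntermediateField.adjoin ℚ_[2] {A}) : (2 : PadicAlgCl 2) ≠ P ^ 2 := by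
  intro e
  have h : UnrClass (IntermediateField.adjoin ℚ_[2] {A}) (2 : ℤ) := by
    have : P ≠ 0 := by rintro rfl; norm_num at e
    rw [Int.cast_ofNat, e]; exact UnrClass.sq hP this
  rcases sign_of_unrClass_ramified hA (Or.inr ha) (by norm_num) h with h | h | h <;> omega

/-- If the norm class of `β` is `5`, then `2` is not a norm from `L(√β)`. -/
theorem two_ne_quadratic_norm {β P Q : PadicAlgCl 2} (hA : A ^ 2 = a) (ha : a % 4 = 3)
    (hb : b % 8 = 5) (h : HasNormClass A a b β) (hP : P ∈ IntermediateField.adjoin ℚ_[2] {A})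
    (hQ : Q ∈ IntermediateField.adjoin ℚ_[2] {A}) : 2 ≠ P ^ 2 - β * Q ^ 2 := by
  intro e
  have hAn := not_exists_root_of_mod_eight hA (by omega) (by omega)
  by_cases hQ0 : Q = 0
  · rw [hQ0, zero_pow two_ne_zero, mul_zero, sub_zero] at e
    exact two_ne_sq hA ha hP e
  · refine h.ne_sq_sub_two_mul_sq hA hAn hb (div_mem hP hQ) (inv_mem hQ) ?_
    field_simp
    linear_combination e

/-- Since -β is the norm of √β and 2 is not a norm from L(√β), the product -2β is not a norm either,
nor is its product with a square. Concretely, a representation would again write β as U² - 2V². -/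
theorem neg_ne_quadratic_norm {β w P Q : PadicAlgCl 2} (hA : A ^ 2 = a) (ha : a % 4 = 3)
    (hb : b % 8 = 5) (h : HasNormClass A a b β) (hw : w ∈ IntermediateField.adjoin ℚ_[2] {A})
    (hw0 : w ≠ 0) (hP : P ∈ IntermediateField.adjoin ℚ_[2] {A})
    (hQ : Q ∈ IntermediateField.adjoin ℚ_[2] {A}) :
    -(w ^ 2 * (2 * β)) ≠ P ^ 2 - β * Q ^ 2 := by
  intro e
  have hAn := not_exists_root_of_mod_eight hA (by omega) (by omega)
  obtain ⟨u, v, r, hβ, hr, hn⟩ := id h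
  have hβ0 : β ≠ 0 := by
    rintro rfl
    exact h.ne_sq_sub_two_mul_sq hA hAn hb (zero_mem _) (zero_mem _) (by ring)
  have h2 : (2 : PadicAlgCl 2) ∈ IntermediateField.adjoin ℚ_[2] {A} := ofNat_mem _ 2
  -- `β (Q² - 2 w²) = P²`
  have e1 : β * (Q ^ 2 - 2 * w ^ 2) = P ^ 2 := by linear_combination e
  by_cases hP0 : P = 0
  · rw [hP0, zero_pow two_ne_zero, mul_eq_zero] at e1
    have e2 := e1.resolve_left hβ0
    refine two_ne_sq hA ha (div_mem hQ hw) ?_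
    field_simp
    linear_combination -e2
  · have hD : Q ^ 2 - 2 * w ^ 2 ≠ 0 := by
      intro h0
      rw [h0, mul_zero, eq_comm] at e1
      exact hP0 (pow_eq_zero_iff two_ne_zero |>.1 e1)
    have hDm : Q ^ 2 - 2 * w ^ 2 ∈ IntermediateField.adjoin ℚ_[2] {A} :=
      sub_mem (pow_mem hQ 2) (mul_mem h2 (pow_mem hw 2))
    refine h.ne_sq_sub_two_mul_sq hA hAn hb (U := P * Q / (Q ^ 2 - 2 * w ^ 2))
      (V := P * w / (Q ^ 2 - 2 * w ^ 2)) (div_mem (mul_mem hP hQ) hDm)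
      (div_mem (mul_mem hP hw) hDm) ?_
    rw [div_pow, div_pow, mul_div_assoc', ← sub_div, eq_div_iff (pow_ne_zero 2 hD)]
    linear_combination (Q ^ 2 - 2 * w ^ 2) * e1

theorem norm_padicInt_le {w : ℤ_[2]} {k : ℕ} (hw : PadicInt.toZModPow k w = 0) :
    ‖(w : ℚ_[2])‖ ≤ (2⁻¹ : ℝ) ^ k := by
  have h1 : w ∈ RingHom.ker (PadicInt.toZModPow (p := 2) k) := hw
  rw [PadicInt.ker_toZModPow, ← PadicInt.norm_le_pow_iff_mem_span_pow] at h1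
  refine le_trans h1 ?_
  rw [zpow_neg, zpow_natCast, inv_pow]
  norm_num

theorem norm_sub_one_of_norm_eq_one {m : ℚ_[2]} (hm : ‖m‖ = 1) : ‖m - 1‖ ≤ 2⁻¹ := by
  set u : ℤ_[2] := ⟨m, hm.le⟩
  have hunit : IsUnit u := PadicInt.isUnit_iff.2 hm
  have hz : ∀ z : ZMod (2 ^ 1), IsUnit z → z = 1 := by decide
  have := norm_padicInt_le (w := u - 1) (k := 1)
    (by rw [map_sub, hz _ (hunit.map (PadicInt.toZModPow 1)), map_one, sub_self])
  rw [pow_one] at this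
  exact this

/-- The residue field of `ℚ₂(√a)` has two elements for `a ≡ 3 mod 4`. -/
theorem norm_sub_one_sq_le (hA : A ^ 2 = a) (ha : a % 4 = 3) {u : PadicAlgCl 2}
    (hu : u ∈ IntermediateField.adjoin ℚ_[2] {A}) (hu1 : ‖u‖ = 1) : ‖u - 1‖ ^ 2 ≤ 2⁻¹ := by
  obtain ⟨e, he⟩ := exists_uniformizer hA (Or.inr ha)
  obtain ⟨m, n, rfl⟩ := exists_coord hA hu
  have h1 := sq_norm_add_mul_uniformizer he (m - e * n) n
  rw [map_sub, map_mul, map_intCast,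
    show ι m - e * ι n + ι n * (A + e) = ι m + ι n * A by ring, hu1, one_pow] at h1
  have h2 : ‖n‖ ≤ 1 := padic_le_one_of_sq_le_two (by
    have := le_max_right (‖m - e * n‖ ^ 2) (‖n‖ ^ 2 * 2⁻¹)
    rw [← h1] at this; linarith)
  have h3 : ‖n‖ ^ 2 * 2⁻¹ ≤ 2⁻¹ := by
    have := pow_le_one₀ (n := 2) (norm_nonneg n) h2
    linarith
  have h4 : ‖m - e * n‖ = 1 := by
    rcases max_choice (‖m - e * n‖ ^ 2) (‖n‖ ^ 2 * 2⁻¹) with h | h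
    · rw [h] at h1
      exact (pow_eq_one_iff_of_nonneg (norm_nonneg _) two_ne_zero).1 h1.symm
    · rw [h] at h1
      rw [← h1] at h3; norm_num at h3
  have h5 := norm_sub_one_of_norm_eq_one h4
  have h6 := sq_norm_add_mul_uniformizer he (m - e * n - 1) n
  rw [map_sub, map_sub, map_mul, map_intCast, map_one,
    show ι m - e * ι n - 1 + ι n * (A + e) = ι m + ι n * A - 1 by ring] at h6
  rw [h6]
  refine max_le ?_ h3
  nlinarith [norm_nonneg (m - e * n - 1)]

end core

end

end Redei

/-! ### Units congruent to 1 modulo 2 are norms when the conductor class is right. -/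

namespace Redei

noncomputable section

local notation "ι" => algebraMap ℚ_[2] (PadicAlgCl 2)

variable {a b : ℤ} {A : PadicAlgCl 2}

/-- `1 + e` cannot have norm class `5` if `e` is divisible by `4`. -/
theorem HasNormClass.norm_sub_one (hA : A ^ 2 = a) (ha : a % 4 = 3) (hb : b % 8 = 5)
    {γ : PadicAlgCl 2} (h : HasNormClass A a b γ) : ¬ ‖γ - 1‖ ≤ 4⁻¹ := by
  intro h1
  have hAn := not_exists_root_of_mod_eight hA (by omega) (by omega)
  have h2 : ‖(γ - 1) / 4‖ ≤ 1 := by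
    rw [norm_div, norm_four, div_le_one (by norm_num)]; exact h1
  obtain ⟨p, q, hpq⟩ := exists_padicInt_coord hA (Or.inr ha) (div_mem (sub_mem h.mem (one_mem _))
    (ofNat_mem _ 4)) h2
  obtain ⟨u, v, r, rfl, hr, hn⟩ := h
  obtain ⟨h3, h4⟩ := coord_ext hAn (u := u) (v := v) (u' := 1 + 4 * p) (v' := 4 * q) (by
    rw [div_eq_iff (by norm_num)] at hpq
    simp only [map_add, map_mul, map_one, map_ofNat]
    linear_combination hpq)
  obtain ⟨B, hB⟩ := IsAlgClosed.exists_pow_nat_eq ((b : ℤ) : PadicAlgCl 2) (n := 2) two_pos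
  have h5 : ‖ι (((8 : ℤ_[2]) * (p + 2 * p ^ 2 - 2 * a * q ^ 2) : ℤ_[2]) : ℚ_[2])‖ ≤ 8⁻¹ := by
    rw [PadicAlgCl.norm_extends, PadicInt.padic_norm_e_of_padicInt, norm_mul]
    refine (mul_le_of_le_one_right (norm_nonneg _) (PadicInt.norm_le_one _)).trans ?_
    rw [show (8 : ℤ_[2]) = 2 ^ 3 by norm_num, norm_pow, show (2 : ℤ_[2]) = ((2 : ℕ) : ℤ_[2]) from rfl,
      PadicInt.norm_p]
    norm_num
  have h6 : ι (b * r ^ 2) - 1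
      = ι (((8 : ℤ_[2]) * (p + 2 * p ^ 2 - 2 * a * q ^ 2) : ℤ_[2]) : ℚ_[2]) := by
    rw [← map_one ι, ← map_sub, ← hn, h3, h4]
    congr 1
    rw [PadicInt.coe_mul, PadicInt.coe_sub, PadicInt.coe_add, PadicInt.coe_mul, PadicInt.coe_mul,
      PadicInt.coe_mul, PadicInt.coe_pow, PadicInt.coe_pow,
      show ((8 : ℤ_[2]) : ℚ_[2]) = 8 from rfl, show ((2 : ℤ_[2]) : ℚ_[2]) = 2 from rfl,
      PadicInt.coe_intCast]
    ring
  obtain ⟨d, hd, hd2⟩ := exists_sqrt_of_norm_sub_one_lt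
    (L := IntermediateField.adjoin ℚ_[2] (∅ : Set (PadicAlgCl 2))) (D := ι (b * r ^ 2))
    (IntermediateField.algebraMap_mem _ _) (by rw [h6, norm_four]; linarith)
  obtain ⟨c, rfl⟩ := mem_adjoin_empty_iff.1 hd
  have h7 : (ι (c / r)) ^ 2 = b := by
    rw [← map_pow, div_pow, map_div₀, map_pow, hd2, ← map_div₀, mul_div_assoc,
      div_self (pow_ne_zero 2 hr), mul_one, map_intCast]
  exact not_exists_root_of_mod_eight h7 (by omega) (by omega) _ rfl

theorem exists_norm_sq_eq_zpow (hA : A ^ 2 = a) (ha : a % 4 = 3) {z : PadicAlgCl 2}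
    (hz : z ∈ IntermediateField.adjoin ℚ_[2] {A}) (hz0 : z ≠ 0) :
    ∃ n : ℤ, ‖z‖ ^ 2 = (2 : ℝ) ^ n := by
  obtain ⟨e, he⟩ := exists_uniformizer hA (Or.inr ha)
  obtain ⟨m, n, rfl⟩ := exists_coord hA hz
  have h1 := sq_norm_add_mul_uniformizer he (m - e * n) n
  rw [map_sub, map_mul, map_intCast,
    show ι m - e * ι n + ι n * (A + e) = ι m + ι n * A by ring] at h1
  have h0 : ‖ι m + ι n * A‖ ^ 2 ≠ 0 := pow_ne_zero 2 (norm_ne_zero_iff.2 hz0)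
  rw [h1] at h0 ⊢
  rcases max_choice (‖m - e * n‖ ^ 2) (‖n‖ ^ 2 * 2⁻¹) with h | h <;> rw [h] at h0 ⊢
  · obtain ⟨k, hk⟩ := exists_norm_eq_zpow (p := 2) (c := m - e * n) (by
      intro h; rw [h] at h0; norm_num at h0)
    exact ⟨k * 2, by rw [hk, zpow_mul]; norm_cast⟩
  · obtain ⟨k, hk⟩ := exists_norm_eq_zpow (p := 2) (c := n) (by
      intro h; rw [h] at h0; norm_num at h0)
    refine ⟨k * 2 - 1, ?_⟩
    rw [hk, zpow_sub_one₀ two_ne_zero, zpow_mul]; norm_cast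

section

variable {γ : IntermediateField.adjoin ℚ_[2] {A}}

/-- The residue field has two elements, so b + 4u ≡ -3 + 4 = 1 mod 4𝔭, which is a square. With d² =
b + 4u this reads u = (d/2)² - b/4: every unit is a norm from L(√b). -/
theorem exists_sq_sub_mul_sq (hA : A ^ 2 = a) (ha : a % 4 = 3) (hb : b % 8 = 5)
    {u : IntermediateField.adjoin ℚ_[2] {A}} (hu : ‖(u : PadicAlgCl 2)‖ = 1) :
    ∃ d : IntermediateField.adjoin ℚ_[2] {A}, d ≠ 0 ∧ d ^ 2 = b + 4 * u := by
  have h1 := norm_sub_one_sq_le hA ha u.2 hu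
  have h2 := norm_intCast_sub_le (n := b) (m := -3) (k := 3) (by omega)
  have h3 : ‖((b : PadicAlgCl 2) + 4 * u) - 1‖ < ‖(4 : PadicAlgCl 2)‖ := by
    rw [show (b : PadicAlgCl 2) + 4 * u - 1 = (b - (-3 : ℤ)) + 4 * (u - 1) by push_cast; ring]
    refine (norm_add_le_max _ _).trans_lt (max_lt ?_ ?_)
    · rw [norm_four]; exact h2.trans_lt (by norm_num)
    · rw [norm_mul]
      refine mul_lt_of_lt_one_right (by rw [norm_four]; norm_num) ?_
      exact (sq_lt_one_iff₀ (norm_nonneg _)).1 (h1.trans_lt (by norm_num))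
  obtain ⟨d, hd, hd2⟩ := exists_sqrt_of_norm_sub_one_lt
    (L := IntermediateField.adjoin ℚ_[2] {A})
    (add_mem (intCast_mem _ b) (mul_mem (ofNat_mem _ 4) u.2)) h3
  refine ⟨⟨d, hd⟩, ?_, Subtype.ext ?_⟩
  · intro h0
    have h0' : d = 0 := congrArg Subtype.val h0
    rw [← hd2, h0', norm_four] at h3
    norm_num at h3
  · exact hd2

/-- An element of L(√b) of norm u has norm u² from the biquadratic algebra. -/
theorem isBiquadraticNorm_sq_of_norm_eq_one (hA : A ^ 2 = a) (ha : a % 4 = 3) (hb : b % 8 = 5)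
    {u : IntermediateField.adjoin ℚ_[2] {A}} (hu : ‖(u : PadicAlgCl 2)‖ = 1) :
    IsBiquadraticNorm (b : IntermediateField.adjoin ℚ_[2] {A}) γ (u ^ 2) := by
  obtain ⟨d, -, hd⟩ := exists_sq_sub_mul_sq hA ha hb hu
  refine isBiquadraticNorm_iff.2 ⟨d / 2, 0, 1 / 2, 0, ?_⟩
  have hu : u = (d / 2) ^ 2 - b * (1 / 2) ^ 2 := by
    field_simp; linear_combination -hd
  rw [hu]; ring

/-- The element 1 + √γ of L(√γ) has norm 1 - γ, so its norm from the biquadratic algebra is the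
square. -/
theorem isBiquadraticNorm_sub_one_sq :
    IsBiquadraticNorm (b : IntermediateField.adjoin ℚ_[2] {A}) γ ((γ - 1) ^ 2) :=
  isBiquadraticNorm_iff.2 ⟨1, 1, 0, 0, by ring⟩

theorem isBiquadraticNorm_sq_of_even (hA : A ^ 2 = a) (ha : a % 4 = 3) (hb : b % 8 = 5)
    {z : IntermediateField.adjoin ℚ_[2] {A}} {n : ℤ} (hz : ‖(z : PadicAlgCl 2)‖ ^ 2 = 2 ^ (2 * n)) :
    IsBiquadraticNorm (b : IntermediateField.adjoin ℚ_[2] {A}) γ (z ^ 2) := by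
  obtain ⟨e, he⟩ := exists_uniformizer hA (Or.inr ha)
  have hm : A + e ∈ IntermediateField.adjoin ℚ_[2] {A} :=
    add_mem (IntermediateField.subset_adjoin _ _ rfl) (intCast_mem _ e)
  set ϖ : IntermediateField.adjoin ℚ_[2] {A} := ⟨A + e, hm⟩ with hϖ
  have hϖ0 : ϖ ≠ 0 := by
    intro h
    have : A + e = 0 := congrArg Subtype.val h
    rw [this] at he; norm_num at he
  have hu : ‖((z * (ϖ ^ 2) ^ n : IntermediateField.adjoin ℚ_[2] {A}) : PadicAlgCl 2)‖ = 1 := by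
    have h2 : (2 : ℝ) ≠ 0 := two_ne_zero
    refine (pow_eq_one_iff_of_nonneg (norm_nonneg _) two_ne_zero).1 ?_
    rw [IntermediateField.coe_mul, norm_mul, mul_pow, hz,
      show (((ϖ ^ 2) ^ n : IntermediateField.adjoin ℚ_[2] {A}) : PadicAlgCl 2)
        = ((A + e) ^ 2) ^ n from
          map_zpow₀ (algebraMap (IntermediateField.adjoin ℚ_[2] {A}) (PadicAlgCl 2)) (ϖ ^ 2) n,
      norm_zpow, norm_pow, he, inv_zpow, zpow_mul']
    exact_mod_cast by rw [← mul_pow, mul_inv_cancel₀ (zpow_ne_zero _ h2), one_pow]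
  have h := (isBiquadraticNorm_sq_of_norm_eq_one (γ := γ) hA ha hb hu).mul
    (IsBiquadraticNorm.pow_four (ϖ ^ (-n)))
  convert h using 1
  rw [mul_pow, mul_assoc, ← zpow_natCast (ϖ ^ (-n)), ← zpow_mul, ← zpow_natCast (_ ^ n), ← zpow_mul,
    ← zpow_natCast ϖ, ← zpow_mul, ← zpow_add₀ hϖ0, show ((2 : ℕ) : ℤ) * (n * (2 : ℕ)) + -n * (4 : ℕ) = 0
    by push_cast; ring, zpow_zero, mul_one]

/-- For even valuation of z, z² is the square of a unit times a fourth power. As γ - 1 has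
𝔭-valuation 3, multiplying by it reduces the odd case to the even one. -/
theorem isBiquadraticNorm_sq (hA : A ^ 2 = a) (ha : a % 4 = 3) (hb : b % 8 = 5)
    (hγ : ‖(γ : PadicAlgCl 2) - 1‖ ^ 2 = 8⁻¹)
    {z : IntermediateField.adjoin ℚ_[2] {A}} (hz0 : z ≠ 0) :
    IsBiquadraticNorm (b : IntermediateField.adjoin ℚ_[2] {A}) γ (z ^ 2) := by
  obtain ⟨n, hn⟩ := exists_norm_sq_eq_zpow hA ha z.2 (by exact_mod_cast hz0)
  rcases Int.even_or_odd' n with ⟨k, rfl | rfl⟩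
  · exact isBiquadraticNorm_sq_of_even hA ha hb hn
  · have hγ0 : γ - 1 ≠ 0 := by
      intro h
      have h' : (γ : PadicAlgCl 2) - 1 = 0 := congrArg Subtype.val h
      rw [h'] at hγ; norm_num at hγ
    have h1 : ‖((z * (γ - 1) : IntermediateField.adjoin ℚ_[2] {A}) : PadicAlgCl 2)‖ ^ 2
        = 2 ^ (2 * (k - 1)) := by
      rw [IntermediateField.coe_mul, norm_mul, mul_pow, hn,
        show ((γ - 1 : IntermediateField.adjoin ℚ_[2] {A}) : PadicAlgCl 2) = γ - 1 from rfl, hγ, show 2 * k + 1 = 2 * (k - 1) + 3 by ring,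
        zpow_add₀ two_ne_zero]
      norm_num
      ring
    have h := ((isBiquadraticNorm_sq_of_even (γ := γ) hA ha hb h1).mul
      isBiquadraticNorm_sub_one_sq).mul (IsBiquadraticNorm.pow_four (γ - 1)⁻¹)
    convert h using 1
    field_simp

/-- The unit u is the norm of some ξ = r + s√γ with r = 1 + s, and of some η = p + √b/2. The norm of
ξ + η down to L(√γ) is 2(p + r)ξ, hence its norm to L is u(2(p + r))². The square factor is itself a
norm and can be removed. -/
theorem isBiquadraticNorm_of_norm_sub_one (hA : A ^ 2 = a) (ha : a % 4 = 3) (hb : b % 8 = 5)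
    (hγ : ‖(γ : PadicAlgCl 2) - 1‖ ^ 2 = 8⁻¹) {u : IntermediateField.adjoin ℚ_[2] {A}}
    (hu : ‖(u : PadicAlgCl 2) - 1‖ ≤ 2⁻¹) :
    IsBiquadraticNorm (b : IntermediateField.adjoin ℚ_[2] {A}) γ u := by
  have hγ0 : γ - 1 ≠ 0 := by
    intro h
    have h' : (γ : PadicAlgCl 2) - 1 = 0 := congrArg Subtype.val h
    rw [h'] at hγ; norm_num at hγ
  have hu1 : ‖(u : PadicAlgCl 2)‖ = 1 := by
    have := IsUltrametricDist.norm_add_eq_max_of_norm_ne_norm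
      (x := (u : PadicAlgCl 2) - 1) (y := 1) (by rw [norm_one]; intro h; rw [h] at hu; norm_num at hu)
    rw [sub_add_cancel, norm_one, max_eq_right (hu.trans (by norm_num))] at this
    exact this
  obtain ⟨d, hd0, hd⟩ := exists_sq_sub_mul_sq hA ha hb hu1
  have hk : ‖(u : PadicAlgCl 2) - 1‖ * ‖(γ : PadicAlgCl 2) - 1‖ < 4⁻¹ := by
    have h1 : ‖(γ : PadicAlgCl 2) - 1‖ < 2⁻¹ := by nlinarith [norm_nonneg ((γ : PadicAlgCl 2) - 1)]
    nlinarith [norm_nonneg ((γ : PadicAlgCl 2) - 1), norm_nonneg ((u : PadicAlgCl 2) - 1)]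
  -- This is a quarter of the discriminant of (1 + s)² - γs² = u as an equation in s. It is ≡ 1 mod
  -- 𝔭⁵ = 4𝔭, hence a square.
  obtain ⟨d', hd'L, hd'⟩ := exists_sqrt_of_norm_sub_one_lt
    (L := IntermediateField.adjoin ℚ_[2] {A})
    (D := 1 - ((u : PadicAlgCl 2) - 1) * ((γ : PadicAlgCl 2) - 1))
    (sub_mem (one_mem _) (mul_mem (sub_mem u.2 (one_mem _)) (sub_mem γ.2 (one_mem _))))
    (by rw [sub_sub_cancel_left, norm_neg, norm_mul, norm_four]; exact hk)
  lift d' to IntermediateField.adjoin ℚ_[2] {A} using hd'L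
  replace hd' : d' ^ 2 = 1 - (u - 1) * (γ - 1) := Subtype.ext (by simpa using hd')
  -- `r² - γ s² = u`, `p² - b / 4 = u`
  set s := (1 - d') / (γ - 1) with hs
  have hrs : (1 + s) ^ 2 - γ * s ^ 2 = u := by
    rw [hs]; field_simp
    linear_combination (1 - γ) * hd'
  -- The sign of p = ±d/2 is free; if p + r vanished for both signs, d would be 0.
  obtain ⟨p, hp, hpr⟩ : ∃ p : IntermediateField.adjoin ℚ_[2] {A},
      p ^ 2 - b * (1 / 2) ^ 2 = u ∧ p + (1 + s) ≠ 0 := by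
    by_cases h0 : d / 2 + (1 + s) = 0
    · refine ⟨-(d / 2), by field_simp; linear_combination hd, fun h1 => hd0 ?_⟩
      linear_combination h0 - h1
    · exact ⟨d / 2, by field_simp; linear_combination hd, h0⟩
  have h1 : IsBiquadraticNorm (b : IntermediateField.adjoin ℚ_[2] {A}) γ
      (u * (2 * (p + (1 + s))) ^ 2) := by
    refine isBiquadraticNorm_iff.2 ⟨p + (1 + s), s, 1 / 2, 0, ?_⟩
    have e1 : γ * s ^ 2 = (1 + s) ^ 2 - u := by linear_combination -hrs
    have e2 : (b : IntermediateField.adjoin ℚ_[2] {A}) * (1 / 2) ^ 2 = p ^ 2 - u := by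
      linear_combination -hp
    have e3 : (p + (1 + s)) ^ 2 + γ * s ^ 2 - b * ((1 / 2) ^ 2 + γ * 0 ^ 2)
        = 2 * (1 + s) * (p + (1 + s)) := by linear_combination e1 - e2
    rw [e3]
    linear_combination -(4 * (p + (1 + s)) ^ 2) * e1
  have hz0 : 2 * (p + (1 + s)) ≠ 0 := mul_ne_zero two_ne_zero hpr
  have h := (h1.mul (isBiquadraticNorm_sq hA ha hb hγ hz0)).mul
    (IsBiquadraticNorm.pow_four (2 * (p + (1 + s)))⁻¹)
  convert h using 1
  rw [mul_assoc u, ← pow_add, mul_assoc, ← mul_pow, mul_inv_cancel₀ hz0, one_pow, mul_one]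

end

/-- An element ≡ 1 mod 4 has norm ≡ 1 mod 8, a square, so the norm class 5 excludes it. The
𝔭-valuation of γ - 1 is therefore exactly 3, and its being odd is what the squares of odd valuation
require. -/
theorem CondTwoClass.norm_sub_one_sq (hA : A ^ 2 = a) (ha : a % 4 = 3) (hb : b % 8 = 5)
    {γ : PadicAlgCl 2} (h : HasNormClass A a b γ) (hγ : ‖γ - 1‖ ^ 2 ≤ 8⁻¹) :
    ‖γ - 1‖ ^ 2 = 8⁻¹ := by
  have h1 := h.norm_sub_one hA ha hb
  have h0 : γ - 1 ≠ 0 := by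
    intro h0; rw [h0, norm_zero] at h1; norm_num at h1
  obtain ⟨n, hn⟩ := exists_norm_sq_eq_zpow hA ha (sub_mem h.mem (one_mem _)) h0
  have h2 : (2 : ℝ) ^ (-4 : ℤ) < 2 ^ n := by
    rw [← hn]; push Not at h1
    norm_num
    nlinarith
  have h3 : (2 : ℝ) ^ n ≤ 2 ^ (-3 : ℤ) := by
    rw [← hn]; norm_num at hγ ⊢; exact hγ
  rw [zpow_lt_zpow_iff_right₀ (by norm_num)] at h2
  rw [zpow_le_zpow_iff_right₀ (by norm_num)] at h3
  rw [hn, show n = -3 by omega]; norm_num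

theorem CondTwoClass.isBiquadraticNorm (hA : A ^ 2 = a) (ha : a % 4 = 3) (hb : b % 8 = 5)
    {β u : IntermediateField.adjoin ℚ_[2] {A}} (h : HasNormClass A a b β)
    (hβ : CondTwoClass A β) (hu : ‖(u : PadicAlgCl 2) - 1‖ ≤ 2⁻¹) :
    IsBiquadraticNorm (b : IntermediateField.adjoin ℚ_[2] {A}) β u := by
  have hAn := not_exists_root_of_mod_eight hA (by omega) (by omega)
  obtain ⟨w, hw, hw1⟩ := hβ
  lift w to IntermediateField.adjoin ℚ_[2] {A} using hw
  have hw0 : (w : PadicAlgCl 2) ≠ 0 := by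
    intro h0; rw [h0] at hw1; norm_num at hw1
  have h1 := CondTwoClass.norm_sub_one_sq hA ha hb (h.sq_mul hA hAn w.2 hw0) hw1
  exact IsBiquadraticNorm.mul_sq (w := w) (isBiquadraticNorm_of_norm_sub_one hA ha hb
    (by simpa using h1) hu)

end

end Redei

/-! ### The dichotomy between β and 2β. -/

namespace Redei

noncomputable section

local notation "ι" => algebraMap ℚ_[2] (PadicAlgCl 2)

variable {a b : ℤ} {A : PadicAlgCl 2}

theorem norm_one_add_sq_le (hA : A ^ 2 = a) (ha : a % 4 = 3) : ‖1 + A‖ ^ 2 ≤ 2⁻¹ := by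
  have hAL : A ∈ IntermediateField.adjoin ℚ_[2] {A} := IntermediateField.subset_adjoin _ _ rfl
  have := norm_sub_one_sq_le hA ha (neg_mem hAL) (by
    rw [norm_neg]; exact norm_eq_one_of_sq hA (by omega))
  rwa [show -A - 1 = -(1 + A) by ring, norm_neg] at this

theorem norm_padicInt_le_of_two_pow_mul {w : ℤ_[2]} {j k : ℕ}
    (hw : 2 ^ j * PadicInt.toZModPow (p := 2) (j + k) w = 0) :
    ‖ι (w : ℚ_[2])‖ ≤ (2⁻¹ : ℝ) ^ k := by
  have h1 := norm_padicInt_le (w := 2 ^ j * w) (k := j + k) (by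
    rw [map_mul, map_pow, map_ofNat]; exact hw)
  rw [PadicInt.coe_mul, PadicInt.coe_pow, norm_mul, norm_pow,
    show ‖((2 : ℤ_[2]) : ℚ_[2])‖ = 2⁻¹ from Padic.norm_p, pow_add] at h1
  rw [PadicAlgCl.norm_extends]
  exact le_of_mul_le_mul_left h1 (by positivity)

/-- The hypotheses say that X is odd and Y ≡ 2 mod 4. If X ≡ 3 mod 4, then in X + YA - 1 = (X - 1 -
Y) + Y(1 + A) the first term is divisible by 4 and the second by 𝔭³. If X ≡ 1 mod 4, multiplication
by A² = a ≡ 3 mod 4 leads back to this case. -/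
theorem condTwoClass_of_toZModPow (hA : A ^ 2 = a) (ha : a % 4 = 3) {X Y : ℤ_[2]}
    (hX : 4 * PadicInt.toZModPow (p := 2) 3 X = 4) (hY : 2 * PadicInt.toZModPow (p := 2) 3 Y = 4) :
    CondTwoClass A (ι X + ι Y * A) := by
  have h1A := norm_one_add_sq_le hA ha
  have key : ∀ X Y : ℤ_[2], 2 * PadicInt.toZModPow (p := 2) 3 X = 6 →
      2 * PadicInt.toZModPow (p := 2) 3 Y = 4 → ‖ι X + ι Y * A - 1‖ ^ 2 ≤ 8⁻¹ := by
    intro X Y hX hY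
    have h1 := norm_padicInt_le_of_two_pow_mul (w := X - 1 - Y) (j := 1) (k := 2) (by
      rw [map_sub, map_sub, map_one, pow_one, mul_sub, mul_sub, hX, hY]; rfl)
    have h2 := norm_padicInt_le_of_two_pow_mul (w := Y) (j := 2) (k := 1) (by
      rw [show (2 : ZMod (2 ^ (2 + 1))) ^ 2 = 2 * 2 by norm_num, mul_assoc, hY]; rfl)
    rw [PadicInt.coe_sub, PadicInt.coe_sub, PadicInt.coe_one, map_sub, map_sub, map_one] at h1
    rw [show ι X + ι Y * A - 1 = (ι X - 1 - ι Y) + ι Y * (1 + A) by ring]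
    rcases le_max_iff.1 (norm_add_le_max (ι X - 1 - ι Y) (ι Y * (1 + A))) with h | h
    · refine (pow_le_pow_left₀ (norm_nonneg _) (h.trans h1) 2).trans (by norm_num)
    · refine (pow_le_pow_left₀ (norm_nonneg _) h 2).trans ?_
      rw [norm_mul, mul_pow]
      refine (mul_le_mul (pow_le_pow_left₀ (norm_nonneg _) h2 2) h1A (by positivity)
        (by positivity)).trans (by norm_num)
  have hX2 : ∀ X : ZMod (2 ^ 3), 4 * X = 4 → 2 * X = 6 ∨ 2 * X = 2 := by decide
  rcases hX2 _ hX with h | h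
  · exact ⟨1, one_mem _, by rw [one_pow, one_mul]; exact key X Y h hY⟩
  · refine ⟨A, IntermediateField.subset_adjoin _ _ rfl, ?_⟩
    have ha' : ∀ X Y c : ZMod (2 ^ 3), 2 * X = 2 → 2 * Y = 4 → c = 3 ∨ c = 7 →
      2 * (c * X) = 6 ∧ 2 * (c * Y) = 4 := by decide
    have hac : ((a : ℤ) : ZMod (2 ^ 3)) = 3 ∨ ((a : ℤ) : ZMod (2 ^ 3)) = 7 := by
      rcases (by omega : a % 8 = 3 ∨ a % 8 = 7) with h | h
      · left; exact (ZMod.intCast_eq_intCast_iff a 3 8).2 h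
      · right; exact (ZMod.intCast_eq_intCast_iff a 7 8).2 h
    obtain ⟨h1, h2⟩ := ha' _ _ _ h hY hac
    have := key (a * X) (a * Y) (by rw [map_mul, map_intCast]; exact h1)
      (by rw [map_mul, map_intCast]; exact h2)
    rw [PadicInt.coe_mul, PadicInt.coe_mul, PadicInt.coe_intCast, map_mul, map_mul,
      map_intCast] at this
    rwa [hA, mul_add, ← mul_assoc]

theorem norm_sq_coord (hA : A ^ 2 = a) (hAn : ∀ c : ℚ_[2], ι c ≠ A) (u v : ℚ_[2]) :
    ‖ι u + ι v * A‖ ^ 2 = ‖u ^ 2 - a * v ^ 2‖ := by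
  have hAe : A ∉ IntermediateField.adjoin ℚ_[2] (∅ : Set (PadicAlgCl 2)) := by
    rw [mem_adjoin_empty_iff]; rintro ⟨c, hc⟩; exact hAn c hc
  have h := norm_conj hAe (by rw [hA]; exact intCast_mem _ a)
    (IntermediateField.algebraMap_mem _ u) (IntermediateField.algebraMap_mem _ v)
  rw [sq, ← PadicAlgCl.norm_extends]
  nth_rw 2 [← h]
  rw [← norm_mul]
  congr 1
  rw [map_sub, map_mul, map_pow, map_pow, map_intCast, ← hA]
  ring

/-- With θ = x + yA, the condition x² - ay² ≡ 5 mod 8 leaves finitely many residues. Either they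
have the shape of `condTwoClass_of_toZModPow`, or ((1 + A)/2)² · 2θ = (g + A)θ has it, where 1 + a =
2g. -/
theorem HasNormClass.condTwoClass_of_norm_eq_one (hA : A ^ 2 = a) (ha : a % 4 = 3)
    (hb : b % 8 = 5) {θ : PadicAlgCl 2} (h : HasNormClass A a b θ) (hθ : ‖θ‖ = 1) :
    CondTwoClass A θ ∨ CondTwoClass A (2 * θ) := by
  have hAn := not_exists_root_of_mod_eight hA (by omega) (by omega)
  obtain ⟨x, y, hxy⟩ := exists_padicInt_coord hA (Or.inr ha) h.mem hθ.le
  obtain ⟨u, v, r, rfl, hr, hn⟩ := h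
  obtain ⟨rfl, rfl⟩ := coord_ext hAn hxy
  have hb1 : ‖(b : ℚ_[2])‖ = 1 := by
    have := norm_intCast_eq_one (p := 2) (c := b) (by omega)
    rwa [← map_intCast ι, PadicAlgCl.norm_extends] at this
  have hr1 : ‖r‖ = 1 := by
    have := norm_sq_coord hA hAn x y
    rw [hθ, hn, norm_mul, hb1, one_mul, one_pow, norm_pow] at this
    exact (pow_eq_one_iff_of_nonneg (norm_nonneg _) two_ne_zero).1 this.symm
  obtain ⟨s, rfl⟩ : ∃ s : ℤ_[2], (s : ℚ_[2]) = r := ⟨⟨r, hr1.le⟩, rfl⟩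
  have hs : IsUnit s := PadicInt.isUnit_iff.2 hr1
  have hn' : x ^ 2 - a * y ^ 2 = b * s ^ 2 := PadicInt.ext (by
    rw [PadicInt.coe_sub, PadicInt.coe_mul, PadicInt.coe_mul, PadicInt.coe_pow, PadicInt.coe_pow,
      PadicInt.coe_pow, PadicInt.coe_intCast, PadicInt.coe_intCast]
    exact hn)
  have hm := congrArg (PadicInt.toZModPow (p := 2) 3) hn'
  have hsq : ∀ z : ZMod (2 ^ 3), IsUnit z → z ^ 2 = 1 := by decide
  rw [map_sub, map_mul, map_mul, map_pow, map_pow, map_pow, map_intCast, map_intCast,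
    hsq _ (hs.map _), mul_one, show ((b : ℤ) : ZMod (2 ^ 3)) = 5 from
      (ZMod.intCast_eq_intCast_iff b 5 8).2 hb] at hm
  have hac : ((a : ℤ) : ZMod (2 ^ 3)) = 3 ∨ ((a : ℤ) : ZMod (2 ^ 3)) = 7 := by
    rcases (by omega : a % 8 = 3 ∨ a % 8 = 7) with h | h
    · left; exact (ZMod.intCast_eq_intCast_iff a 3 8).2 h
    · right; exact (ZMod.intCast_eq_intCast_iff a 7 8).2 h
  -- The second alternative is the pair of congruences for the coordinates gx + ay and gy + x of (g
  -- + A)θ, with 2g replaced by 1 + a, since a modulo 8 does not determine g modulo 8.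
  have cases : ∀ x y c : ZMod (2 ^ 3), c = 3 ∨ c = 7 → x ^ 2 - c * y ^ 2 = 5 →
      (4 * x = 4 ∧ 2 * y = 4) ∨
        (2 * ((1 + c) * x) + 4 * (c * y) = 4 ∧ (1 + c) * y + 2 * x = 4) := by decide
  rcases cases _ _ _ hac hm with ⟨h1, h2⟩ | ⟨h1, h2⟩
  · exact Or.inl (condTwoClass_of_toZModPow hA ha h1 h2)
  · right
    obtain ⟨g, hg⟩ : ∃ g : ℤ, 1 + a = 2 * g := ⟨(1 + a) / 2, by omega⟩
    have hgz : 1 + ((a : ℤ) : ZMod (2 ^ 3)) = 2 * g := by exact_mod_cast congrArg Int.cast hg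
    have h3 := condTwoClass_of_toZModPow (X := g * x + a * y) (Y := g * y + x) hA ha
      (by
        rw [map_add, map_mul, map_mul, map_intCast, map_intCast]
        rw [hgz] at h1; linear_combination h1)
      (by
        rw [map_add, map_mul, map_intCast]
        rw [hgz] at h2; linear_combination h2)
    have hgA : (1 + A) ^ 2 = 2 * (g + A) := by
      have : (1 : PadicAlgCl 2) + a = 2 * g := by exact_mod_cast congrArg Int.cast hg
      linear_combination hA + this
    have hAL : A ∈ IntermediateField.adjoin ℚ_[2] {A} := IntermediateField.subset_adjoin _ _ rfl
    refine CondTwoClass.of_sq_mul (r := (1 + A) / 2)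
      (div_mem (add_mem (one_mem _) hAL) (ofNat_mem _ 2)) ?_
    convert h3 using 1
    rw [PadicInt.coe_add, PadicInt.coe_add, PadicInt.coe_mul, PadicInt.coe_mul, PadicInt.coe_mul,
      PadicInt.coe_intCast, PadicInt.coe_intCast, map_add, map_add, map_mul, map_mul, map_mul,
      map_intCast, map_intCast, div_pow, hgA, ← hA]
    ring

/-- The norm of θ is a unit times a square, so |θ| is an integral power of 2 and the square of a
power of the uniformizer makes θ a unit. -/
theorem HasNormClass.condTwoClass_or (hA : A ^ 2 = a) (ha : a % 4 = 3)
    (hb : b % 8 = 5) {θ : PadicAlgCl 2} (h : HasNormClass A a b θ) :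
    CondTwoClass A θ ∨ CondTwoClass A (2 * θ) := by
  have hAn := not_exists_root_of_mod_eight hA (by omega) (by omega)
  obtain ⟨e, he⟩ := exists_uniformizer hA (Or.inr ha)
  have hm : A + e ∈ IntermediateField.adjoin ℚ_[2] {A} :=
    add_mem (IntermediateField.subset_adjoin _ _ rfl) (intCast_mem _ e)
  have h0 : A + e ≠ 0 := by
    intro h; rw [h] at he; norm_num at he
  obtain ⟨k, hk⟩ : ∃ k : ℤ, ‖θ‖ = 2 ^ k := by
    obtain ⟨u, v, r, rfl, hr, hn⟩ := h
    have := norm_sq_coord hA hAn u v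
    have hb1 : ‖(b : ℚ_[2])‖ = 1 := by
      have := norm_intCast_eq_one (p := 2) (c := b) (by omega)
      rwa [← map_intCast ι, PadicAlgCl.norm_extends] at this
    rw [hn, norm_mul, hb1, one_mul, norm_pow] at this
    obtain ⟨k, hk⟩ := exists_norm_eq_zpow (p := 2) hr
    refine ⟨k, ?_⟩
    rw [(pow_left_inj₀ (norm_nonneg _) (norm_nonneg _) two_ne_zero).1 this, hk]; norm_num
  have hw := zpow_mem hm k
  have hw0 := zpow_ne_zero k h0
  have h1 : ‖((A + e) ^ k) ^ 2 * θ‖ = 1 := by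
    have := norm_zpow_sq (p := 2) he k
    rw [norm_mul, norm_pow, hk]; exact_mod_cast this
  rcases (h.sq_mul hA hAn hw hw0).condTwoClass_of_norm_eq_one hA ha hb h1 with h2 | h2
  · exact Or.inl (h2.of_sq_mul hw)
  · right
    rw [mul_left_comm] at h2
    exact h2.of_sq_mul hw

/-- If `2β` has conductor dividing `2`, then some unit `≡ 1 mod 2` is not a norm from the
extension defined by `β`. -/
theorem exists_not_isBiquadraticNorm_of_condTwoClass_two_mul (hA : A ^ 2 = a) (ha : a % 4 = 3)
    (hb : b % 8 = 5) {β : IntermediateField.adjoin ℚ_[2] {A}} (h : HasNormClass A a b β)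
    (h2 : CondTwoClass A (2 * β)) : ∃ u : IntermediateField.adjoin ℚ_[2] {A},
      ‖(u : PadicAlgCl 2) - 1‖ ≤ 2⁻¹ ∧
        ¬ IsBiquadraticNorm (b : IntermediateField.adjoin ℚ_[2] {A}) β u := by
  obtain ⟨w, hw, hw1⟩ := h2
  have hw0 : w ≠ 0 := by rintro rfl; norm_num at hw1
  -- As 2w²β ≡ 1 mod 𝔭³, its negative is ≡ -1 ≡ 1 mod 2.
  refine ⟨-(⟨w, hw⟩ ^ 2 * (2 * β)), ?_, ?_⟩
  · change ‖-(w ^ 2 * (2 * (β : PadicAlgCl 2))) - 1‖ ≤ 2⁻¹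
    rw [show -(w ^ 2 * (2 * (β : PadicAlgCl 2))) - 1 = -(w ^ 2 * (2 * β) - 1) - 2 by ring]
    refine (norm_sub_le_max _ _).trans (max_le ?_ norm_two.le)
    rw [norm_neg]
    nlinarith [norm_nonneg (w ^ 2 * (2 * (β : PadicAlgCl 2)) - 1)]
  · intro hn
    obtain ⟨P, Q, hPQ⟩ := hn.exists_quadratic_norm
    exact neg_ne_quadratic_norm hA ha hb h hw hw0 P.2 Q.2 (congrArg Subtype.val hPQ).symm

/-- Since 1 + A is a uniformizer, 2/(1 + A)² is a unit in the square class of 2, which is not a norm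
from L(√β). It shows that no ideal larger than (2) can serve as conductor. -/
theorem exists_not_isBiquadraticNorm (hA : A ^ 2 = a) (ha : a % 4 = 3) (hb : b % 8 = 5)
    {β : IntermediateField.adjoin ℚ_[2] {A}} (h : HasNormClass A a b β) :
    ∃ u : IntermediateField.adjoin ℚ_[2] {A}, ‖(u : PadicAlgCl 2)‖ = 1 ∧
      ‖(u : PadicAlgCl 2) - 1‖ ^ 2 ≤ 2⁻¹ ∧
        ¬ IsBiquadraticNorm (b : IntermediateField.adjoin ℚ_[2] {A}) β u := by
  have hAL : A ∈ IntermediateField.adjoin ℚ_[2] {A} := IntermediateField.subset_adjoin _ _ rfl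
  have h1A : ‖1 + A‖ ^ 2 = 2⁻¹ := by
    have hAn := not_exists_root_of_mod_eight hA (by omega) (by omega)
    have := norm_sq_coord hA hAn 1 1
    rw [map_one, one_mul] at this
    rw [this, one_pow, mul_one, ← PadicAlgCl.norm_extends, map_sub, map_one, map_intCast,
      show (1 : PadicAlgCl 2) - a = 2 * ((1 - a) / 2 : ℤ) by
        rw [show (2 : PadicAlgCl 2) = ((2 : ℤ) : PadicAlgCl 2) by norm_num, ← Int.cast_mul,
          show 2 * ((1 - a) / 2) = 1 - a by omega]; push_cast; ring,
      norm_mul, norm_two, norm_intCast_eq_one (by omega), mul_one]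
  have h10 : 1 + A ≠ 0 := by intro h; rw [h] at h1A; norm_num at h1A
  have hu1 : ‖2 / (1 + A) ^ 2‖ = 1 := by
    rw [norm_div, norm_pow, h1A, norm_two]; norm_num
  have hum : 2 / (1 + A) ^ 2 ∈ IntermediateField.adjoin ℚ_[2] {A} :=
    div_mem (ofNat_mem _ 2) (pow_mem (add_mem (one_mem _) hAL) 2)
  refine ⟨⟨_, hum⟩, hu1, norm_sub_one_sq_le hA ha hum hu1, fun hn => ?_⟩
  obtain ⟨P, Q, hPQ⟩ := hn.exists_quadratic_norm
  have e : (P : PadicAlgCl 2) ^ 2 - β * Q ^ 2 = 2 / (1 + A) ^ 2 := congrArg Subtype.val hPQ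
  refine two_ne_quadratic_norm (P := (1 + A) * P) (Q := (1 + A) * Q) hA ha hb h
    (mul_mem (add_mem (one_mem _) hAL) P.2) (mul_mem (add_mem (one_mem _) hAL) Q.2) ?_
  rw [eq_div_iff (pow_ne_zero 2 h10)] at e
  linear_combination -e

end

end Redei

/-! ### The conductor of an abstract local algebra. -/

namespace Redei

noncomputable section

local notation "ι" => algebraMap ℚ_[2] (PadicAlgCl 2)

theorem quadraticAlgebra_norm_eq {R : Type*} [CommRing R] {c d : R} (z : QuadraticAlgebra R c d) :
    Algebra.norm R z = QuadraticAlgebra.norm z := by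
  rw [← QuadraticAlgebra.det_toLinearMap_eq_norm, Algebra.norm_apply]
  congr 1

/-- The hypotheses make both quadratic steps fields: b becomes a square in L(√β) only if b or b/β is
a square in L. -/
theorem norm_norm_eq_zero {L : Type*} [Field L] [NeZero (2 : L)] {b β : L}
    (hβ : ∀ r : L, r ^ 2 ≠ β)
    (hb : ∀ r : L, r ^ 2 ≠ b) (hbβ : ∀ r : L, β * r ^ 2 ≠ b)
    {V : QuadraticAlgebra (QuadraticAlgebra L β 0) (algebraMap L _ b) 0}
    (h : QuadraticAlgebra.norm (QuadraticAlgebra.norm V) = 0) : V = 0 := by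
  have : Fact (∀ r : L, r ^ 2 ≠ β + 0 * r) := ⟨fun r => by simpa using hβ r⟩
  rw [QuadraticAlgebra.norm_eq_zero_iff_eq_zero] at h
  have : Fact (∀ r : QuadraticAlgebra L β 0, r ^ 2 ≠ algebraMap L _ b + 0 * r) := ⟨fun r hr => by
    obtain ⟨p, q⟩ := r
    rw [zero_mul, add_zero, sq, QuadraticAlgebra.mk_mul_mk, QuadraticAlgebra.algebraMap_eq] at hr
    obtain ⟨h1, h2⟩ := QuadraticAlgebra.ext_iff.1 hr
    simp only [zero_mul, add_zero] at h1 h2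
    have h3 : 2 * (p * q) = 0 := by linear_combination h2
    rcases mul_eq_zero.1 ((mul_eq_zero.1 h3).resolve_left two_ne_zero) with rfl | rfl
    · exact hbβ q (by linear_combination h1)
    · exact hb p (by linear_combination h1)⟩
  exact QuadraticAlgebra.norm_eq_zero_iff_eq_zero.1 h

/-- Norms from a biquadratic extension, given by generators, are norms from the biquadratic
algebra. -/
theorem exists_norm_eq_iff {R S : Type*} [CommRing R] [CommRing S] [Algebra R S] {b β : R}
    {g d : S} (hg : g ^ 2 = algebraMap R S β) (hd : d ^ 2 = algebraMap R S b)
    (hinj : Function.Injective (algebraMap R S))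
    (hsurj : ∀ s : S, ∃ u₁ u₂ v₁ v₂ : R, s = (algebraMap R S u₁ + algebraMap R S u₂ * g)
      + (algebraMap R S v₁ + algebraMap R S v₂ * g) * d)
    (h0 : ∀ V : QuadraticAlgebra (QuadraticAlgebra R β 0) (algebraMap R _ b) 0,
      QuadraticAlgebra.norm (QuadraticAlgebra.norm V) = 0 → V = 0) (c : R) :
    (∃ w : S, Algebra.norm R w = c) ↔ IsBiquadraticNorm b β c := by
  let f : QuadraticAlgebra R β 0 →ₐ[R] S := QuadraticAlgebra.lift ⟨g, by
    rw [zero_smul, add_zero, ← sq, hg, Algebra.algebraMap_eq_smul_one]⟩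
  have hf : ∀ u v : R, f ⟨u, v⟩ = algebraMap R S u + algebraMap R S v * g := fun u v => by
    simp only [f, QuadraticAlgebra.lift_apply_apply, Algebra.smul_def, mul_one]
  let : Algebra (QuadraticAlgebra R β 0) S := f.toRingHom.toAlgebra
  have hff : ∀ x, algebraMap (QuadraticAlgebra R β 0) S x = f x := fun _ => rfl
  have : IsScalarTower R (QuadraticAlgebra R β 0) S := IsScalarTower.of_algebraMap_eq fun r => by
    rw [hff, AlgHom.commutes]
  let Φ : QuadraticAlgebra (QuadraticAlgebra R β 0) (algebraMap R _ b) 0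
      →ₐ[QuadraticAlgebra R β 0] S := QuadraticAlgebra.lift ⟨d, by
    rw [zero_smul, add_zero, ← sq, hd, ← Algebra.algebraMap_eq_smul_one,
      ← IsScalarTower.algebraMap_apply]⟩
  have hΦ : ∀ u v, Φ ⟨u, v⟩ = f u + f v * d := fun u v => by
    simp only [Φ, QuadraticAlgebra.lift_apply_apply, Algebra.smul_def, mul_one, hff]
  have hbij : Function.Bijective Φ := by
    constructor
    -- If Φ kills V, then the image in S of the twofold norm of V vanishes, so this norm is zero in
    -- R.
    · rw [injective_iff_map_eq_zero]
      intro V hV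
      apply h0
      apply hinj
      have h1 : algebraMap _ S (QuadraticAlgebra.norm V) = 0 := by
        rw [← Φ.commutes, QuadraticAlgebra.algebraMap_norm_eq_mul_star, map_mul, hV, zero_mul]
      rw [IsScalarTower.algebraMap_apply R (QuadraticAlgebra R β 0) S,
        QuadraticAlgebra.algebraMap_norm_eq_mul_star, map_mul, h1, zero_mul, map_zero]
    · intro s
      obtain ⟨u₁, u₂, v₁, v₂, rfl⟩ := hsurj s
      exact ⟨⟨⟨u₁, u₂⟩, ⟨v₁, v₂⟩⟩, by rw [hΦ, hf, hf]⟩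
  let E : QuadraticAlgebra (QuadraticAlgebra R β 0) (algebraMap R _ b) 0 ≃ₐ[R] S :=
    (AlgEquiv.ofBijective Φ hbij).restrictScalars R
  have hE : ∀ V, Algebra.norm R (E V) = QuadraticAlgebra.norm (QuadraticAlgebra.norm V) := by
    intro V
    rw [Algebra.norm_eq_of_algEquiv, ← Algebra.norm_norm (S := QuadraticAlgebra R β 0),
      quadraticAlgebra_norm_eq, quadraticAlgebra_norm_eq]
  constructor
  · rintro ⟨w, hw⟩
    exact ⟨E.symm w, by rw [← hE, E.apply_symm_apply, hw]⟩
  · rintro ⟨V, hV⟩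
    exact ⟨E V, by rw [hE, hV]⟩

theorem norm_le_one_of_isIntegral_padicInt {w : PadicAlgCl 2} {p : Polynomial ℤ_[2]}
    (hp : p.Monic) (hw : p.eval₂ ((algebraMap ℚ_[2] (PadicAlgCl 2)).comp
      (algebraMap ℤ_[2] ℚ_[2])) w = 0) : ‖w‖ ≤ 1 := by
  have hv : (Valued.v (R := PadicAlgCl 2)).Integers (Valued.v (R := PadicAlgCl 2)).integer :=
    Valuation.integer.integers _
  let φ : ℤ_[2] →+* (Valued.v (R := PadicAlgCl 2)).integer :=
    ((algebraMap ℚ_[2] (PadicAlgCl 2)).comp (algebraMap ℤ_[2] ℚ_[2])).codRestrict _ fun z => by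
      change ‖algebraMap ℚ_[2] (PadicAlgCl 2) z‖ ≤ 1
      rw [PadicAlgCl.norm_extends]; exact z.2
  have h1 : IsIntegral (Valued.v (R := PadicAlgCl 2)).integer w :=
    ⟨p.map φ, hp.map φ, by rw [Polynomial.eval₂_map]; exact hw⟩
  exact hv.mem_of_integral h1

section conductor

variable {a b : ℤ} {A : PadicAlgCl 2}

theorem mem_integralClosure_iff {R : Type*} [CommRing R] [Algebra ℤ_[2] R] (hA : A ^ 2 = a)
    (ha : a % 4 = 3) (e : R ≃+* IntermediateField.adjoin ℚ_[2] {A})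
    (he : ∀ z : ℤ_[2], (e (algebraMap ℤ_[2] R z) : PadicAlgCl 2) = ι z) (r : R) :
    r ∈ integralClosure ℤ_[2] R ↔ ‖(e r : PadicAlgCl 2)‖ ≤ 1 := by
  set j : R →+* PadicAlgCl 2 := (algebraMap (IntermediateField.adjoin ℚ_[2] {A}) (PadicAlgCl 2)).comp
    (e : R →+* IntermediateField.adjoin ℚ_[2] {A}) with hj
  have hjinj : Function.Injective j :=
    (algebraMap (IntermediateField.adjoin ℚ_[2] {A}) (PadicAlgCl 2)).injective.comp e.injective
  constructor
  · rintro ⟨p, hp, h0⟩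
    refine norm_le_one_of_isIntegral_padicInt hp ?_
    have h1 := congrArg j h0
    rw [Polynomial.hom_eval₂, map_zero] at h1
    convert h1 using 1
    congr 1
    ext z
    exact (he z).symm
  · intro h
    obtain ⟨u, v, huv⟩ := exists_padicInt_coord hA (Or.inr ha) (e r).2 h
    set α : R := e.symm ⟨A, IntermediateField.subset_adjoin _ _ rfl⟩
    have hα : j α = A := by
      change ((e α : IntermediateField.adjoin ℚ_[2] {A}) : PadicAlgCl 2) = A
      rw [e.apply_symm_apply]
    have hr : r = algebraMap ℤ_[2] R u + algebraMap ℤ_[2] R v * α := by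
      apply hjinj
      rw [map_add, map_mul, hα]
      exact huv.trans (by rw [← he, ← he]; rfl)
    rw [hr]
    refine add_mem (algebraMap_mem _ u) (mul_mem (algebraMap_mem _ v) ?_)
    refine IsIntegral.of_pow two_pos ?_
    rw [show α ^ 2 = algebraMap ℤ_[2] R a by
      apply hjinj; rw [map_pow, hα, hA, map_intCast, map_intCast]]
    exact isIntegral_algebraMap

/-- If β is not of conductor dividing 2, the dichotomy says that 2β is, and this produces a non-norm
≡ 1 mod 2. If β is, then all units ≡ 1 mod 2 are norms; and an ideal not contained in (2) contains
𝔭, hence u - 1 for some unit u that is not a norm, so (2) is the largest. -/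
theorem isLocalConductor_iff {R S : Type} [CommRing R] [Algebra ℤ_[2] R] [CommRing S]
    [Algebra R S] (hA : A ^ 2 = a) (ha : a % 4 = 3) (hb : b % 8 = 5)
    (e : R ≃+* IntermediateField.adjoin ℚ_[2] {A})
    (he : ∀ z : ℤ_[2], (e (algebraMap ℤ_[2] R z) : PadicAlgCl 2) = ι z) {β : R}
    (hβ : HasNormClass A a b (e β))
    (hS : ∀ c : R, (∃ w : S, Algebra.norm R w = c) ↔ IsBiquadraticNorm (b : R) β c) :
    IsLocalConductor 2 R S (Ideal.span {2}) ↔ CondTwoClass A (e β) := by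
  have hnorm : ∀ u : R, (∃ w : S, Algebra.norm R w = u) ↔
      IsBiquadraticNorm (b : IntermediateField.adjoin ℚ_[2] {A}) (e β) (e u) := by
    intro u
    rw [hS]
    constructor
    · intro h
      simpa using h.map (e : R →+* IntermediateField.adjoin ℚ_[2] {A})
    · intro h
      simpa using h.map (e.symm : IntermediateField.adjoin ℚ_[2] {A} →+* R)
  have hmem := mem_integralClosure_iff hA ha e he
  have hspan : ∀ x : integralClosure ℤ_[2] R,
      x ∈ Ideal.span {(2 : integralClosure ℤ_[2] R)} ↔ ‖(e x : PadicAlgCl 2)‖ ≤ 2⁻¹ := by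
    intro x
    rw [Ideal.mem_span_singleton]
    constructor
    · rintro ⟨y, rfl⟩
      have h2 : (e ((2 * y : integralClosure ℤ_[2] R) : R) : PadicAlgCl 2) = 2 * e y := by
        rw [Subalgebra.coe_mul, map_mul]
        rw [show ((2 : integralClosure ℤ_[2] R) : R) = 2 from rfl, map_ofNat]; rfl
      rw [h2, norm_mul, norm_two]
      exact mul_le_of_le_one_right (by norm_num) ((hmem _).1 y.2)
    · intro h
      refine ⟨⟨e.symm (e x / 2), (hmem _).2 ?_⟩, Subtype.ext (e.injective ?_)⟩
      · rw [e.apply_symm_apply]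
        change ‖(e x : PadicAlgCl 2) / 2‖ ≤ 1
        rw [norm_div, norm_two, div_le_one (by norm_num)]; exact h
      · rw [Subalgebra.coe_mul, map_mul, e.apply_symm_apply,
          show ((2 : integralClosure ℤ_[2] R) : R) = 2 from rfl, map_ofNat]
        field_simp
  have hunit : ∀ u : IntermediateField.adjoin ℚ_[2] {A}, ‖(u : PadicAlgCl 2)‖ = 1 →
      ∃ U : (integralClosure ℤ_[2] R)ˣ, e ((U : integralClosure ℤ_[2] R) : R) = u := by
    intro u hu
    have hu0 : u ≠ 0 := by
      rintro rfl
      have h0 : ‖(0 : PadicAlgCl 2)‖ = 1 := hu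
      rw [norm_zero] at h0; exact zero_ne_one h0
    refine ⟨⟨⟨e.symm u, (hmem _).2 ?_⟩, ⟨e.symm u⁻¹, (hmem _).2 ?_⟩, Subtype.ext ?_,
      Subtype.ext ?_⟩, e.apply_symm_apply u⟩
    · rw [e.apply_symm_apply]; exact hu.le
    · rw [e.apply_symm_apply]
      change ‖(u : PadicAlgCl 2)⁻¹‖ ≤ 1
      rw [norm_inv, hu, inv_one]
    · change e.symm u * e.symm u⁻¹ = 1
      rw [← map_mul, mul_inv_cancel₀ hu0, map_one]
    · change e.symm u⁻¹ * e.symm u = 1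
      rw [← map_mul, inv_mul_cancel₀ hu0, map_one]
  have hsub : ∀ x y : R, (e (x - y) : PadicAlgCl 2) = e x - e y := by
    intro x y; rw [map_sub]; rfl
  have hone : (e (1 : R) : PadicAlgCl 2) = 1 := by rw [map_one]; rfl
  constructor
  · rintro ⟨h1, -⟩
    refine (hβ.condTwoClass_or hA ha hb).resolve_right fun h2 => ?_
    obtain ⟨u, hu, hn⟩ := exists_not_isBiquadraticNorm_of_condTwoClass_two_mul hA ha hb hβ h2
    have hu1 : ‖(u : PadicAlgCl 2)‖ = 1 := by
      have := IsUltrametricDist.norm_add_eq_max_of_norm_ne_norm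
        (x := (u : PadicAlgCl 2) - 1) (y := 1)
        (by rw [norm_one]; intro h; rw [h] at hu; norm_num at hu)
      rw [sub_add_cancel, norm_one, max_eq_right (hu.trans (by norm_num))] at this
      exact this
    obtain ⟨U, rfl⟩ := hunit u hu1
    refine hn ((hnorm _).1 (h1 U ((hspan _).2 ?_)))
    rw [show (((U : integralClosure ℤ_[2] R) - 1 : integralClosure ℤ_[2] R) : R)
      = (U : integralClosure ℤ_[2] R) - 1 from rfl, hsub, hone]
    exact hu
  · intro h
    refine ⟨fun U hU => (hnorm _).2 (h.isBiquadraticNorm hA ha hb hβ ?_), fun 𝔤 h𝔤 x hx => ?_⟩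
    · have := (hspan _).1 hU
      rwa [show (((U : integralClosure ℤ_[2] R) - 1 : integralClosure ℤ_[2] R) : R)
        = (U : integralClosure ℤ_[2] R) - 1 from rfl, hsub, hone] at this
    · rw [hspan]
      by_contra hx2
      push Not at hx2
      have hx0 : e (x : R) ≠ 0 := by
        intro h0
        rw [h0] at hx2
        change 2⁻¹ < ‖(0 : PadicAlgCl 2)‖ at hx2
        norm_num at hx2
      -- Squares of absolute values are integral powers of 2, so anything above 1/4 is at least 1/2.
      have hx3 : 2⁻¹ ≤ ‖(e (x : R) : PadicAlgCl 2)‖ ^ 2 := by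
        obtain ⟨n, hn⟩ := exists_norm_sq_eq_zpow hA ha (e (x : R)).2 (by exact_mod_cast hx0)
        have h1 : (2 : ℝ) ^ (-2 : ℤ) < 2 ^ n := by rw [← hn]; norm_num; nlinarith
        rw [zpow_lt_zpow_iff_right₀ (by norm_num)] at h1
        rw [hn, ← zpow_neg_one]
        exact zpow_le_zpow_right₀ (by norm_num) (by omega)
      obtain ⟨u, hu, hu1, hn⟩ := exists_not_isBiquadraticNorm hA ha hb hβ
      obtain ⟨U, rfl⟩ := hunit u hu
      refine hn ((hnorm _).1 (h𝔤 U ?_))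
      set y : IntermediateField.adjoin ℚ_[2] {A} :=
        (e ((U : integralClosure ℤ_[2] R) : R) - 1) / e (x : R) with hy
      have hy1 : ‖(y : PadicAlgCl 2)‖ ≤ 1 := by
        rw [← sq_le_one_iff₀ (norm_nonneg _)]
        change ‖((e ((U : integralClosure ℤ_[2] R) : R) : PadicAlgCl 2) - 1) / e (x : R)‖ ^ 2 ≤ 1
        rw [norm_div, div_pow]
        exact div_le_one_of_le₀ (hu1.trans hx3) (by positivity)
      have : (U : integralClosure ℤ_[2] R) - 1
          = x * ⟨e.symm y, (hmem _).2 (by rw [e.apply_symm_apply]; exact hy1)⟩ := by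
        refine Subtype.ext (e.injective ?_)
        change e (((U : integralClosure ℤ_[2] R) : R) - 1) = e ((x : R) * e.symm y)
        rw [map_mul, e.apply_symm_apply, hy, mul_div_cancel₀ _ hx0, map_sub, map_one]
      rw [this]
      exact 𝔤.mul_mem_right _ hx

end conductor

end

end Redei

/-! ### The completions k ⊗ ℚ₂ and F ⊗ ℚ₂. -/

namespace Redei

noncomputable section

local notation "ι" => algebraMap ℚ_[2] (PadicAlgCl 2)

variable {a b : ℤ} {A : PadicAlgCl 2}

/-- A square β contradicts its norm class. A square root of b in L would make b or ab a square in
ℚ₂, but b ≡ 5 mod 8 and ab ≡ 3 mod 4. Finally βr² = b would give b the norm class of β, so b² = bs²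
and b would be a square. -/
theorem HasNormClass.norm_norm_eq_zero (hA : A ^ 2 = a) (ha : a % 4 = 3) (hb : b % 8 = 5)
    {β : IntermediateField.adjoin ℚ_[2] {A}} (hβ : HasNormClass A a b β)
    {V : QuadraticAlgebra (QuadraticAlgebra (IntermediateField.adjoin ℚ_[2] {A}) β 0)
      (algebraMap _ _ (b : IntermediateField.adjoin ℚ_[2] {A})) 0}
    (h : QuadraticAlgebra.norm (QuadraticAlgebra.norm V) = 0) : V = 0 := by
  have hAn := not_exists_root_of_mod_eight hA (by omega) (by omega)
  have hb0 : (b : PadicAlgCl 2) ≠ 0 := by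
    rw [Int.cast_ne_zero]; omega
  have hbr : ∀ s : ℚ_[2], s ^ 2 ≠ b := fun s hs =>
    not_exists_root_of_mod_eight (A := ι s) (a := b) (by rw [← map_pow, hs, map_intCast])
      (by omega) (by omega) s rfl
  refine Redei.norm_norm_eq_zero (fun r hr => ?_) (fun r hr => ?_) (fun r hr => ?_) h
  · refine hβ.ne_sq_sub_two_mul_sq hA hAn hb r.2 (zero_mem _) ?_
    rw [← hr]
    change (r : PadicAlgCl 2) ^ 2 = _
    ring
  · have hr' : (r : PadicAlgCl 2) ^ 2 = b := congrArg Subtype.val hr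
    obtain ⟨s, t, hst⟩ := exists_coord hA r.2
    obtain ⟨h1, h2⟩ := coord_ext hAn (u := s ^ 2 + a * t ^ 2) (v := 2 * (s * t)) (u' := b) (v' := 0)
      (by
        rw [hst] at hr'
        simp only [map_add, map_mul, map_pow, map_ofNat, map_intCast, map_zero]
        rw [← hr', ← hA]; ring)
    rcases mul_eq_zero.1 ((mul_eq_zero.1 h2).resolve_left two_ne_zero) with rfl | rfl
    · refine not_exists_root_of_mod_eight (A := ι (a * t)) (a := a * b) ?_ ?_ ?_ _ rfl
      · rw [← map_pow, ← map_intCast ι]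
        congr 1
        push_cast
        linear_combination (a : ℚ_[2]) * h1
      · rw [Int.mul_emod, hb]; omega
      · rw [Int.mul_emod, show b % 4 = 1 by omega, ha]; norm_num
    · exact hbr s (by linear_combination h1)
  · have hr' : (β : PadicAlgCl 2) * (r : PadicAlgCl 2) ^ 2 = b := congrArg Subtype.val hr
    have hr0 : (r : PadicAlgCl 2) ≠ 0 := by
      intro h0
      rw [h0] at hr'
      exact hb0 (by rw [← hr']; ring)
    obtain ⟨u, v, s, h1, hs, h2⟩ := hβ.sq_mul hA hAn r.2 hr0
    obtain ⟨rfl, rfl⟩ := coord_ext hAn (u := u) (v := v) (u' := b) (v' := 0) (by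
      rw [← h1, mul_comm, hr', map_intCast]; simp)
    have hb0' : (b : ℚ_[2]) ≠ 0 := by rw [Int.cast_ne_zero]; omega
    refine hbr s (mul_left_cancel₀ hb0' ?_)
    linear_combination -h2

theorem exists_tmul_add {k : Type} [Field k] [CharZero k] {α : k}
    (hk : ∀ c : k, ∃ c₀ c₁ : ℚ, c = c₀ + c₁ * α) (r : ℚ_[2] ⊗[ℚ] k) :
    ∃ u v : ℚ_[2], r = u ⊗ₜ 1 + v ⊗ₜ α := by
  induction r using TensorProduct.induction_on with
  | zero => exact ⟨0, 0, by simp⟩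
  | tmul q c =>
    obtain ⟨c₀, c₁, rfl⟩ := hk c
    refine ⟨c₀ • q, c₁ • q, ?_⟩
    rw [TensorProduct.smul_tmul, TensorProduct.smul_tmul, ← TensorProduct.tmul_add, Rat.smul_def,
      Rat.smul_def, mul_one]
  | add r s hr hs =>
    obtain ⟨u, v, rfl⟩ := hr
    obtain ⟨u', v', rfl⟩ := hs
    exact ⟨u + u', v + v', by rw [TensorProduct.add_tmul, TensorProduct.add_tmul]; abel⟩

/-- As A is not in ℚ₂, the elements 1 and A stay independent and the tensor product is still a
quadratic field. -/
theorem exists_tensor_equiv {k : Type} [Field k] [CharZero k] {α : k}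
    (hk : ∀ c : k, ∃ c₀ c₁ : ℚ, c = c₀ + c₁ * α) (φ : k →+* PadicAlgCl 2) (hA : φ α = A)
    (hA2 : A ^ 2 = a) (hAn : ∀ c : ℚ_[2], ι c ≠ A) :
    ∃ e : ℚ_[2] ⊗[ℚ] k ≃+* IntermediateField.adjoin ℚ_[2] {A},
      ∀ (q : ℚ_[2]) (c : k), (e (q ⊗ₜ c) : PadicAlgCl 2) = ι q * φ c := by
  let f : ℚ_[2] ⊗[ℚ] k →ₐ[ℚ_[2]] PadicAlgCl 2 :=
    Algebra.TensorProduct.lift (Algebra.ofId ℚ_[2] (PadicAlgCl 2)) φ.toRatAlgHom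
      (fun _ _ => Commute.all _ _)
  have hf : ∀ (q : ℚ_[2]) (c : k), f (q ⊗ₜ c) = ι q * φ c := fun q c => by
    rw [Algebra.TensorProduct.lift_tmul]; rfl
  have hAL : A ∈ IntermediateField.adjoin ℚ_[2] {A} := IntermediateField.subset_adjoin _ _ rfl
  have hfL : ∀ r, f r ∈ (IntermediateField.adjoin ℚ_[2] {A}).toSubring := by
    intro r
    obtain ⟨u, v, rfl⟩ := exists_tmul_add hk r
    rw [map_add, hf, hf, hA, map_one, mul_one]
    exact add_mem (IntermediateField.algebraMap_mem _ u)
      (mul_mem (IntermediateField.algebraMap_mem _ v) hAL)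
  let g : ℚ_[2] ⊗[ℚ] k →+* IntermediateField.adjoin ℚ_[2] {A} :=
    (f : ℚ_[2] ⊗[ℚ] k →+* PadicAlgCl 2).codRestrict (IntermediateField.adjoin ℚ_[2] {A}).toSubring hfL
  have hg : ∀ r, (g r : PadicAlgCl 2) = f r := fun r => rfl
  refine ⟨RingEquiv.ofBijective g ⟨?_, ?_⟩, fun q c => hf q c⟩
  · rw [injective_iff_map_eq_zero]
    intro r hr
    obtain ⟨u, v, rfl⟩ := exists_tmul_add hk r
    have h1 : f (u ⊗ₜ 1 + v ⊗ₜ α) = 0 := congrArg Subtype.val hr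
    rw [map_add, hf, hf, hA, map_one, mul_one] at h1
    obtain ⟨rfl, rfl⟩ := coord_ext hAn (u' := 0) (v' := 0) (by rw [h1]; simp)
    simp
  · rintro ⟨w, hw⟩
    obtain ⟨u, v, rfl⟩ := exists_coord hA2 hw
    refine ⟨u ⊗ₜ 1 + v ⊗ₜ α, Subtype.ext ?_⟩
    change f _ = _
    rw [map_add, hf, hf, hA, map_one, mul_one]

/-- The conductor condition in terms of `β = x + y√a` over `ℚ₂(√a)`. -/
theorem localConductorTwo_iff {k F : Type} [Field k] [CharZero k] [Field F] [CharZero F]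
    [Algebra k F] {α : k} {δ γ : F} {x y z : ℚ} (ha : a % 4 = 3) (hb : b % 8 = 5)
    (hα : α ^ 2 = a) (hk : ∀ c : k, ∃ c₀ c₁ : ℚ, c = c₀ + c₁ * α) (hδ : δ ^ 2 = b)
    (hγ : γ ^ 2 = algebraMap k F (x + y * α))
    (hF : ∀ f : F, ∃ u₁ u₂ v₁ v₂ : k, f = (algebraMap k F u₁ + algebraMap k F u₂ * γ)
      + (algebraMap k F v₁ + algebraMap k F v₂ * γ) * δ)
    (h : x ^ 2 - a * y ^ 2 = b * z ^ 2) (hz : z ≠ 0) (φ : k →+* PadicAlgCl 2) (hA : φ α = A) :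
    LocalConductorTwo k F ↔ CondTwoClass A (x + y * A) := by
  have hA2 : A ^ 2 = a := by rw [← hA, ← map_pow, hα, map_intCast]
  have hAn := not_exists_root_of_mod_eight hA2 (by omega) (by omega)
  obtain ⟨e, he⟩ := exists_tensor_equiv hk φ hA hA2 hAn
  let β : ℚ_[2] ⊗[ℚ] k := 1 ⊗ₜ (x + y * α)
  have heβ : (e β : PadicAlgCl 2) = x + y * A := by
    rw [he, map_one, one_mul, map_add, map_mul, map_ratCast, map_ratCast, hA]
  have hβ : HasNormClass A a b (e β) := by
    rw [heβ]
    refine ⟨x, y, z, ?_, by exact_mod_cast hz, ?_⟩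
    · rw [map_ratCast, map_ratCast]
    · have := congrArg (Rat.cast : ℚ → ℚ_[2]) h
      simpa using this
  rw [← heβ]
  unfold LocalConductorTwo
  let : Algebra (ℚ_[2] ⊗[ℚ] k) (ℚ_[2] ⊗[ℚ] F) := (localMap 2 k F : _ →+* _).toAlgebra
  have hmap : ∀ (q : ℚ_[2]) (c : k), algebraMap (ℚ_[2] ⊗[ℚ] k) (ℚ_[2] ⊗[ℚ] F) (q ⊗ₜ c)
      = q ⊗ₜ algebraMap k F c := fun q c => by
    change localMap 2 k F (q ⊗ₜ c) = _
    rw [localMap, Algebra.TensorProduct.map_tmul]; rfl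
  refine isLocalConductor_iff hA2 ha hb e (fun r => ?_) hβ
    (exists_norm_eq_iff (g := 1 ⊗ₜ γ) (d := 1 ⊗ₜ δ) ?_ ?_ ?_ ?_ ?_)
  · rw [show algebraMap ℤ_[2] (ℚ_[2] ⊗[ℚ] k) r = (r : ℚ_[2]) ⊗ₜ 1 from rfl, he, map_one, mul_one]
  · rw [Algebra.TensorProduct.tmul_pow, one_pow, hγ, hmap]
  · rw [Algebra.TensorProduct.tmul_pow, one_pow, hδ, map_intCast]
    exact map_intCast (Algebra.TensorProduct.includeRight : F →ₐ[ℚ] ℚ_[2] ⊗[ℚ] F) b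
  · have hfield : IsField (ℚ_[2] ⊗[ℚ] k) :=
      e.toMulEquiv.isField (Field.toIsField (IntermediateField.adjoin ℚ_[2] {A}))
    let := hfield.toField
    exact (algebraMap (ℚ_[2] ⊗[ℚ] k) (ℚ_[2] ⊗[ℚ] F)).injective
  · intro s
    induction s using TensorProduct.induction_on with
    | zero => exact ⟨0, 0, 0, 0, by simp⟩
    | tmul q f =>
      obtain ⟨u₁, u₂, v₁, v₂, rfl⟩ := hF f
      refine ⟨q ⊗ₜ u₁, q ⊗ₜ u₂, q ⊗ₜ v₁, q ⊗ₜ v₂, ?_⟩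
      simp only [hmap, Algebra.TensorProduct.tmul_mul_tmul, mul_one, ← TensorProduct.tmul_add]
    | add r s hr hs =>
      obtain ⟨u₁, u₂, v₁, v₂, rfl⟩ := hr
      obtain ⟨u₁', u₂', v₁', v₂', rfl⟩ := hs
      exact ⟨u₁ + u₁', u₂ + u₂', v₁ + v₁', v₂ + v₂', by simp only [map_add]; ring⟩
  · rintro ⟨⟨u₁, u₂⟩, ⟨v₁, v₂⟩⟩ hV
    have h1 := congrArg e hV
    rw [norm_norm_mk] at h1
    simp only [map_sub, map_add, map_mul, map_pow, map_ofNat, map_intCast, map_zero] at h1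
    rw [← norm_norm_mk] at h1
    have h2 := hβ.norm_norm_eq_zero hA2 ha hb h1
    obtain ⟨h3, h4⟩ := QuadraticAlgebra.ext_iff.1 h2
    obtain ⟨h5, h6⟩ := QuadraticAlgebra.ext_iff.1 h3
    obtain ⟨h7, h8⟩ := QuadraticAlgebra.ext_iff.1 h4
    have hz : ∀ r, e r = 0 → r = 0 := fun r hr => (map_eq_zero_iff e e.injective).1 hr
    rw [hz _ h5, hz _ h6, hz _ h7, hz _ h8]
    rfl

end

end Redei

/-! ### Integers and discriminants of quadratic fields. -/

namespace Redei

noncomputable section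

theorem discr_quadraticAlgebra_basis (A B : ℤ) :
    Algebra.discr ℤ (QuadraticAlgebra.basis A B) = B ^ 2 + 4 * A := by
  have htr : ∀ w : QuadraticAlgebra ℤ A B, Algebra.trace ℤ _ w = 2 * w.re + B * w.im := by
    intro w
    rw [Algebra.trace_eq_matrix_trace (QuadraticAlgebra.basis A B), Matrix.trace_fin_two,
      Algebra.leftMulMatrix_eq_repr_mul, Algebra.leftMulMatrix_eq_repr_mul]
    simp [QuadraticAlgebra.basis]
    ring
  rw [Algebra.discr_def, Matrix.det_fin_two]
  simp only [Algebra.traceMatrix_apply, Algebra.traceForm_apply, htr]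
  simp [QuadraticAlgebra.basis]
  ring

theorem discr_eq_of_span {K : Type*} [Field K] [NumberField K] {A B : ℤ} {θ : 𝓞 K}
    (hθ : θ ^ 2 = A + B * θ) (hspan : ∀ w : 𝓞 K, ∃ m n : ℤ, w = m + n * θ)
    (hind : ∀ m n : ℤ, (m : 𝓞 K) + n * θ = 0 → m = 0 ∧ n = 0) :
    NumberField.discr K = B ^ 2 + 4 * A := by
  let f : QuadraticAlgebra ℤ A B →ₐ[ℤ] 𝓞 K := QuadraticAlgebra.lift ⟨θ, by
    rw [← sq, hθ]; simp⟩
  have hf : ∀ m n : ℤ, f ⟨m, n⟩ = m + n * θ := fun m n => by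
    simp [f, QuadraticAlgebra.lift_apply_apply]
  have hbij : Function.Bijective f := by
    constructor
    · rw [injective_iff_map_eq_zero]
      rintro ⟨m, n⟩ h
      rw [hf] at h
      obtain ⟨rfl, rfl⟩ := hind m n h
      rfl
    · intro w
      obtain ⟨m, n, rfl⟩ := hspan w
      exact ⟨⟨m, n⟩, hf m n⟩
  let e := AlgEquiv.ofBijective f hbij
  rw [← NumberField.discr_eq_discr K ((QuadraticAlgebra.basis A B).map e.toLinearEquiv),
    ← discr_quadraticAlgebra_basis, Algebra.discr_eq_discr_of_algEquiv _ e]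
  rfl

theorem exists_int_of_isIntegral {K : Type*} [Field K] [CharZero K] {q : ℚ}
    (h : IsIntegral ℤ (q : K)) : ∃ n : ℤ, (n : ℚ) = q := by
  have h1 : IsIntegral ℤ q := by
    rw [← isIntegral_algebraMap_iff (algebraMap ℚ K).injective]
    simpa using h
  exact IsIntegrallyClosed.isIntegral_iff.1 h1

/-- The integral elements of `ℚ(√d)`, for squarefree `d`. -/
theorem exists_int_coord {K : Type*} [Field K] [NumberField K] {d : ℤ} (hd : Squarefree d)
    (hd1 : ¬ IsSquare (d : ℚ)) {δ : K} (hδ : δ ^ 2 = d) {u v : ℚ}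
    (h : IsIntegral ℤ ((u : K) + v * δ)) :
    ∃ m n : ℤ, 2 * u = m ∧ 2 * v = n ∧ (4 : ℤ) ∣ m ^ 2 - d * n ^ 2 := by
  let φ : K →ₐ[ℚ] AlgebraicClosure ℚ := IsAlgClosed.lift
  have : Normal ℚ (AlgebraicClosure ℚ) := by
    have h := AlgebraicClosure.instIsAlgClosure ℚ
    rw [Subsingleton.elim (AlgebraicClosure.instAlgebra ℚ) DivisionRing.toRatAlgebra] at h
    exact IsAlgClosure.normal ℚ (AlgebraicClosure ℚ)
  obtain ⟨σ, hσ⟩ := exists_algEquiv_neg (k := ℚ) (A := φ δ) (c := (d : ℚ))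
    (by rw [← map_pow, hδ, map_intCast, map_intCast]) (fun r hr => hd1 ⟨r, by
      have h2 : (algebraMap ℚ (AlgebraicClosure ℚ) r) ^ 2 = algebraMap ℚ _ d := by
        rw [hr, ← map_pow, hδ, map_intCast, map_intCast]
      rw [← map_pow] at h2
      rw [← (algebraMap ℚ (AlgebraicClosure ℚ)).injective h2, sq]⟩)
  have h1 : IsIntegral ℤ ((u : AlgebraicClosure ℚ) + v * φ δ) := by
    simpa using h.map (φ.restrictScalars ℤ)
  have h2 : IsIntegral ℤ ((u : AlgebraicClosure ℚ) - v * φ δ) := by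
    have := h1.map (σ.toAlgHom.restrictScalars ℤ)
    simpa [hσ, sub_eq_add_neg] using this
  have hφδ : φ δ ^ 2 = d := by rw [← map_pow, hδ, map_intCast]
  obtain ⟨m, hm⟩ := exists_int_of_isIntegral (K := AlgebraicClosure ℚ) (q := 2 * u) (by
    have := h1.add h2
    rw [show ((2 * u : ℚ) : AlgebraicClosure ℚ) = (u + v * φ δ) + (u - v * φ δ) by push_cast; ring]
    exact this)
  obtain ⟨N, hN⟩ := exists_int_of_isIntegral (K := AlgebraicClosure ℚ) (q := u ^ 2 - d * v ^ 2) (by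
    have := h1.mul h2
    rw [show ((u ^ 2 - d * v ^ 2 : ℚ) : AlgebraicClosure ℚ) = (u + v * φ δ) * (u - v * φ δ) by
      push_cast; rw [← hφδ]; ring]
    exact this)
  -- The trace 2u and the norm u² - dv² are integers, so d(2v)² is one; as d is squarefree, 2v has
  -- denominator 1.
  have e : (d : ℚ) * (2 * v) ^ 2 = ((m ^ 2 - 4 * N : ℤ) : ℚ) := by
    push_cast
    rw [hm, hN]; ring
  obtain ⟨n, hn⟩ : ∃ n : ℤ, (n : ℚ) = 2 * v := by
    set q := 2 * v with hq
    have hden : (d : ℚ) * (q.num : ℚ) ^ 2 = ((m ^ 2 - 4 * N : ℤ) : ℚ) * (q.den : ℚ) ^ 2 := by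
      rw [← e]
      nth_rw 2 [← Rat.num_div_den q]
      have : (q.den : ℚ) ≠ 0 := by exact_mod_cast q.den_nz
      field_simp
    have hden' : d * q.num ^ 2 = (m ^ 2 - 4 * N) * (q.den : ℤ) ^ 2 := by exact_mod_cast hden
    have hcop : IsCoprime ((q.den : ℤ) ^ 2) (q.num ^ 2) :=
      (Int.isCoprime_iff_gcd_eq_one.2 (by
        have := q.reduced
        rw [Nat.coprime_comm] at this
        simpa [Int.gcd, Nat.Coprime] using this)).pow
    have hdvd : (q.den : ℤ) ^ 2 ∣ d := hcop.dvd_of_dvd_mul_right ⟨_, by rw [hden', mul_comm]⟩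
    have hunit := hd (q.den : ℤ) (by rwa [← sq])
    have : q.den = 1 := by
      have := Int.isUnit_iff_natAbs_eq.1 hunit
      simpa using this
    exact ⟨q.num, Rat.coe_int_num_of_den_eq_one this⟩
  refine ⟨m, n, hm.symm, hn.symm, N, ?_⟩
  rw [← hn] at e
  have e' : d * n ^ 2 = m ^ 2 - 4 * N := by exact_mod_cast e
  linarith

theorem not_four_dvd_of_squarefree {d : ℤ} (hd : Squarefree d) : d % 4 ≠ 0 := by
  intro h
  have h2 := hd 2 (by norm_num; omega)
  rw [Int.isUnit_iff] at h2
  omega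

/-- The discriminant of `ℚ(√d)`, for squarefree `d`. -/
theorem discr_quadratic {K : Type*} [Field K] [NumberField K] {d : ℤ} (hd : Squarefree d)
    (hd1 : ¬ IsSquare (d : ℚ)) {δ : K} (hδ : δ ^ 2 = d)
    (hK : ∀ w : K, ∃ u v : ℚ, w = u + v * δ) :
    NumberField.discr K = if d % 4 = 1 then d else 4 * d := by
  have hδn : ∀ u v : ℚ, (u : K) + v * δ = 0 → u = 0 ∧ v = 0 := by
    intro u v h
    have hv : v = 0 := by
      by_contra hv
      refine hd1 ⟨u / v, ?_⟩
      have hv' : (v : K) ≠ 0 := by exact_mod_cast hv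
      have h1 : δ = -(u / v) := by
        field_simp; linear_combination h
      have h2 : (d : K) = ((u / v * (u / v) : ℚ) : K) := by
        rw [← hδ, h1]; push_cast; ring
      exact_mod_cast h2
    subst hv
    simpa using h
  have hd4 := not_four_dvd_of_squarefree hd
  split_ifs with hmod
  · obtain ⟨c, hc⟩ : ∃ c : ℤ, d = 1 + 4 * c := ⟨(d - 1) / 4, by omega⟩
    have hθ2 : ((1 + δ) / 2) ^ 2 = (c : K) + (1 : ℤ) * ((1 + δ) / 2) := by
      have : (d : K) = 1 + 4 * c := by exact_mod_cast congrArg Int.cast hc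
      rw [div_pow]; field_simp; push_cast
      linear_combination hδ + this
    have hθ : IsIntegral ℤ ((1 + δ) / 2) := by
      refine ⟨Polynomial.X ^ 2 - Polynomial.X - Polynomial.C c, by monicity!, ?_⟩
      rw [Polynomial.eval₂_sub, Polynomial.eval₂_sub, Polynomial.eval₂_pow, Polynomial.eval₂_X,
        Polynomial.eval₂_C, hθ2]
      simp
    obtain ⟨θ, hθv⟩ : ∃ θ : 𝓞 K, (θ : K) = (1 + δ) / 2 := ⟨⟨_, hθ⟩, rfl⟩
    rw [discr_eq_of_span (A := c) (B := 1) (θ := θ) (NumberField.RingOfIntegers.ext (by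
      simp only [map_add, map_mul, map_pow, map_intCast, hθv]; exact hθ2))]
    · rw [hc]; ring
    · intro w
      obtain ⟨u, v, huv⟩ := hK w
      obtain ⟨m, n, hm, hn, hmn⟩ := exists_int_coord hd hd1 hδ
        (by rw [← huv]; exact w.isIntegral_coe)
      have hpar : (m - n) % 2 = 0 := by
        rcases Int.emod_two_eq_zero_or_one m with h1 | h1 <;>
        rcases Int.emod_two_eq_zero_or_one n with h2 | h2
        · omega
        · exfalso
          obtain ⟨k, hk⟩ := hmn
          obtain ⟨i, rfl⟩ : ∃ i, m = 2 * i := ⟨m / 2, by omega⟩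
          obtain ⟨j, rfl⟩ : ∃ j, n = 2 * j + 1 := ⟨n / 2, by omega⟩
          have : d * (4 * (j ^ 2 + j) + 1) = 4 * i ^ 2 - 4 * k := by linear_combination -hk
          rw [hc] at this
          have : (4 : ℤ) ∣ 1 := ⟨i ^ 2 - k - (1 + 4 * c) * (j ^ 2 + j) - c, by linear_combination this⟩
          omega
        · exfalso
          obtain ⟨k, hk⟩ := hmn
          obtain ⟨i, rfl⟩ : ∃ i, m = 2 * i + 1 := ⟨m / 2, by omega⟩
          obtain ⟨j, rfl⟩ : ∃ j, n = 2 * j := ⟨n / 2, by omega⟩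
          have : (4 : ℤ) ∣ 1 := ⟨k - i ^ 2 - i + d * j ^ 2, by linear_combination hk⟩
          omega
        · omega
      obtain ⟨k, hk⟩ : ∃ k, m = n + 2 * k := ⟨(m - n) / 2, by omega⟩
      refine ⟨k, n, NumberField.RingOfIntegers.ext ?_⟩
      have hu : (2 : K) * u = n + 2 * k := by
        have : 2 * u = n + 2 * k := by rw [hm, hk]; push_cast; ring
        exact_mod_cast congrArg (Rat.cast : ℚ → K) this
      have hv : (2 : K) * v = n := by exact_mod_cast congrArg (Rat.cast : ℚ → K) hn
      simp only [map_add, map_mul, map_intCast, hθv]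
      rw [huv]
      linear_combination hu / 2 + δ / 2 * hv
    · intro m n h
      have h' : (m : K) + n * ((1 + δ) / 2) = 0 := by
        have := congrArg (algebraMap (𝓞 K) K) h
        simpa only [map_add, map_mul, map_intCast, hθv, map_zero] using this
      obtain ⟨h1, h2⟩ := hδn (m + n / 2) (n / 2) (by push_cast; linear_combination h')
      have h3 : (n : ℚ) = 0 := by linarith
      have h4 : (m : ℚ) = 0 := by linarith
      exact ⟨by exact_mod_cast h4, by exact_mod_cast h3⟩
  · have hθ : IsIntegral ℤ δ := IsIntegral.of_pow two_pos (by
      rw [hδ]; exact isIntegral_algebraMap (R := ℤ) (x := d))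
    obtain ⟨θ, hθv⟩ : ∃ θ : 𝓞 K, (θ : K) = δ := ⟨⟨_, hθ⟩, rfl⟩
    rw [discr_eq_of_span (A := d) (B := 0) (θ := θ) (NumberField.RingOfIntegers.ext (by
      simp only [map_add, map_mul, map_pow, map_intCast, hθv]; simpa using hδ))]
    · ring
    · intro w
      obtain ⟨u, v, huv⟩ := hK w
      obtain ⟨m, n, hm, hn, hmn⟩ := exists_int_coord hd hd1 hδ
        (by rw [← huv]; exact w.isIntegral_coe)
      have hpar : m % 2 = 0 ∧ n % 2 = 0 := by
        have hz : ∀ m n d : ZMod 4, m ^ 2 - d * n ^ 2 = 0 → d ≠ 0 → d ≠ 1 →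
            2 * m = 0 ∧ 2 * n = 0 := by decide
        have h1 : (m : ZMod 4) ^ 2 - d * (n : ZMod 4) ^ 2 = 0 := by
          exact_mod_cast (ZMod.intCast_zmod_eq_zero_iff_dvd _ 4).2 hmn
        obtain ⟨h2, h3⟩ := hz _ _ _ h1
          (fun h => by
            have := (ZMod.intCast_zmod_eq_zero_iff_dvd d 4).1 h
            omega)
          (fun h => by
            have := (ZMod.intCast_eq_intCast_iff d 1 4).1 (by simpa using h)
            exact hmod this)
        have h2' := (ZMod.intCast_zmod_eq_zero_iff_dvd (2 * m) 4).1 (by push_cast; exact h2)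
        have h3' := (ZMod.intCast_zmod_eq_zero_iff_dvd (2 * n) 4).1 (by push_cast; exact h3)
        omega
      obtain ⟨i, hi⟩ : ∃ i, m = 2 * i := ⟨m / 2, by omega⟩
      obtain ⟨j, hj⟩ : ∃ j, n = 2 * j := ⟨n / 2, by omega⟩
      refine ⟨i, j, NumberField.RingOfIntegers.ext ?_⟩
      have hu : u = i := by rw [hi] at hm; push_cast at hm; linarith
      have hv : v = j := by rw [hj] at hn; push_cast at hn; linarith
      simp only [map_add, map_mul, map_intCast, hθv]
      rw [huv, hu, hv, Rat.cast_intCast, Rat.cast_intCast]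
    · intro m n h
      have h' : (m : K) + n * δ = 0 := by
        have := congrArg (algebraMap (𝓞 K) K) h
        simpa only [map_add, map_mul, map_intCast, hθv, map_zero] using this
      obtain ⟨h1, h2⟩ := hδn m n (by push_cast; exact h')
      exact ⟨by exact_mod_cast h1, by exact_mod_cast h2⟩

end

end Redei

/-! ### Squarefree parts, the field F, and the interchange of a and b. -/

namespace Redei

noncomputable section

/-- `a = m r²` with `m ≠ 1` a squarefree integer. -/
structure IsSquarefreePart (a : ℚ) (m : ℤ) (r : ℚ) : Prop where
  squarefree : Squarefree m
  not_sq : ¬ IsSquare (m : ℚ)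
  ne_zero : r ≠ 0
  eq : a = m * r ^ 2

theorem sqClass_eq_one_iff {t : ℚˣ} : (t : SqClass) = 1 ↔ IsSquare (t : ℚ) := by
  rw [QuotientGroup.eq_one_iff]
  constructor
  · rintro ⟨u, rfl⟩
    exact ⟨u, by simp [sq]⟩
  · rintro ⟨u, hu⟩
    have hu0 : u ≠ 0 := by rintro rfl; simp at hu
    exact ⟨Units.mk0 u hu0, Units.ext (by simp [hu, sq])⟩

theorem exists_squarefree_mul_sq (t : ℚˣ) :
    ∃ (m : ℤ) (r : ℚ), Squarefree m ∧ r ≠ 0 ∧ (t : ℚ) = m * r ^ 2 := by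
  set q := (t : ℚ)
  have hq : q ≠ 0 := t.ne_zero
  have hden : (q.den : ℚ) ≠ 0 := by exact_mod_cast q.den_nz
  set N : ℤ := q.num * q.den
  have hN0 : N ≠ 0 := mul_ne_zero (Rat.num_ne_zero.2 hq) (by exact_mod_cast q.den_nz)
  obtain ⟨k, l, hkl, hk⟩ := Nat.sq_mul_squarefree N.natAbs
  have hl : l ≠ 0 := by
    rintro rfl
    rw [zero_pow two_ne_zero, zero_mul, eq_comm, Int.natAbs_eq_zero] at hkl
    exact hN0 hkl
  have hN : (N : ℚ) = (N.sign * k : ℤ) * (l : ℚ) ^ 2 := by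
    have : N = N.sign * k * (l : ℤ) ^ 2 := by
      conv_lhs => rw [← Int.sign_mul_natAbs N, ← hkl]
      push_cast; ring
    exact_mod_cast this
  refine ⟨N.sign * k, l / q.den, ?_, div_ne_zero (by exact_mod_cast hl) hden, ?_⟩
  · rw [← Int.squarefree_natAbs, Int.natAbs_mul, Int.natAbs_sign_of_ne_zero hN0, one_mul]
    simpa using hk
  · rw [div_pow, ← mul_div_assoc, ← hN, eq_div_iff (pow_ne_zero 2 hden)]
    have : (N : ℚ) = q.num * q.den := by simp [N]
    rw [this]
    nth_rw 1 [← Rat.num_div_den q]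
    field_simp

theorem exists_isSquarefreePart {t : ℚˣ} (ht : (t : SqClass) ≠ 1) :
    ∃ (m : ℤ) (r : ℚ), IsSquarefreePart t m r := by
  obtain ⟨m, r, hm, hr, h⟩ := exists_squarefree_mul_sq t
  refine ⟨m, r, hm, fun ⟨c, hc⟩ => ht (sqClass_eq_one_iff.2 ⟨c * r, ?_⟩), hr, h⟩
  rw [h, hc]; ring

theorem mem_quadField {a : ℚ} {w : ℂ} (hw : w ∈ quadField a) :
    ∃ u v : ℚ, w = u + v * rt (a : ℂ) := by
  have halg : IsAlgebraic ℚ (rt (a : ℂ)) := by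
    refine (IsIntegral.of_pow two_pos ?_).isAlgebraic
    rw [rt_sq]; exact isIntegral_algebraMap (x := a)
  have h : w ∈ Algebra.adjoin ℚ {rt (a : ℂ)} := by
    rw [← IntermediateField.adjoin_toSubalgebra_of_isAlgebraic (by simpa using halg)]
    exact hw
  obtain ⟨u, v, h⟩ := mem_adjoin_singleton_sqrt (c := a) (by rw [rt_sq]; rfl) h
  exact ⟨u, v, h⟩

theorem rt_mem_quadField (a : ℚ) : rt (a : ℂ) ∈ quadField a :=
  IntermediateField.subset_adjoin _ _ rfl

namespace IsSquarefreePart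

variable {a : ℚ} {m : ℤ} {r : ℚ} (h : IsSquarefreePart a m r)

/-- The square root of `m` in `ℚ(√a)`, where `a = m r²`. -/
def root (_ : IsSquarefreePart a m r) : quadField a :=
  ⟨rt (a : ℂ) / r, div_mem (rt_mem_quadField a) (SubfieldClass.ratCast_mem _ r)⟩

include h

theorem cast_ne_zero : (r : ℂ) ≠ 0 := by exact_mod_cast h.ne_zero

theorem ne : m ≠ 0 := by
  rintro rfl
  exact h.not_sq (by simp)

theorem rt_div_sq : (rt (a : ℂ) / r) ^ 2 = m := by
  rw [div_pow, rt_sq, div_eq_iff (pow_ne_zero 2 h.cast_ne_zero)]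
  exact_mod_cast congrArg (Rat.cast : ℚ → ℂ) h.eq

theorem root_sq : h.root ^ 2 = m := Subtype.ext (by
  have := h.rt_div_sq
  simpa [root] using this)

theorem exists_coord (w : quadField a) : ∃ u v : ℚ, w = u + v * h.root := by
  obtain ⟨u, v, hw⟩ := mem_quadField w.2
  refine ⟨u, v * r, Subtype.ext ?_⟩
  rw [hw]
  have := h.cast_ne_zero
  change _ = (u : ℂ) + ((v * r : ℚ) : ℂ) * (rt (a : ℂ) / r)
  push_cast
  field_simp

theorem disc_eq : disc a = if m % 4 = 1 then m else 4 * m :=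
  discr_quadratic h.squarefree h.not_sq h.root_sq h.exists_coord

end IsSquarefreePart

theorem isAlgebraic_of_mem {a b x y : ℚ} :
    ∀ w ∈ ({rt (a : ℂ), rt (b : ℂ), rt ((x : ℂ) + (y : ℂ) * rt (a : ℂ))} : Set ℂ),
      IsIntegral ℚ w := by
  have h1 : ∀ c : ℚ, IsIntegral ℚ (rt (c : ℂ)) := fun c =>
    IsIntegral.of_pow two_pos (by rw [rt_sq]; exact isIntegral_algebraMap (x := c))
  rintro w (rfl | rfl | rfl)
  · exact h1 a
  · exact h1 b
  · refine IsIntegral.of_pow two_pos ?_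
    rw [rt_sq]
    exact (isIntegral_algebraMap (x := x)).add ((isIntegral_algebraMap (x := y)).mul (h1 a))

theorem mem_fieldF_iff {a b x y : ℚ} {w : ℂ} : w ∈ fieldF a b x y ↔
    w ∈ Algebra.adjoin ℚ {rt (a : ℂ), rt (b : ℂ), rt ((x : ℂ) + (y : ℂ) * rt (a : ℂ))} := by
  rw [← IntermediateField.adjoin_toSubalgebra_of_isAlgebraic
    (fun w hw => (isAlgebraic_of_mem w hw).isAlgebraic)]
  rfl

theorem finiteDimensional_fieldF (a b x y : ℚ) : FiniteDimensional ℚ (fieldF a b x y) :=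
  IntermediateField.finiteDimensional_adjoin isAlgebraic_of_mem

instance (a b x y : ℚ) :
    NumberField (IntermediateField.extendScalars (quadField_mul_le a b x y)) where
  to_charZero := inferInstance
  to_finiteDimensional := finiteDimensional_fieldF a b x y

theorem IsNonzeroSolution.right_ne {a b x y z : ℚ} (ha : ¬ IsSquare a)
    (h : IsNonzeroSolution a b x y z) : z ≠ 0 := by
  rintro rfl
  obtain ⟨h0, h⟩ := h
  by_cases hy : y = 0
  · subst hy
    have : x = 0 := by simpa using h
    subst this
    exact h0 rfl
  · refine ha ⟨x / y, ?_⟩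
    field_simp
    linear_combination -h

theorem IsSquarefreePart.not_isSquare {a : ℚ} {m : ℤ} {r : ℚ} (h : IsSquarefreePart a m r) :
    ¬ IsSquare a := by
  rintro ⟨c, hc⟩
  refine h.not_sq ⟨c / r, ?_⟩
  have := h.ne_zero
  field_simp
  rw [h.eq] at hc
  linear_combination hc

section

variable {a b x y z r s : ℚ} {m n : ℤ}

theorem IsNonzeroSolution.left_ne (hb : ¬ IsSquare b)
    (h : IsNonzeroSolution a b x y z) : y ≠ 0 := by
  have h' : IsNonzeroSolution b a x z y := by
    refine ⟨fun h0 => h.1 ?_, by linear_combination h.2⟩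
    simp only [Prod.mk.injEq] at h0 ⊢
    tauto
  exact h'.right_ne hb

theorem IsNonzeroSolution.normalized (ha : IsSquarefreePart a m r) (hb : IsSquarefreePart b n s)
    (h : IsNonzeroSolution a b x y z) :
    x ^ 2 - (m : ℚ) * (y * r) ^ 2 = n * (z * s) ^ 2 := by
  linear_combination h.2 + y ^ 2 * ha.eq + z ^ 2 * hb.eq

theorem IsNonzeroSolution.isRedeiField (ha : IsSquarefreePart a m r) (hb : IsSquarefreePart b n s)
    (h : IsNonzeroSolution a b x y z) :
    ∃ α δ γ, IsRedeiField m n x (y * r) (z * s) (quadField (a * b))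
      (IntermediateField.extendScalars (quadField_mul_le a b x y)) α δ γ := by
  have har := ha.cast_ne_zero
  have hbs := hb.cast_ne_zero
  have hmem : ∀ w ∈ ({rt (a : ℂ), rt (b : ℂ), rt ((x : ℂ) + (y : ℂ) * rt (a : ℂ))} : Set ℂ),
      w ∈ fieldF a b x y := fun w hw => IntermediateField.subset_adjoin _ _ hw
  -- The chosen square root of ab is the product of the chosen roots of a and b only up to sign.
  obtain ⟨ε, hε, hε'⟩ : ∃ ε : ℚ, ε ≠ 0 ∧
      rt ((a * b : ℚ) : ℂ) = ε * (rt (a : ℂ) * rt (b : ℂ)) := by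
    have h : rt ((a * b : ℚ) : ℂ) ^ 2 = (rt (a : ℂ) * rt (b : ℂ)) ^ 2 := by
      rw [mul_pow, rt_sq, rt_sq, rt_sq]; push_cast; rfl
    rcases sq_eq_sq_iff_eq_or_eq_neg.1 h with h | h
    · exact ⟨1, one_ne_zero, by rw [h]; simp⟩
    · exact ⟨-1, by norm_num, by rw [h]; simp⟩
  have hεc : (ε : ℂ) ≠ 0 := by exact_mod_cast hε
  set F := IntermediateField.extendScalars (quadField_mul_le a b x y)
  set α : F := ⟨rt (a : ℂ) / r, div_mem (hmem _ (by simp)) (SubfieldClass.ratCast_mem _ r)⟩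
  set δ : F := ⟨rt (b : ℂ) / s, div_mem (hmem _ (by simp)) (SubfieldClass.ratCast_mem _ s)⟩
  set γ : F := ⟨rt ((x : ℂ) + (y : ℂ) * rt (a : ℂ)), hmem _ (by simp)⟩
  let f : F →ₐ[ℚ] ℂ := (algebraMap F ℂ).toRatAlgHom
  have hf : ∀ w : F, f w = w := fun _ => rfl
  have hfinj : Function.Injective f := f.injective
  have hfα : f α = rt (a : ℂ) / r := rfl
  have hfδ : f δ = rt (b : ℂ) / s := rfl
  have hfγ : f γ = rt ((x : ℂ) + (y : ℂ) * rt (a : ℂ)) := rfl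
  refine ⟨α, δ, γ, ?_, ?_, ?_, h.normalized ha hb, ha.not_sq, hb.not_sq,
    mul_ne_zero (h.right_ne ha.not_isSquare) hb.ne_zero, ?_, ?_, ?_⟩
  · apply hfinj
    rw [map_pow, hfα, ha.rt_div_sq, AlgHom.commutes]; simp
  · apply hfinj
    rw [map_pow, hfδ, hb.rt_div_sq, AlgHom.commutes]; simp
  · apply hfinj
    rw [map_pow, hfγ, rt_sq, map_add, map_mul, AlgHom.commutes, AlgHom.commutes, hfα]
    simp only [eq_ratCast, Rat.cast_mul]
    field_simp
  · rw [eq_top_iff]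
    rintro w -
    have hle : Algebra.adjoin ℚ {rt (a : ℂ), rt (b : ℂ), rt ((x : ℂ) + (y : ℂ) * rt (a : ℂ))}
        ≤ (Algebra.adjoin ℚ {γ, α, δ}).map f := by
      refine Algebra.adjoin_le ?_
      rintro v (rfl | rfl | rfl)
      · refine ⟨algebraMap ℚ F r * α, mul_mem (Subalgebra.algebraMap_mem _ _)
          (Algebra.subset_adjoin (by simp)), ?_⟩
        change f (algebraMap ℚ F r * α) = _
        rw [map_mul, hfα, AlgHom.commutes, eq_ratCast]; field_simp
      · refine ⟨algebraMap ℚ F s * δ, mul_mem (Subalgebra.algebraMap_mem _ _)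
          (Algebra.subset_adjoin (by simp)), ?_⟩
        change f (algebraMap ℚ F s * δ) = _
        rw [map_mul, hfδ, AlgHom.commutes, eq_ratCast]; field_simp
      · exact ⟨γ, Algebra.subset_adjoin (by simp), hfγ⟩
    obtain ⟨w', hw', hww⟩ := hle (mem_fieldF_iff.1 w.2)
    rwa [← hfinj hww]
  · refine ⟨⟨rt ((a * b : ℚ) : ℂ) / (ε * r * s : ℚ), div_mem (rt_mem_quadField _)
      (SubfieldClass.ratCast_mem _ _)⟩, hfinj ?_⟩
    rw [map_mul, hfα, hfδ]
    change rt ((a * b : ℚ) : ℂ) / (ε * r * s : ℚ) = _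
    rw [hε']
    push_cast
    field_simp
  · intro k
    obtain ⟨u, v, huv⟩ := mem_quadField k.2
    refine ⟨u, v * ε * r * s, hfinj ?_⟩
    rw [map_add, map_mul f, map_mul f, AlgHom.commutes, AlgHom.commutes, hfα, hfδ]
    change (k : ℂ) = _
    rw [huv, hε']
    simp only [eq_ratCast, Rat.cast_mul]
    field_simp

theorem IsNonzeroSolution.unramifiedOver_iff (ha : IsSquarefreePart a m r)
    (hb : IsSquarefreePart b n s) (h : IsNonzeroSolution a b x y z) {p : ℕ} [Fact p.Prime]
    {A B : PadicAlgCl p} (hA : A ^ 2 = m) (hB : B ^ 2 = n) :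
    UnramifiedOver (quadField (a * b))
      (IntermediateField.extendScalars (quadField_mul_le a b x y)) p ↔
      UnrClass (IntermediateField.adjoin ℚ_[p] {A, B}) (x + (y * r : ℚ) * A) := by
  obtain ⟨α, δ, γ, hR⟩ := h.isRedeiField ha hb
  exact hR.unramifiedOver_iff (by rw [hA, Rat.cast_intCast]) (by rw [hB, Rat.cast_intCast])

/-- The field E is a variable, so that the statement also applies with a and b interchanged to the
same subfield of ℂ, presented differently. -/
theorem IsNonzeroSolution.localConductorTwo_iff (ha : IsSquarefreePart a m r)
    (hb : IsSquarefreePart b n s) (h : IsNonzeroSolution a b x y z) (hm : m % 4 = 3)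
    (hn : n % 8 = 5) (φ : quadField a →+* PadicAlgCl 2) {E : IntermediateField ℚ ℂ}
    (hE : E = fieldF a b x y) (hle : quadField a ≤ E) :
    LocalConductorTwo (quadField a) (IntermediateField.extendScalars hle) ↔
      CondTwoClass (φ ha.root) (x + (y * r : ℚ) * φ ha.root) := by
  subst hE
  have hbs := hb.cast_ne_zero
  have har := ha.cast_ne_zero
  have hmem : ∀ w ∈ ({rt (a : ℂ), rt (b : ℂ), rt ((x : ℂ) + (y : ℂ) * rt (a : ℂ))} : Set ℂ),
      w ∈ fieldF a b x y := fun w hw => IntermediateField.subset_adjoin _ _ hw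
  set G := rt ((x : ℂ) + (y : ℂ) * rt (a : ℂ)) with hG
  refine Redei.localConductorTwo_iff (δ := ⟨rt (b : ℂ) / s, div_mem (hmem _ (by simp))
    (SubfieldClass.ratCast_mem _ s)⟩) (γ := ⟨G, hmem _ (by simp)⟩) hm hn ha.root_sq
    ha.exists_coord (Subtype.ext ?_) (Subtype.ext ?_) ?_ (h.normalized ha hb)
    (mul_ne_zero (h.right_ne ha.not_isSquare) hb.ne_zero) φ rfl
  · simpa using hb.rt_div_sq
  · change G ^ 2 = (x : ℂ) + (y * r : ℚ) * (rt (a : ℂ) / r)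
    rw [hG, rt_sq]
    push_cast
    field_simp
  · rintro ⟨w, hw⟩
    have hQ : ∀ v ∈ Algebra.adjoin ℚ {rt (a : ℂ)}, v ∈ quadField a := fun v hv =>
      IntermediateField.algebra_adjoin_le_adjoin _ _ hv
    have hw' : w ∈ Algebra.adjoin ℚ {rt (b : ℂ), G, rt (a : ℂ)} := by
      refine Algebra.adjoin_mono ?_ (mem_fieldF_iff.1 hw)
      rintro v (rfl | rfl | rfl) <;> simp [hG]
    have hG2 : G ^ 2 ∈ Algebra.adjoin ℚ {rt (a : ℂ)} := by
      rw [hG, rt_sq]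
      exact add_mem (Subalgebra.algebraMap_mem _ x) (mul_mem (Subalgebra.algebraMap_mem _ y)
        (Algebra.subset_adjoin rfl))
    obtain ⟨u, hu, v, hv, rfl⟩ := mem_adjoin_insert_sqrt
      (by rw [rt_sq]; exact Subalgebra.algebraMap_mem _ b) hw'
    obtain ⟨u₁, hu₁, u₂, hu₂, rfl⟩ := mem_adjoin_insert_sqrt hG2 hu
    obtain ⟨v₁, hv₁, v₂, hv₂, rfl⟩ := mem_adjoin_insert_sqrt hG2 hv
    have hs : ∀ v ∈ quadField a, s * v ∈ quadField a := fun v hv =>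
      mul_mem (SubfieldClass.ratCast_mem _ s) hv
    refine ⟨⟨u₁, hQ _ hu₁⟩, ⟨u₂, hQ _ hu₂⟩, ⟨s * v₁, hs _ (hQ _ hv₁)⟩, ⟨s * v₂, hs _ (hQ _ hv₂)⟩,
      Subtype.ext ?_⟩
    change _ = u₁ + u₂ * G + (s * v₁ + s * v₂ * G) * (rt (b : ℂ) / s)
    field_simp

/-- With √β' = z√b/√β one has (√β + √β')² = β + β' + 2z√b = 2x + 2z√b. -/
theorem fieldF_swap_le (ha : ¬ IsSquare a) (hb : ¬ IsSquare b) (h : IsNonzeroSolution a b x y z) :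
    fieldF b a (2 * x) (2 * z) ≤ fieldF a b x y := by
  have hmem : ∀ w ∈ ({rt (a : ℂ), rt (b : ℂ), rt ((x : ℂ) + (y : ℂ) * rt (a : ℂ))} : Set ℂ),
      w ∈ fieldF a b x y := fun w hw => IntermediateField.subset_adjoin _ _ hw
  have ha' := hmem (rt (a : ℂ)) (by simp)
  have hb' := hmem (rt (b : ℂ)) (by simp)
  have hG' := hmem (rt ((x : ℂ) + (y : ℂ) * rt (a : ℂ))) (by simp)
  set G := rt ((x : ℂ) + (y : ℂ) * rt (a : ℂ)) with hG
  have hz := h.right_ne ha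
  have hb0 : rt (b : ℂ) ≠ 0 := by
    intro h0
    have := rt_sq (b : ℂ)
    rw [h0, zero_pow two_ne_zero] at this
    have hb0 : b = 0 := by exact_mod_cast this.symm
    exact hb (hb0 ▸ IsSquare.zero)
  have heq : (x : ℂ) ^ 2 - a * y ^ 2 = b * z ^ 2 := by
    have := congrArg (Rat.cast : ℚ → ℂ) h.2
    push_cast at this
    linear_combination this
  have hprod : ((x : ℂ) + y * rt (a : ℂ)) * (x - y * rt (a : ℂ)) = (z * rt (b : ℂ)) ^ 2 := by
    rw [mul_pow, rt_sq]
    linear_combination heq - y ^ 2 * rt_sq (a : ℂ)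
  have hG2 : G ^ 2 = (x : ℂ) + y * rt (a : ℂ) := rt_sq _
  have hG0 : G ≠ 0 := by
    intro h0
    rw [← hG2, h0, zero_pow two_ne_zero, zero_mul, eq_comm, pow_eq_zero_iff two_ne_zero] at hprod
    exact mul_ne_zero (by exact_mod_cast hz) hb0 hprod
  refine IntermediateField.adjoin_le_iff.2 ?_
  rintro w (rfl | rfl | rfl)
  · exact hb'
  · exact ha'
  · have h1 : rt (((2 * x : ℚ) : ℂ) + ((2 * z : ℚ) : ℂ) * rt (b : ℂ)) ^ 2
        = (G + z * rt (b : ℂ) / G) ^ 2 := by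
      rw [rt_sq]
      push_cast
      field_simp
      linear_combination (2 * x - G ^ 2) * hG2 - (x + y * rt (a : ℂ)) * hG2 + hprod
    have h2 : G + z * rt (b : ℂ) / G ∈ fieldF a b x y :=
      add_mem hG' (div_mem (mul_mem (SubfieldClass.ratCast_mem _ z) hb') hG')
    rcases sq_eq_sq_iff_eq_or_eq_neg.1 h1 with h | h <;> rw [SetLike.mem_coe, h]
    · exact h2
    · exact neg_mem h2

theorem IsNonzeroSolution.swap (h : IsNonzeroSolution a b x y z) :
    IsNonzeroSolution b a (2 * x) (2 * z) (2 * y) := by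
  refine ⟨fun h0 => h.1 ?_, by linear_combination 4 * h.2⟩
  simp only [Prod.mk.injEq, mul_eq_zero, OfNat.ofNat_ne_zero, false_or] at h0 ⊢
  tauto

theorem fieldF_mul_four (a b x y : ℚ) : fieldF a b (2 * (2 * x)) (2 * (2 * y)) = fieldF a b x y := by
  have h : rt (((2 * (2 * x) : ℚ) : ℂ) + ((2 * (2 * y) : ℚ) : ℂ) * rt (a : ℂ)) ^ 2
      = (2 * rt ((x : ℂ) + y * rt (a : ℂ))) ^ 2 := by
    rw [mul_pow, rt_sq, rt_sq]; push_cast; ring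
  apply le_antisymm <;> refine IntermediateField.adjoin_le_iff.2 ?_
  · rintro w (rfl | rfl | rfl)
    · exact IntermediateField.subset_adjoin _ _ (by simp)
    · exact IntermediateField.subset_adjoin _ _ (by simp)
    · have : 2 * rt ((x : ℂ) + y * rt (a : ℂ)) ∈ fieldF a b x y :=
        mul_mem (ofNat_mem _ 2) (IntermediateField.subset_adjoin _ _ (by simp))
      rcases sq_eq_sq_iff_eq_or_eq_neg.1 h with h | h <;> rw [SetLike.mem_coe, h]
      · exact this
      · exact neg_mem this
  · rintro w (rfl | rfl | rfl)
    · exact IntermediateField.subset_adjoin _ _ (by simp)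
    · exact IntermediateField.subset_adjoin _ _ (by simp)
    · have h0 : rt (((2 * (2 * x) : ℚ) : ℂ) + ((2 * (2 * y) : ℚ) : ℂ) * rt (a : ℂ)) / 2
          ∈ fieldF a b (2 * (2 * x)) (2 * (2 * y)) :=
        div_mem (IntermediateField.subset_adjoin _ _ (by simp)) (ofNat_mem _ 2)
      rcases sq_eq_sq_iff_eq_or_eq_neg.1 h with h | h
      · rw [h, mul_div_cancel_left₀ _ two_ne_zero] at h0
        exact h0
      · rw [h, neg_div, mul_div_cancel_left₀ _ two_ne_zero] at h0
        exact neg_mem_iff.1 h0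

/-- Interchanging twice multiplies the solution by 4, a square, which does not change the field.
This gives the other inclusion. -/
theorem fieldF_swap (ha : ¬ IsSquare a) (hb : ¬ IsSquare b) (h : IsNonzeroSolution a b x y z) :
    fieldF a b x y = fieldF b a (2 * x) (2 * z) := by
  refine le_antisymm ?_ (fieldF_swap_le ha hb h)
  have := fieldF_swap_le hb ha h.swap
  rwa [fieldF_mul_four] at this

end

end

end Redei

/-! ### Signed primes and 2-parts of discriminants. -/

namespace Redei

noncomputable section

theorem signedPrime_emod_four {p : ℕ} (hp : p.Prime) (hp2 : p ≠ 2) : signedPrime p % 4 = 1 := by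
  unfold signedPrime
  have hodd := hp.eq_two_or_odd.resolve_left hp2
  rcases (by omega : p % 4 = 1 ∨ p % 4 = 3) with h | h
  · rw [Even.neg_one_pow (Nat.even_iff.2 (by omega))]; omega
  · rw [Odd.neg_one_pow (Nat.odd_iff.2 (by omega))]; omega

theorem natAbs_signedPrime (p : ℕ) : (signedPrime p).natAbs = p := by
  simp [signedPrime, Int.natAbs_mul, Int.natAbs_pow]

theorem prod_signedPrime_emod_four {S : Finset ℕ} (hS : ∀ p ∈ S, p.Prime ∧ p ≠ 2) :
    (∏ p ∈ S, signedPrime p) % 4 = 1 := by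
  refine Finset.prod_induction (p := fun n : ℤ => n % 4 = 1) _ (fun u v hu hv => ?_) rfl
    (fun p hp => signedPrime_emod_four (hS p hp).1 (hS p hp).2)
  rw [Int.mul_emod, hu, hv]; rfl

/-- An odd squarefree integer `k` is `∏ p*` up to sign. -/
theorem prod_signedPrime_eq {k : ℤ} (hk : Squarefree k) (hodd : k % 2 = 1) :
    ∏ p ∈ k.natAbs.primeFactors, signedPrime p = if k % 4 = 1 then k else -k := by
  have h1 : (∏ p ∈ k.natAbs.primeFactors, signedPrime p) % 4 = 1 :=
    prod_signedPrime_emod_four fun p hp => ⟨Nat.prime_of_mem_primeFactors hp, by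
      rintro rfl
      have := Int.natCast_dvd.2 (Nat.dvd_of_mem_primeFactors hp)
      push_cast at this
      omega⟩
  have h2 : (∏ p ∈ k.natAbs.primeFactors, signedPrime p).natAbs = k.natAbs := by
    rw [← Int.natAbsHom_apply, map_prod]
    simp only [Int.natAbsHom_apply, natAbs_signedPrime]
    exact Nat.prod_primeFactors_of_squarefree (Int.squarefree_natAbs.2 hk)
  split_ifs <;> omega

theorem twoPart_mul {c k : ℤ} (hc : c = 1 ∨ c = 4 ∨ c = 8) (hk : Squarefree k)
    (hodd : k % 2 = 1) : twoPart (c * k) = if k % 4 = 1 then c else -c := by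
  have hk0 := hk.ne_zero
  have hset : (c * k).natAbs.primeFactors.erase 2 = k.natAbs.primeFactors := by
    ext p
    have h2 : ¬ 2 ∣ k.natAbs := by omega
    rw [Finset.mem_erase, Int.natAbs_mul, Nat.mem_primeFactors, Nat.mem_primeFactors]
    constructor
    · rintro ⟨hp2, hp, hd, h0⟩
      refine ⟨hp, (hp.dvd_mul.1 hd).resolve_left fun h => hp2 ?_, by omega⟩
      have h3 : p ∣ 2 ^ 3 := h.trans (by rcases hc with rfl | rfl | rfl <;> decide)
      exact (Nat.prime_dvd_prime_iff_eq hp Nat.prime_two).1 (hp.dvd_of_dvd_pow h3)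
    · rintro ⟨hp, hd, h0⟩
      refine ⟨by rintro rfl; exact h2 hd, hp, hd.mul_left _, ?_⟩
      rcases hc with rfl | rfl | rfl <;> simpa using hk0
  rw [twoPart, hset, prod_signedPrime_eq hk hodd]
  split_ifs
  · exact Int.mul_ediv_cancel _ hk0
  · rw [show c * k = -c * -k by ring]
    exact Int.mul_ediv_cancel _ (neg_ne_zero.2 hk0)

namespace IsSquarefreePart

variable {a : ℚ} {m : ℤ} {r : ℚ} (h : IsSquarefreePart a m r)

include h

theorem emod_four_ne : m % 4 ≠ 0 := not_four_dvd_of_squarefree h.squarefree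

theorem twoPart_cases : (m % 4 = 1 ∧ twoPart (disc a) = 1) ∨ (m % 4 = 3 ∧ twoPart (disc a) = -4) ∨
    (m % 8 = 2 ∧ twoPart (disc a) = 8) ∨ (m % 8 = 6 ∧ twoPart (disc a) = -8) := by
  have h4 := h.emod_four_ne
  rw [h.disc_eq]
  rcases Int.emod_two_eq_zero_or_one m with h2 | h2
  · obtain ⟨k, hk⟩ : ∃ k, m = 2 * k := ⟨m / 2, by omega⟩
    have hsq : Squarefree k := h.squarefree.squarefree_of_dvd ⟨2, by rw [hk]; ring⟩
    have := twoPart_mul (c := 8) (by norm_num) hsq (by omega)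
    rw [if_neg (by omega), show 4 * m = 8 * k by rw [hk]; ring, this]
    split_ifs <;> omega
  · split_ifs with h1
    · have := twoPart_mul (c := 1) (by norm_num) h.squarefree h2
      rw [one_mul, if_pos h1] at this
      exact Or.inl ⟨h1, this⟩
    · have := twoPart_mul (c := 4) (by norm_num) h.squarefree h2
      rw [if_neg h1] at this
      exact Or.inr (Or.inl ⟨by omega, this⟩)

theorem even_disc_iff : Even (disc a) ↔ m % 4 ≠ 1 := by
  rw [h.disc_eq, Int.even_iff]; split_ifs <;> omega

theorem disc_modEq_one : disc a ≡ 1 [ZMOD 8] ↔ m % 8 = 1 := by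
  rw [h.disc_eq, Int.ModEq]; split_ifs <;> omega

theorem disc_modEq_five : disc a ≡ 5 [ZMOD 8] ↔ m % 8 = 5 := by
  rw [h.disc_eq, Int.ModEq]; split_ifs <;> omega

theorem disc_modEq_four : disc a ≡ 4 [ZMOD 8] ↔ m % 4 = 3 := by
  have h4 := h.emod_four_ne
  rw [h.disc_eq, Int.ModEq]; split_ifs <;> omega

theorem dvd_disc_iff {p : ℕ} (hp : p.Prime) (hp2 : p ≠ 2) : (p : ℤ) ∣ disc a ↔ (p : ℤ) ∣ m := by
  rw [h.disc_eq]
  split_ifs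
  · rfl
  · have hpp := Nat.prime_iff_prime_int.1 hp
    rw [hpp.dvd_mul, or_iff_right]
    intro h4
    have h3 : p ∣ 2 ^ 2 := by exact_mod_cast h4
    exact hp2 ((Nat.prime_dvd_prime_iff_eq hp Nat.prime_two).1 (hp.dvd_of_dvd_pow h3))

end IsSquarefreePart

end

end Redei

/-! ### Existence of minimally ramified extensions. -/

namespace Redei

noncomputable section

theorem exists_sq_eq (p : ℕ) [Fact p.Prime] (m : ℤ) : ∃ A : PadicAlgCl p, A ^ 2 = m :=
  IsAlgClosed.exists_pow_nat_eq _ two_pos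

theorem cast_mul_add {p : ℕ} [Fact p.Prime] (t x y r : ℚ) (A : PadicAlgCl p) :
    ((t * x : ℚ) : PadicAlgCl p) + ((t * y * r : ℚ) : PadicAlgCl p) * A
      = t * (x + (y * r : ℚ) * A) := by
  push_cast; ring

theorem add_mul_mem {p : ℕ} [Fact p.Prime] {L : IntermediateField ℚ_[p] (PadicAlgCl p)} (x y : ℚ)
    {A : PadicAlgCl p} (hA : A ∈ L) : (x : PadicAlgCl p) + y * A ∈ L :=
  add_mem (SubfieldClass.ratCast_mem _ x) (mul_mem (SubfieldClass.ratCast_mem _ y) hA)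

theorem IsNonzeroSolution.smul {a b x y z t : ℚ} (h : IsNonzeroSolution a b x y z) (ht : t ≠ 0) :
    IsNonzeroSolution a b (t * x) (t * y) (t * z) := by
  refine ⟨fun h0 => h.1 ?_, by linear_combination t ^ 2 * h.2⟩
  simpa [ht] using h0

/-- `ℚ(√(ab)) ⊂ F(x, y, z)` is unramified over `p`. -/
abbrev UnramifiedAt (a b x y : ℚ) (p : ℕ) : Prop :=
  UnramifiedOver (quadField (a * b)) (IntermediateField.extendScalars (quadField_mul_le a b x y)) p

theorem padicValRat_intCast_eq_zero {p : ℕ} {N : ℤ} (h : ¬ (p : ℤ) ∣ N) :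
    padicValRat p (N : ℚ) = 0 := by
  rw [padicValRat.of_int, padicValInt.eq_zero_of_not_dvd h]; rfl

section

variable {a b x y z r s : ℚ} {m n : ℤ} {p : ℕ}

theorem unramifiedAt_of_dvd (ha : IsSquarefreePart a m r) (hb : IsSquarefreePart b n s)
    (h : IsNonzeroSolution a b x y z) (hp : p.Prime) (hp2 : p ≠ 2)
    (hd : ((p : ℤ) ∣ m ∧ ¬ (p : ℤ) ∣ n) ∨ (¬ (p : ℤ) ∣ m ∧ (p : ℤ) ∣ n)) :
    UnramifiedAt a b x y p := by
  have : Fact p.Prime := ⟨hp⟩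
  obtain ⟨A, hA⟩ := exists_sq_eq p m
  obtain ⟨B, hB⟩ := exists_sq_eq p n
  have hz := mul_ne_zero (h.right_ne ha.not_isSquare) hb.ne_zero
  rw [UnramifiedAt, h.unramifiedOver_iff ha hb hA hB]
  rcases hd with ⟨h1, h2⟩ | ⟨h1, h2⟩
  · exact unrClass_of_dvd_left hp2 ha.squarefree h1 h2 hA (h.normalized ha hb) hz
  · exact unrClass_of_dvd_right hp2 hb.squarefree h1 h2 hA hB (h.normalized ha hb) hz

theorem unramifiedAt_smul_iff (ha : IsSquarefreePart a m r) (hb : IsSquarefreePart b n s)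
    (h : IsNonzeroSolution a b x y z) (hp : p.Prime) (hp2 : p ≠ 2) (hpm : ¬ (p : ℤ) ∣ m)
    (hpn : ¬ (p : ℤ) ∣ n) (hu : UnramifiedAt a b x y p) {t : ℚ} (ht : t ≠ 0) :
    UnramifiedAt a b (t * x) (t * y) p ↔ Even (padicValRat p t) := by
  have : Fact p.Prime := ⟨hp⟩
  obtain ⟨A, hA⟩ := exists_sq_eq p m
  obtain ⟨B, hB⟩ := exists_sq_eq p n
  rw [UnramifiedAt, h.unramifiedOver_iff ha hb hA hB] at hu
  rw [UnramifiedAt, (h.smul ht).unramifiedOver_iff ha hb hA hB, cast_mul_add,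
    hu.mul_iff (add_mul_mem _ _ (IntermediateField.subset_adjoin _ _ (by simp))),
    unrClass_ratCast_iff hp2 hpm hpn hA hB ht]

theorem unramifiedAt_or (ha : IsSquarefreePart a m r) (hb : IsSquarefreePart b n s)
    (h : IsNonzeroSolution a b x y z) (hp : p.Prime) (hp2 : p ≠ 2) (hpm : ¬ (p : ℤ) ∣ m)
    (hpn : ¬ (p : ℤ) ∣ n) :
    UnramifiedAt a b x y p ∨ UnramifiedAt a b (p * x) (p * y) p := by
  have : Fact p.Prime := ⟨hp⟩
  obtain ⟨A, hA⟩ := exists_sq_eq p m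
  obtain ⟨B, hB⟩ := exists_sq_eq p n
  have hp0 : (p : ℚ) ≠ 0 := by exact_mod_cast hp.ne_zero
  rw [UnramifiedAt, UnramifiedAt, h.unramifiedOver_iff ha hb hA hB,
    (h.smul hp0).unramifiedOver_iff ha hb hA hB, cast_mul_add, Rat.cast_natCast]
  exact unrClass_or hp2 hpm hpn hA hB (h.normalized ha hb)
    (mul_ne_zero (h.right_ne ha.not_isSquare) hb.ne_zero) hb.ne

theorem norm_ratCast_le_one {p : ℕ} [Fact p.Prime] {q : ℚ} (h : ¬ p ∣ q.den) :
    ‖(q : PadicAlgCl p)‖ ≤ 1 := by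
  rw [norm_ratCast]; exact Padic.norm_rat_le_one h

/-- Outside finitely many primes β is already a unit. Twisting by the product of the bad primes
changes the parity at each of them once and is a unit at the others. -/
theorem exists_forall_unramifiedAt (ha : IsSquarefreePart a m r) (hb : IsSquarefreePart b n s)
    (h : IsNonzeroSolution a b x y z) : ∃ t : ℚ, t ≠ 0 ∧ ∀ p : ℕ, p.Prime → p ≠ 2 →
      ¬ (p : ℤ) ∣ m → ¬ (p : ℤ) ∣ n → UnramifiedAt a b (t * x) (t * y) p := by
  classical
  have hz := mul_ne_zero (h.right_ne ha.not_isSquare) hb.ne_zero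
  set N : ℕ := x.den * (y * r).den * (z * s).den * (z * s).num.natAbs with hN
  have hN0 : N ≠ 0 := by
    have := (z * s).num_ne_zero.2 hz
    have h1 := x.den_nz
    have h2 := (y * r).den_nz
    have h3 := (z * s).den_nz
    simp only [hN, mul_ne_zero_iff, Int.natAbs_ne_zero]
    tauto
  have hgood : ∀ p : ℕ, p.Prime → p ≠ 2 → ¬ (p : ℤ) ∣ n → ¬ p ∣ N → UnramifiedAt a b x y p := by
    intro p hp hp2 hpn hpN
    have : Fact p.Prime := ⟨hp⟩
    obtain ⟨A, hA⟩ := exists_sq_eq p m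
    obtain ⟨B, hB⟩ := exists_sq_eq p n
    have h1 : ¬ p ∣ x.den := fun hd => hpN (by
      rw [hN]; exact ((hd.mul_right _).mul_right _).mul_right _)
    have h2 : ¬ p ∣ (y * r).den := fun hd => hpN (by
      rw [hN]; exact ((hd.mul_left _).mul_right _).mul_right _)
    have h3 : ¬ p ∣ (z * s).den := fun hd => hpN (by
      rw [hN]; exact (hd.mul_left _).mul_right _)
    have h4 : ¬ (p : ℤ) ∣ (z * s).num := fun hd => hpN (by
      rw [hN]; exact (Int.natCast_dvd.1 hd).mul_left _)
    rw [UnramifiedAt, h.unramifiedOver_iff ha hb hA hB]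
    refine unrClass_of_norm_le hp2 hpn hA (h.normalized ha hb) (norm_ratCast_le_one h1)
      (norm_ratCast_le_one h2) ?_
    rw [← Rat.num_div_den (z * s)]
    push_cast
    rw [norm_div, norm_intCast_eq_one h4]
    have := norm_intCast_eq_one (p := p) (c := ((z * s).den : ℤ)) (by exact_mod_cast h3)
    rw [Int.cast_natCast] at this
    rw [this, div_one]
  set S := N.primeFactors.filter fun p => ¬ UnramifiedAt a b x y p ∧ p ≠ 2 with hS
  have hSp : ∀ p ∈ S, p.Prime := fun p hp => Nat.prime_of_mem_primeFactors (Finset.mem_filter.1 hp).1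
  have hprod : ∀ (T : Finset ℕ), T ⊆ S → ∀ p : ℕ, p.Prime → p ∉ T →
      ¬ (p : ℤ) ∣ ((∏ q ∈ T, q : ℕ) : ℤ) := by
    intro T hT p hp hpT hd
    obtain ⟨q, hq, hpq⟩ := (hp.prime.dvd_finsetProd_iff _).1 (Int.natCast_dvd_natCast.1 hd)
    exact hpT (((Nat.prime_dvd_prime_iff_eq hp (hSp q (hT hq))).1 hpq) ▸ hq)
  refine ⟨((∏ q ∈ S, q : ℕ) : ℤ), ?_, fun p hp hp2 hpm hpn => ?_⟩
  · have : (∏ q ∈ S, q : ℕ) ≠ 0 := Finset.prod_ne_zero_iff.2 fun q hq => (hSp q hq).ne_zero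
    exact_mod_cast this
  by_cases hpS : p ∈ S
  · have hp0 : (p : ℚ) ≠ 0 := by exact_mod_cast hp.ne_zero
    have h1 := (unramifiedAt_or ha hb h hp hp2 hpm hpn).resolve_left (Finset.mem_filter.1 hpS).2.1
    have h2 : (((∏ q ∈ S, q : ℕ) : ℤ) : ℚ) = (((∏ q ∈ S.erase p, q : ℕ) : ℤ) : ℚ) * p := by
      rw [← Finset.prod_erase_mul _ _ hpS]; push_cast; rfl
    have h3 : (((∏ q ∈ S.erase p, q : ℕ) : ℤ) : ℚ) ≠ 0 := by
      have : (∏ q ∈ S.erase p, q : ℕ) ≠ 0 :=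
        Finset.prod_ne_zero_iff.2 fun q hq => (hSp q (Finset.mem_of_mem_erase hq)).ne_zero
      exact_mod_cast this
    rw [h2, mul_assoc, mul_assoc, unramifiedAt_smul_iff ha hb (h.smul hp0) hp hp2 hpm hpn h1 h3,
      padicValRat_intCast_eq_zero (hprod _ (Finset.erase_subset _ _) p hp (Finset.notMem_erase _ _))]
    exact Even.zero
  · have h1 : UnramifiedAt a b x y p := by
      by_contra h1
      refine hpS (Finset.mem_filter.2 ⟨Nat.mem_primeFactors.2 ⟨hp, ?_, hN0⟩, h1, hp2⟩)
      by_contra hpN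
      exact h1 (hgood p hp hp2 hpn hpN)
    have h3 : (((∏ q ∈ S, q : ℕ) : ℤ) : ℚ) ≠ 0 := by
      have : (∏ q ∈ S, q : ℕ) ≠ 0 := Finset.prod_ne_zero_iff.2 fun q hq => (hSp q hq).ne_zero
      exact_mod_cast this
    rw [unramifiedAt_smul_iff ha hb h hp hp2 hpm hpn h1 h3,
      padicValRat_intCast_eq_zero (hprod S subset_rfl p hp hpS)]
    exact Even.zero

/-- Odd primes dividing exactly one of m, n impose nothing, so only those dividing neither remain.
The condition over ℚ₂(√b) is read off from the interchanged presentation of F. -/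
theorem minimallyRamified_iff (ha : IsSquarefreePart a m r) (hb : IsSquarefreePart b n s)
    (h : IsNonzeroSolution a b x y z) (φ : quadField a →+* PadicAlgCl 2)
    (ψ : quadField b →+* PadicAlgCl 2) : MinimallyRamified a b x y ↔
      (∀ p : ℕ, p.Prime → p ≠ 2 → ¬ (p : ℤ) ∣ m → ¬ (p : ℤ) ∣ n → UnramifiedAt a b x y p) ∧
      ((m % 4 = 1 ∧ n % 4 = 1) ∨ m % 8 = 1 ∨ n % 8 = 1 →
        UnrClass (IntermediateField.adjoin ℚ_[2] {φ ha.root, ψ hb.root})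
          (x + (y * r : ℚ) * φ ha.root)) ∧
      (m % 4 = 3 → n % 8 = 5 → CondTwoClass (φ ha.root) (x + (y * r : ℚ) * φ ha.root)) ∧
      (m % 8 = 5 → n % 4 = 3 →
        CondTwoClass (ψ hb.root) ((2 * x : ℚ) + (2 * z * s : ℚ) * ψ hb.root)) := by
  have hA : φ ha.root ^ 2 = m := by rw [← map_pow, ha.root_sq, map_intCast]
  have hB : ψ hb.root ^ 2 = n := by rw [← map_pow, hb.root_sq, map_intCast]
  have h1 : (∀ p : ℕ, p.Prime → p ≠ 2 → ¬ p ∣ Int.gcd (disc a) (disc b) → UnramifiedAt a b x y p) ↔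
      ∀ p : ℕ, p.Prime → p ≠ 2 → ¬ (p : ℤ) ∣ m → ¬ (p : ℤ) ∣ n → UnramifiedAt a b x y p := by
    have hg : ∀ p : ℕ, p.Prime → p ≠ 2 → (p ∣ Int.gcd (disc a) (disc b) ↔
        (p : ℤ) ∣ m ∧ (p : ℤ) ∣ n) := by
      intro p hp hp2
      rw [← ha.dvd_disc_iff hp hp2, ← hb.dvd_disc_iff hp hp2, Int.natCast_dvd, Int.natCast_dvd]
      exact Nat.dvd_gcd_iff
    refine forall_congr' fun p => forall_congr' fun hp => forall_congr' fun hp2 => ?_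
    rw [hg p hp hp2]
    constructor
    · exact fun hu hpm _ => hu fun hc => hpm hc.1
    · intro hu hc
      by_cases hpm : (p : ℤ) ∣ m <;> by_cases hpn : (p : ℤ) ∣ n
      · exact absurd ⟨hpm, hpn⟩ hc
      · exact unramifiedAt_of_dvd ha hb h hp hp2 (Or.inl ⟨hpm, hpn⟩)
      · exact unramifiedAt_of_dvd ha hb h hp hp2 (Or.inr ⟨hpm, hpn⟩)
      · exact hu hpm hpn
  have h2 : Odd (disc a * disc b) ∨ disc a ≡ 1 [ZMOD 8] ∨ disc b ≡ 1 [ZMOD 8] ↔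
      (m % 4 = 1 ∧ n % 4 = 1) ∨ m % 8 = 1 ∨ n % 8 = 1 := by
    rw [Int.odd_mul, ← Int.not_even_iff_odd, ← Int.not_even_iff_odd, ha.even_disc_iff,
      hb.even_disc_iff, ha.disc_modEq_one, hb.disc_modEq_one, not_not, not_not]
  have hu := h.unramifiedOver_iff ha hb hA hB
  have hl := fun hm hn => h.localConductorTwo_iff ha hb hm hn φ rfl (quadField_left_le a b x y)
  have hr := fun hm hn => h.swap.localConductorTwo_iff hb ha hm hn ψ
    (fieldF_swap ha.not_isSquare hb.not_isSquare h) (quadField_right_le a b x y)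
  rw [← h1, ← h2, ← hu, ← ha.disc_modEq_four, ← hb.disc_modEq_five, ← ha.disc_modEq_five,
    ← hb.disc_modEq_four]
  constructor
  · rintro ⟨c1, c2, c3, c4⟩
    exact ⟨c1, c2, fun e1 e2 => (hl (ha.disc_modEq_four.1 e1) (hb.disc_modEq_five.1 e2)).1 (c3 e1 e2),
      fun e1 e2 => (hr (hb.disc_modEq_four.1 e2) (ha.disc_modEq_five.1 e1)).1 (c4 e1 e2)⟩
  · rintro ⟨c1, c2, c3, c4⟩
    exact ⟨c1, c2, fun e1 e2 => (hl (ha.disc_modEq_four.1 e1) (hb.disc_modEq_five.1 e2)).2 (c3 e1 e2),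
      fun e1 e2 => (hr (hb.disc_modEq_four.1 e2) (ha.disc_modEq_five.1 e1)).2 (c4 e1 e2)⟩

theorem IsNonzeroSolution.hasNormClass (ha : IsSquarefreePart a m r) (hb : IsSquarefreePart b n s)
    (h : IsNonzeroSolution a b x y z) {A : PadicAlgCl 2} :
    HasNormClass A m n (x + (y * r : ℚ) * A) := by
  have hz := mul_ne_zero (h.right_ne ha.not_isSquare) hb.ne_zero
  refine ⟨x, (y * r : ℚ), (z * s : ℚ), ?_, by exact_mod_cast hz, ?_⟩
  · rw [map_ratCast, map_ratCast]
  · have := congrArg (Rat.cast : ℚ → ℚ_[2]) (h.normalized ha hb)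
    push_cast at this ⊢
    exact this

/-- The odd primes are settled first. A further twist by ±1 or ±2 does not affect them, and at most
one of the three conditions at 2 is in force. -/
theorem exists_minimallyRamified (ha : IsSquarefreePart a m r) (hb : IsSquarefreePart b n s)
    (h : IsNonzeroSolution a b x y z) :
    ∃ t : ℚ, t ≠ 0 ∧ MinimallyRamified a b (t * x) (t * y) := by
  obtain ⟨t, ht, hodd⟩ := exists_forall_unramifiedAt ha hb h
  have h1 := h.smul ht
  obtain ⟨φ⟩ : Nonempty (quadField a →ₐ[ℚ] PadicAlgCl 2) := ⟨IsAlgClosed.lift⟩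
  obtain ⟨ψ⟩ : Nonempty (quadField b →ₐ[ℚ] PadicAlgCl 2) := ⟨IsAlgClosed.lift⟩
  have hA : φ ha.root ^ 2 = m := by rw [← map_pow, ha.root_sq, map_intCast]
  have hB : ψ hb.root ^ 2 = n := by rw [← map_pow, hb.root_sq, map_intCast]
  have key : ∀ u : ℚ, (u = 1 ∨ u = -1 ∨ u = 2 ∨ u = -2) →
      u ≠ 0 ∧ ∀ p : ℕ, p.Prime → p ≠ 2 → ¬ (p : ℤ) ∣ m → ¬ (p : ℤ) ∣ n →
        UnramifiedAt a b (u * (t * x)) (u * (t * y)) p := by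
    intro u hu
    have hu0 : u ≠ 0 := by rcases hu with rfl | rfl | rfl | rfl <;> norm_num
    refine ⟨hu0, fun p hp hp2 hpm hpn => ?_⟩
    rw [unramifiedAt_smul_iff ha hb h1 hp hp2 hpm hpn (hodd p hp hp2 hpm hpn) hu0]
    obtain ⟨k, hk, hkp⟩ : ∃ k : ℤ, (k : ℚ) = u ∧ k ∣ 2 := by
      rcases hu with rfl | rfl | rfl | rfl
      exacts [⟨1, by norm_num⟩, ⟨-1, by norm_num⟩, ⟨2, by norm_num⟩, ⟨-2, by norm_num⟩]
    rw [← hk, padicValRat_intCast_eq_zero fun hd => hp2 ((Nat.prime_dvd_prime_iff_eq hp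
      Nat.prime_two).1 (by exact_mod_cast hd.trans hkp))]
    exact Even.zero
  obtain ⟨u, hu, hu'⟩ : ∃ u : ℚ, (u = 1 ∨ u = -1 ∨ u = 2 ∨ u = -2) ∧
      ((m % 4 = 1 ∧ n % 4 = 1) ∨ m % 8 = 1 ∨ n % 8 = 1 →
        UnrClass (IntermediateField.adjoin ℚ_[2] {φ ha.root, ψ hb.root})
          ((u * (t * x) : ℚ) + (u * (t * y) * r : ℚ) * φ ha.root)) ∧
      (m % 4 = 3 → n % 8 = 5 →
        CondTwoClass (φ ha.root) ((u * (t * x) : ℚ) + (u * (t * y) * r : ℚ) * φ ha.root)) ∧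
      (m % 8 = 5 → n % 4 = 3 →
        CondTwoClass (ψ hb.root)
          ((2 * (u * (t * x)) : ℚ) + (2 * (u * (t * z)) * s : ℚ) * ψ hb.root)) := by
    by_cases c2 : (m % 4 = 1 ∧ n % 4 = 1) ∨ m % 8 = 1 ∨ n % 8 = 1
    · obtain ⟨u, hu, hu'⟩ := exists_sign_unrClass_add hA hB (h1.normalized ha hb)
        (mul_ne_zero (h1.right_ne ha.not_isSquare) hb.ne_zero) hb.ne (by omega)
      exact ⟨u, hu, fun _ => by rw [cast_mul_add]; exact hu', by omega, by omega⟩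
    · by_cases c3 : m % 4 = 3 ∧ n % 8 = 5
      · rcases (h1.hasNormClass ha hb).condTwoClass_or hA c3.1 c3.2 with h2 | h2
        · exact ⟨1, Or.inl rfl, by omega, fun _ _ => by rw [cast_mul_add]; simpa using h2, by omega⟩
        · refine ⟨2, by norm_num, by omega, fun _ _ => ?_, by omega⟩
          rw [cast_mul_add]; exact_mod_cast h2
      · by_cases c4 : m % 8 = 5 ∧ n % 4 = 3
        · have e : ∀ u : ℚ, ((2 * (u * (t * x)) : ℚ) : PadicAlgCl 2)
              + (2 * (u * (t * z)) * s : ℚ) * ψ hb.root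
              = u * ((2 * (t * x) : ℚ) + (2 * (t * z) * s : ℚ) * ψ hb.root) := fun u => by
            push_cast; ring
          rcases (h1.swap.hasNormClass hb ha).condTwoClass_or hB c4.2 c4.1 with h2 | h2
          · exact ⟨1, Or.inl rfl, by omega, by omega, fun _ _ => by rw [e]; simpa using h2⟩
          · refine ⟨2, by norm_num, by omega, by omega, fun _ _ => ?_⟩
            rw [e]; exact_mod_cast h2
        · exact ⟨1, Or.inl rfl, fun h => absurd h c2, fun e1 e2 => absurd ⟨e1, e2⟩ c3,
            fun e1 e2 => absurd ⟨e1, e2⟩ c4⟩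
  obtain ⟨hu0, hodd'⟩ := key u hu
  refine ⟨u * t, mul_ne_zero hu0 ht, ?_⟩
  rw [mul_assoc, mul_assoc, minimallyRamified_iff ha hb (h1.smul hu0) φ ψ]
  exact ⟨hodd', hu'⟩

end

end

end Redei

/-! ### Twists: local conditions on t and the group T. -/

namespace Redei

noncomputable section

/-- The local conditions on `t` under which twisting by `t` preserves minimal ramification. -/
structure IsAdmissible (m n : ℤ) (A B : PadicAlgCl 2) (t : ℚ) : Prop where
  ne_zero : t ≠ 0
  odd : ∀ p : ℕ, p.Prime → p ≠ 2 → ¬ (p : ℤ) ∣ m → ¬ (p : ℤ) ∣ n → Even (padicValRat p t)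
  two : (m % 4 = 1 ∧ n % 4 = 1) ∨ m % 8 = 1 ∨ n % 8 = 1 →
    UnrClass (IntermediateField.adjoin ℚ_[2] {A, B}) (t : PadicAlgCl 2)
  left : m % 4 = 3 → n % 8 = 5 → CondTwoClass A (t : PadicAlgCl 2)
  right : m % 8 = 5 → n % 4 = 3 → CondTwoClass B (t : PadicAlgCl 2)

theorem condTwoClass_sq {A w : PadicAlgCl 2} (hw : w ∈ IntermediateField.adjoin ℚ_[2] {A})
    (hw0 : w ≠ 0) : CondTwoClass A (w ^ 2) :=
  ⟨w⁻¹, inv_mem hw, by rw [← mul_pow, inv_mul_cancel₀ hw0]; norm_num⟩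

namespace IsAdmissible

variable {m n : ℤ} {A B : PadicAlgCl 2} {t u : ℚ}

theorem symm (h : IsAdmissible m n A B t) : IsAdmissible n m B A t where
  ne_zero := h.ne_zero
  odd p hp hp2 h1 h2 := h.odd p hp hp2 h2 h1
  two h1 := by rw [Set.pair_comm]; exact h.two (by tauto)
  left h1 h2 := h.right h2 h1
  right h1 h2 := h.left h2 h1

theorem mul (h : IsAdmissible m n A B t) (h' : IsAdmissible m n A B u) :
    IsAdmissible m n A B (t * u) where
  ne_zero := mul_ne_zero h.ne_zero h'.ne_zero
  odd p hp hp2 h1 h2 := by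
    have : Fact p.Prime := ⟨hp⟩
    rw [padicValRat.mul h.ne_zero h'.ne_zero]
    exact (h.odd p hp hp2 h1 h2).add (h'.odd p hp hp2 h1 h2)
  two h1 := by rw [Rat.cast_mul]; exact (h.two h1).mul (h'.two h1)
  left h1 h2 := by rw [Rat.cast_mul]; exact (h.left h1 h2).mul (h'.left h1 h2)
  right h1 h2 := by rw [Rat.cast_mul]; exact (h.right h1 h2).mul (h'.right h1 h2)

theorem sq (ht : t ≠ 0) : IsAdmissible m n A B (t ^ 2) where
  ne_zero := pow_ne_zero 2 ht
  odd p hp hp2 h1 h2 := by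
    have : Fact p.Prime := ⟨hp⟩
    rw [pow_two, padicValRat.mul ht ht]
    exact ⟨_, rfl⟩
  two h1 := by
    rw [Rat.cast_pow]
    exact UnrClass.sq (SubfieldClass.ratCast_mem _ t) (by exact_mod_cast ht)
  left h1 h2 := by
    rw [Rat.cast_pow]
    exact condTwoClass_sq (SubfieldClass.ratCast_mem _ t) (by exact_mod_cast ht)
  right h1 h2 := by
    rw [Rat.cast_pow]
    exact condTwoClass_sq (SubfieldClass.ratCast_mem _ t) (by exact_mod_cast ht)

theorem of_mul_sq (hu : u ≠ 0) (h : IsAdmissible m n A B (t * u ^ 2)) :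
    IsAdmissible m n A B t := by
  have := h.mul (sq (inv_ne_zero hu))
  rwa [mul_assoc, ← mul_pow, mul_inv_cancel₀ hu, one_pow, mul_one] at this

theorem one : IsAdmissible m n A B 1 := by
  simpa using sq (m := m) (n := n) (A := A) (B := B) (t := 1) one_ne_zero

/-- Integers `≡ 1 mod 4` are admissible if their prime factors divide `mn`. -/
theorem intCast {k : ℤ} (hk : k % 4 = 1)
    (h : ∀ p : ℕ, p.Prime → p ≠ 2 → (p : ℤ) ∣ k → (p : ℤ) ∣ m ∨ (p : ℤ) ∣ n) :
    IsAdmissible m n A B k where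
  ne_zero := by rw [Int.cast_ne_zero]; omega
  odd p hp hp2 h1 h2 := by
    rw [padicValRat_intCast_eq_zero fun hd => (h p hp hp2 hd).elim h1 h2]
    exact Even.zero
  two _ := by rw [Rat.cast_intCast]; exact unrClass_intCast _ hk
  left _ _ := by rw [Rat.cast_intCast]; exact condTwoClass_intCast hk
  right _ _ := by rw [Rat.cast_intCast]; exact condTwoClass_intCast hk

theorem signedPrime_of_dvd {p : ℕ} (hp : p.Prime) (hp2 : p ≠ 2) (h : (p : ℤ) ∣ m ∨ (p : ℤ) ∣ n) :
    IsAdmissible m n A B (signedPrime p) := by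
  refine intCast (signedPrime_emod_four hp hp2) fun q hq _ hd => ?_
  rw [Int.natCast_dvd, natAbs_signedPrime] at hd
  rwa [(Nat.prime_dvd_prime_iff_eq hq hp).1 hd]

theorem of_even (hm : m % 4 ≠ 1) (hn : n % 4 ≠ 1) {k : ℤ} (hk : k = -1 ∨ k = 2) :
    IsAdmissible m n A B k where
  ne_zero := by rcases hk with rfl | rfl <;> norm_num
  odd p hp hp2 h1 h2 := by
    rw [padicValRat_intCast_eq_zero fun hd => hp2 ((Nat.prime_dvd_prime_iff_eq hp
      Nat.prime_two).1 (by
        have : k ∣ 2 := by rcases hk with rfl | rfl <;> norm_num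
        exact_mod_cast hd.trans this))]
    exact Even.zero
  two h := by omega
  left h1 h2 := by omega
  right h1 h2 := by omega

/-- There is an integer k ≡ 1 mod 4 with k t_a = 4m = (2A)², so t_a has the class of k over a field
containing A. For the conductor conditions t_a is -4 or 1, and -1 = A²(-1/m) is harmless when m ≡ 3
mod 4. -/
theorem twoPart_disc {a r : ℚ} (ha : IsSquarefreePart a m r) (hA : A ^ 2 = m) :
    IsAdmissible m n A B (twoPart (disc a)) := by
  have h8 : twoPart (disc a) ∣ 8 := by
    rcases ha.twoPart_cases with ⟨-, h⟩ | ⟨-, h⟩ | ⟨-, h⟩ | ⟨-, h⟩ <;> rw [h] <;> norm_num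
  have h0 : twoPart (disc a) ≠ 0 := by
    intro h; rw [h] at h8; norm_num at h8
  have hA0 : A ≠ 0 := by
    rintro rfl
    rw [zero_pow two_ne_zero] at hA
    exact ha.ne (by exact_mod_cast hA.symm)
  have hAL : A ∈ IntermediateField.adjoin ℚ_[2] {A, B} :=
    IntermediateField.subset_adjoin _ _ (by simp)
  refine ⟨by exact_mod_cast h0, fun p hp hp2 _ _ => ?_, fun _ => ?_, fun h1 _ => ?_, fun h1 _ => ?_⟩
  · rw [padicValRat_intCast_eq_zero fun hd => hp2 ((Nat.prime_dvd_prime_iff_eq hp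
      Nat.prime_two).1 (hp.dvd_of_dvd_pow (n := 3) (by exact_mod_cast hd.trans h8)))]
    exact Even.zero
  · rw [Rat.cast_intCast]
    have key : ∀ k : ℤ, k % 4 = 1 → k * twoPart (disc a) = 4 * m →
        UnrClass (IntermediateField.adjoin ℚ_[2] {A, B}) (twoPart (disc a) : PadicAlgCl 2) := by
      intro k hk e
      refine (unrClass_intCast _ hk).of_mul_eq_sq (intCast_mem _ k)
        (mul_mem (ofNat_mem _ 2) hAL) (mul_ne_zero two_ne_zero hA0) ?_
      rw [mul_pow, hA]
      rw [← Int.cast_mul, e, Int.cast_mul, Int.cast_ofNat]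
      ring
    rcases ha.twoPart_cases with ⟨h1, h⟩ | ⟨h1, h⟩ | ⟨h1, h⟩ | ⟨h1, h⟩
    · rw [h]; exact unrClass_intCast _ rfl
    · exact key (-m) (by omega) (by rw [h]; ring)
    · exact key (m / 2) (by omega) (by rw [h]; omega)
    · exact key (-(m / 2)) (by omega) (by rw [h]; omega)
  · have h : twoPart (disc a) = -4 := by rcases ha.twoPart_cases with h | h | h | h <;> omega
    have := (condTwoClass_neg_one hA h1).mul
      (condTwoClass_sq (A := A) (w := 2) (ofNat_mem _ 2) two_ne_zero)
    rw [h]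
    norm_num at this ⊢
    exact this
  · have h : twoPart (disc a) = 1 := by rcases ha.twoPart_cases with h | h | h | h <;> omega
    rw [h, Rat.cast_intCast]
    exact condTwoClass_intCast rfl

end IsAdmissible

/-- Otherwise θ and 2θ would both have conductor dividing 2: the first makes all units ≡ 1 mod 2
norms from the extension defined by θ, the second yields one that is not. -/
theorem not_condTwoClass_two {a b : ℤ} {A θ : PadicAlgCl 2} (hA : A ^ 2 = a) (ha : a % 4 = 3)
    (hb : b % 8 = 5) (h : HasNormClass A a b θ) : ¬ CondTwoClass A 2 := by
  intro h2
  have key : CondTwoClass A θ ∧ CondTwoClass A (2 * θ) := by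
    rcases h.condTwoClass_or hA ha hb with h1 | h1
    · exact ⟨h1, h2.mul h1⟩
    · refine ⟨(h2.mul_iff (ofNat_mem _ 2)).1 (by rwa [mul_comm]), h1⟩
  obtain ⟨u, hu, hn⟩ := exists_not_isBiquadraticNorm_of_condTwoClass_two_mul
    (β := ⟨θ, h.mem⟩) hA ha hb h key.2
  exact hn (CondTwoClass.isBiquadraticNorm hA ha hb h key.1 hu)

/-- For n ≡ 1 mod 8 the root √n lies in ℚ₂ and the condition is one over the ramified field ℚ₂(√m).
For n ≡ 5 mod 8 solvability forces m ≡ 3 mod 4; there -1 is harmless and 2 is not, so ±2 are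
excluded. -/
theorem sign_eq_of_isAdmissible {m n : ℤ} {A B : PadicAlgCl 2} {x y z : ℚ} (hA : A ^ 2 = m)
    (hB : B ^ 2 = n) (h : x ^ 2 - m * y ^ 2 = n * z ^ 2) (hy : y ≠ 0) (hz : z ≠ 0)
    (hm0 : m % 4 ≠ 0) (hm : m % 4 ≠ 1) (hn : n % 4 = 1) {k : ℤ} (hk : k = -1 ∨ k = 2 ∨ k = -2)
    (hadm : IsAdmissible m n A B k) :
    (k = -1 ∧ m % 4 = 3) ∨ (k = 2 ∧ m % 8 = 2) ∨ (k = -2 ∧ m % 8 = 6) := by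
  rcases (by omega : n % 8 = 1 ∨ n % 8 = 5) with hn | hn
  · have h1 := hadm.two (by omega)
    rw [adjoin_pair_eq_of_right (exists_root_of_mod_eight hB hn), Rat.cast_intCast] at h1
    exact sign_of_unrClass_ramified hA (by omega) hk h1
  · rcases (by omega : m % 4 = 2 ∨ m % 4 = 3) with hm | hm
    · exact (not_solution_of_mod hm hn h hy).elim
    · have h1 := hadm.left hm hn
      have h2 : HasNormClass A m n (x + y * A) := by
        refine ⟨x, y, z, ?_, by exact_mod_cast hz, ?_⟩
        · rw [map_ratCast, map_ratCast]
        · have := congrArg (Rat.cast : ℚ → ℚ_[2]) h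
          push_cast at this
          exact this
      have h3 := not_condTwoClass_two hA hm hn h2
      rcases hk with rfl | rfl | rfl
      · exact Or.inl ⟨rfl, hm⟩
      · exact absurd (by simpa using h1) h3
      · have := (condTwoClass_neg_one hA hm).mul h1
        exact absurd (by simpa using this) h3

/-- The class of the rational number `q` lies in the twisting subgroup. -/
def InTwistingSubgroup (a b q : ℚ) : Prop :=
  ∃ u : ℚˣ, (u : ℚ) = q ∧ (u : SqClass) ∈ twistingSubgroup a b

namespace InTwistingSubgroup

variable {a b q q' : ℚ}

theorem units_iff {t : ℚˣ} :
    InTwistingSubgroup a b t ↔ (t : SqClass) ∈ twistingSubgroup a b :=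
  ⟨fun ⟨u, hu, h⟩ => by rwa [← Units.ext hu], fun h => ⟨t, rfl, h⟩⟩

theorem mul (h : InTwistingSubgroup a b q) (h' : InTwistingSubgroup a b q') :
    InTwistingSubgroup a b (q * q') := by
  obtain ⟨u, rfl, hu⟩ := h
  obtain ⟨v, rfl, hv⟩ := h'
  exact ⟨u * v, by simp, by rw [QuotientGroup.mk_mul]; exact mul_mem hu hv⟩

theorem sq (hq : q ≠ 0) : InTwistingSubgroup a b (q ^ 2) :=
  ⟨Units.mk0 q hq ^ 2, by simp, by
    rw [sqClass_eq_one_iff.2 ⟨q, by simp [_root_.sq]⟩]; exact one_mem _⟩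

theorem one : InTwistingSubgroup a b 1 := by
  simpa using sq (a := a) (b := b) (q := 1) one_ne_zero

theorem of_mul_sq (hq : q' ≠ 0) (h : InTwistingSubgroup a b (q * q' ^ 2)) :
    InTwistingSubgroup a b q := by
  have := h.mul (sq (inv_ne_zero hq))
  rwa [mul_assoc, ← mul_pow, mul_inv_cancel₀ hq, one_pow, mul_one] at this

theorem of_generator (hq : q ≠ 0)
    (h : (∃ p : ℕ, p.Prime ∧ p ≠ 2 ∧ (p : ℤ) ∣ disc a * disc b ∧ q = signedPrime p) ∨
      q = twoPart (disc a) ∨ q = twoPart (disc b) ∨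
      (Even (disc a) ∧ Even (disc b) ∧ (q = -1 ∨ q = 2))) : InTwistingSubgroup a b q :=
  ⟨Units.mk0 q hq, rfl, Subgroup.subset_closure ⟨Units.mk0 q hq, rfl, h⟩⟩

end InTwistingSubgroup

section

variable {a b x y z r s : ℚ} {m n : ℤ} {A B : PadicAlgCl 2}

theorem dvd_disc_mul_disc_iff (ha : IsSquarefreePart a m r) (hb : IsSquarefreePart b n s) {p : ℕ}
    (hp : p.Prime) (hp2 : p ≠ 2) :
    (p : ℤ) ∣ disc a * disc b ↔ (p : ℤ) ∣ m ∨ (p : ℤ) ∣ n := by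
  rw [(Nat.prime_iff_prime_int.1 hp).dvd_mul, ha.dvd_disc_iff hp hp2, hb.dvd_disc_iff hp hp2]

/-- Admissibility depends only on the square class and is multiplicative, so the generators suffice.
-/
theorem isAdmissible_of_mem (ha : IsSquarefreePart a m r) (hb : IsSquarefreePart b n s)
    (hA : A ^ 2 = m) (hB : B ^ 2 = n) {c : SqClass} (hc : c ∈ twistingSubgroup a b) :
    ∀ u : ℚˣ, (u : SqClass) = c → IsAdmissible m n A B u := by
  have key : ∀ u v : ℚˣ, (u : SqClass) = v → IsAdmissible m n A B u → IsAdmissible m n A B v := by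
    intro u v huv hu
    have h1 : ((u⁻¹ * v : ℚˣ) : SqClass) = 1 := by
      rw [QuotientGroup.mk_mul, QuotientGroup.mk_inv, huv, inv_mul_cancel]
    obtain ⟨w, hw⟩ := sqClass_eq_one_iff.1 h1
    have hv : (v : ℚ) = u * w ^ 2 := by
      rw [sq, ← hw]; simp
    have hw0 : w ≠ 0 := by
      rintro rfl
      rw [zero_pow two_ne_zero, mul_zero] at hv
      exact v.ne_zero hv
    rw [hv]
    exact hu.mul (IsAdmissible.sq hw0)
  induction hc using Subgroup.closure_induction with
  | mem c hc =>
    obtain ⟨v, rfl, h⟩ := hc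
    intro u hu
    refine key v u hu.symm ?_
    rcases h with ⟨p, hp, hp2, hd, h⟩ | h | h | ⟨h1, h2, h⟩
    · rw [h]
      exact IsAdmissible.signedPrime_of_dvd hp hp2 ((dvd_disc_mul_disc_iff ha hb hp hp2).1 hd)
    · rw [h]; exact IsAdmissible.twoPart_disc ha hA
    · rw [h]; exact (IsAdmissible.twoPart_disc hb hB).symm
    · rw [ha.even_disc_iff] at h1
      rw [hb.even_disc_iff] at h2
      rcases h with h | h
      · rw [h]; exact_mod_cast IsAdmissible.of_even h1 h2 (Or.inl rfl)
      · rw [h]; exact_mod_cast IsAdmissible.of_even h1 h2 (Or.inr rfl)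
  | one => exact fun u hu => key 1 u hu.symm (by simpa using IsAdmissible.one)
  | mul c d _ _ hc hd =>
    intro u hu
    obtain ⟨v, rfl⟩ := QuotientGroup.mk_surjective c
    have h1 := hd (v⁻¹ * u) (by rw [QuotientGroup.mk_mul, QuotientGroup.mk_inv, hu]; group)
    have := (hc v rfl).mul h1
    rwa [← Units.val_mul, mul_inv_cancel_left] at this
  | inv c _ hc =>
    intro u hu
    have h1 := hc u⁻¹ (by rw [QuotientGroup.mk_inv, hu, inv_inv])
    have := h1.mul (IsAdmissible.sq u.ne_zero)
    rwa [Units.val_inv_eq_inv_val, sq, inv_mul_cancel_left₀ u.ne_zero] at this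

theorem inTwistingSubgroup_prod (ha : IsSquarefreePart a m r) (hb : IsSquarefreePart b n s)
    {S : Finset ℕ} (hS : ∀ p ∈ S, p.Prime ∧ p ≠ 2 ∧ ((p : ℤ) ∣ m ∨ (p : ℤ) ∣ n)) :
    InTwistingSubgroup a b ((∏ p ∈ S, signedPrime p : ℤ) : ℚ) := by
  refine Finset.prod_induction (p := fun k : ℤ => InTwistingSubgroup a b k) _
    (fun k l hk hl => by rw [Int.cast_mul]; exact hk.mul hl) (by simpa using InTwistingSubgroup.one)
    fun p hp => ?_
  obtain ⟨hp, hp2, hd⟩ := hS p hp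
  refine InTwistingSubgroup.of_generator ?_
    (Or.inl ⟨p, hp, hp2, (dvd_disc_mul_disc_iff ha hb hp hp2).2 hd, rfl⟩)
  rw [Int.cast_ne_zero]
  have := signedPrime_emod_four hp hp2
  omega

/-- In these three cases 4k is the 2-part of Δ(a). -/
theorem inTwistingSubgroup_sign_left (ha : IsSquarefreePart a m r) {k : ℤ}
    (h : (k = -1 ∧ m % 4 = 3) ∨ (k = 2 ∧ m % 8 = 2) ∨ (k = -2 ∧ m % 8 = 6)) :
    InTwistingSubgroup a b k ∧ InTwistingSubgroup b a k := by
  have h1 : ((k : ℤ) : ℚ) * 2 ^ 2 = twoPart (disc a) := by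
    have : k * 2 ^ 2 = twoPart (disc a) := by
      rcases ha.twoPart_cases with h' | h' | h' | h' <;> omega
    exact_mod_cast this
  have h0 : ((k : ℤ) : ℚ) * 2 ^ 2 ≠ 0 := by
    have : k ≠ 0 := by omega
    exact mul_ne_zero (by exact_mod_cast this) (by norm_num)
  exact ⟨.of_mul_sq (q' := 2) two_ne_zero (.of_generator h0 (Or.inr (Or.inl h1))),
    .of_mul_sq (q' := 2) two_ne_zero (.of_generator h0 (Or.inr (Or.inr (Or.inl h1))))⟩

/-- If m and n are both ≡ 1 mod 4, then L is unramified over ℚ₂ and only k = 1 survives. If exactly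
one of them is, a surviving k ≠ 1 is, up to the factor 4, the 2-part belonging to the other. If
neither is, then -1 and 2 are generators. -/
theorem inTwistingSubgroup_sign (ha : IsSquarefreePart a m r) (hb : IsSquarefreePart b n s)
    (hA : A ^ 2 = m) (hB : B ^ 2 = n) (h : IsNonzeroSolution a b x y z) {k : ℤ}
    (hk : k = 1 ∨ k = -1 ∨ k = 2 ∨ k = -2) (hadm : IsAdmissible m n A B k) :
    InTwistingSubgroup a b k := by
  have hz := mul_ne_zero (h.right_ne ha.not_isSquare) hb.ne_zero
  have hy := mul_ne_zero (h.left_ne hb.not_isSquare) ha.ne_zero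
  have hsol := h.normalized ha hb
  rcases hk with rfl | hk
  · simpa using InTwistingSubgroup.one
  by_cases hm : m % 4 = 1 <;> by_cases hn : n % 4 = 1
  · have h1 := hadm.two (Or.inl ⟨hm, hn⟩)
    obtain ⟨hA1, hA4⟩ := norm_odd_sub_one hA hm
    obtain ⟨hB1, hB4⟩ := norm_odd_sub_one hB hn
    have hval := hasIntVal_pair (a := m) (b := n) (by rw [hA, Rat.cast_intCast])
      (by rw [hB, Rat.cast_intCast]) hA1 hA4 hB1 hB4
    exact absurd h1 (not_unrClass_of_hasIntVal hval (by
      rcases hk with rfl | rfl | rfl <;> norm_num))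
  · exact (inTwistingSubgroup_sign_left hb (sign_eq_of_isAdmissible (x := x) (y := z * s)
      (z := y * r) hB hA (by linear_combination hsol) hz hy hb.emod_four_ne hn hm hk hadm.symm)).2
  · exact (inTwistingSubgroup_sign_left ha (sign_eq_of_isAdmissible hA hB hsol hy hz
      ha.emod_four_ne hm hn hk hadm)).1
  · have he := ha.even_disc_iff.2 hm
    have he' := hb.even_disc_iff.2 hn
    have h1 : InTwistingSubgroup a b (-1) :=
      .of_generator (by norm_num) (Or.inr (Or.inr (Or.inr ⟨he, he', Or.inl rfl⟩)))
    have h2 : InTwistingSubgroup a b 2 :=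
      .of_generator (by norm_num) (Or.inr (Or.inr (Or.inr ⟨he, he', Or.inr rfl⟩)))
    rcases hk with rfl | rfl | rfl
    · simpa using h1
    · simpa using h2
    · simpa using h1.mul h2

/-- Even valuations away from 2mn leave only primes dividing 2mn in the squarefree part c of t, so c
= σ∏p* with σ in {±1, ±2}. The product is admissible and lies in T, hence σ is admissible and the
statement reduces to it. -/
theorem inTwistingSubgroup_of_isAdmissible (ha : IsSquarefreePart a m r)
    (hb : IsSquarefreePart b n s) (hA : A ^ 2 = m) (hB : B ^ 2 = n)
    (h : IsNonzeroSolution a b x y z) {t : ℚˣ} (hadm : IsAdmissible m n A B t) :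
    InTwistingSubgroup a b t := by
  obtain ⟨c, q, hc, hq, ht⟩ := exists_squarefree_mul_sq t
  rw [ht] at hadm ⊢
  replace hadm := hadm.of_mul_sq hq
  refine InTwistingSubgroup.mul ?_ (InTwistingSubgroup.sq hq)
  have hc0 := hc.ne_zero
  have hdvd : ∀ p : ℕ, p.Prime → p ≠ 2 → (p : ℤ) ∣ c → (p : ℤ) ∣ m ∨ (p : ℤ) ∣ n := by
    intro p hp hp2 hpc
    by_contra hne
    push Not at hne
    have : Fact p.Prime := ⟨hp⟩
    have h1 := hadm.odd p hp hp2 hne.1 hne.2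
    obtain ⟨d, rfl⟩ := hpc
    have hpd : ¬ (p : ℤ) ∣ d := fun ⟨e, he⟩ => by
      have := hc p ⟨e, by rw [he]; ring⟩
      exact (Nat.prime_iff_prime_int.1 hp).not_isUnit this
    have hd0 : (d : ℚ) ≠ 0 := by
      rintro hd0
      exact hpd (by rw [Int.cast_eq_zero.1 hd0]; exact dvd_zero _)
    rw [Int.cast_mul, Int.cast_natCast, padicValRat.mul (by exact_mod_cast hp.ne_zero) hd0,
      padicValRat_intCast_eq_zero hpd, padicValRat.self hp.one_lt] at h1
    exact absurd h1 (by decide)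
  obtain ⟨e, k, hek, he, hk⟩ : ∃ e k : ℤ, c = e * k ∧ (e = 1 ∨ e = 2) ∧ k % 2 = 1 := by
    rcases Int.emod_two_eq_zero_or_one c with h2 | h2
    · refine ⟨2, c / 2, by omega, Or.inr rfl, ?_⟩
      by_contra h3
      exact not_four_dvd_of_squarefree hc (by omega)
    · exact ⟨1, c, by ring, Or.inl rfl, h2⟩
  have hksq : Squarefree k := hc.squarefree_of_dvd ⟨e, by rw [hek]; ring⟩
  set P : ℤ := ∏ p ∈ k.natAbs.primeFactors, signedPrime p with hP
  have hS : ∀ p ∈ k.natAbs.primeFactors, p.Prime ∧ p ≠ 2 ∧ ((p : ℤ) ∣ m ∨ (p : ℤ) ∣ n) := by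
    intro p hp
    have hpk := Int.natCast_dvd.2 (Nat.dvd_of_mem_primeFactors hp)
    have hpp := Nat.prime_of_mem_primeFactors hp
    have hp2 : p ≠ 2 := by
      rintro rfl
      push_cast at hpk
      omega
    exact ⟨hpp, hp2, hdvd p hpp hp2 (hpk.trans ⟨e, by rw [hek]; ring⟩)⟩
  have hPT := inTwistingSubgroup_prod ha hb hS
  have hP4 : P % 4 = 1 := prod_signedPrime_emod_four fun p hp => ⟨(hS p hp).1, (hS p hp).2.1⟩
  have hPk : P = k ∨ P = -k := by
    rw [hP, prod_signedPrime_eq hksq hk]; split_ifs <;> simp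
  have hPadm : IsAdmissible m n A B P := IsAdmissible.intCast hP4 fun p hp hp2 hd =>
    hdvd p hp hp2 (hd.trans (by
      rw [hek]
      rcases hPk with h | h <;> rw [h]
      · exact dvd_mul_left _ _
      · exact (neg_dvd.2 (dvd_mul_left _ _))))
  obtain ⟨σ, hσ, hcσ⟩ : ∃ σ : ℤ, (σ = 1 ∨ σ = -1 ∨ σ = 2 ∨ σ = -2) ∧ c = σ * P := by
    rcases hPk with h | h
    · exact ⟨e, by tauto, by rw [hek, h]⟩
    · exact ⟨-e, by omega, by rw [hek, h]; ring⟩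
  have hP0 : (P : ℚ) ≠ 0 := by rw [Int.cast_ne_zero]; omega
  rw [hcσ, Int.cast_mul] at hadm ⊢
  refine InTwistingSubgroup.mul (inTwistingSubgroup_sign ha hb hA hB h hσ ?_) hPT
  have := hadm.mul hPadm
  rw [mul_assoc, ← sq] at this
  exact this.of_mul_sq hP0

theorem minimallyRamified_smul_iff (ha : IsSquarefreePart a m r) (hb : IsSquarefreePart b n s)
    (h : IsNonzeroSolution a b x y z) (hmr : MinimallyRamified a b x y)
    (φ : quadField a →+* PadicAlgCl 2) (ψ : quadField b →+* PadicAlgCl 2) {t : ℚ} (ht : t ≠ 0) :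
    MinimallyRamified a b (t * x) (t * y) ↔ IsAdmissible m n (φ ha.root) (ψ hb.root) t := by
  rw [minimallyRamified_iff ha hb h φ ψ] at hmr
  rw [minimallyRamified_iff ha hb (h.smul ht) φ ψ]
  obtain ⟨c1, c2, c3, c4⟩ := hmr
  have e : ((2 * (t * x) : ℚ) : PadicAlgCl 2) + (2 * (t * z) * s : ℚ) * ψ hb.root
      = t * ((2 * x : ℚ) + (2 * z * s : ℚ) * ψ hb.root) := by
    push_cast; ring
  rw [cast_mul_add, e]
  have h1 : ∀ p : ℕ, p.Prime → p ≠ 2 → ¬ (p : ℤ) ∣ m → ¬ (p : ℤ) ∣ n →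
      (UnramifiedAt a b (t * x) (t * y) p ↔ Even (padicValRat p t)) := fun p hp hp2 hpm hpn =>
    unramifiedAt_smul_iff ha hb h hp hp2 hpm hpn (c1 p hp hp2 hpm hpn) ht
  have h2 := fun hc => (c2 hc).mul_iff (β' := (t : PadicAlgCl 2))
    (add_mul_mem _ _ (IntermediateField.subset_adjoin _ _ (by simp)))
  have h3 := fun e1 e2 => (c3 e1 e2).mul_iff (β' := (t : PadicAlgCl 2))
    (add_mul_mem _ _ (IntermediateField.subset_adjoin _ _ rfl))
  have h4 := fun e1 e2 => (c4 e1 e2).mul_iff (β' := (t : PadicAlgCl 2))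
    (add_mul_mem _ _ (IntermediateField.subset_adjoin _ _ rfl))
  constructor
  · rintro ⟨d1, d2, d3, d4⟩
    exact ⟨ht, fun p hp hp2 hpm hpn => (h1 p hp hp2 hpm hpn).1 (d1 p hp hp2 hpm hpn),
      fun hc => (h2 hc).1 (d2 hc), fun e1 e2 => (h3 e1 e2).1 (d3 e1 e2),
      fun e1 e2 => (h4 e1 e2).1 (d4 e1 e2)⟩
  · rintro ⟨-, d1, d2, d3, d4⟩
    exact ⟨fun p hp hp2 hpm hpn => (h1 p hp hp2 hpm hpn).2 (d1 p hp hp2 hpm hpn),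
      fun hc => (h2 hc).2 (d2 hc), fun e1 e2 => (h3 e1 e2).2 (d3 e1 e2),
      fun e1 e2 => (h4 e1 e2).2 (d4 e1 e2)⟩

end

end

end Redei

theorem mainTheorem8 (a b : ℚˣ)
    (ha : (a : Redei.SqClass) ≠ 1) (hb : (b : Redei.SqClass) ≠ 1)
    (hab : ∃ x y z : ℚ, Redei.IsNonzeroSolution a b x y z) :
    (∃ x y z : ℚ, Redei.IsNonzeroSolution a b x y z ∧ Redei.MinimallyRamified a b x y) ∧
    ∀ x y z : ℚ, Redei.IsNonzeroSolution a b x y z → Redei.MinimallyRamified a b x y →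
      ∀ t : ℚˣ, Redei.MinimallyRamified a b (t * x) (t * y) ↔
        (t : Redei.SqClass) ∈ Redei.twistingSubgroup a b := by
  obtain ⟨m, r, ha⟩ := Redei.exists_isSquarefreePart ha
  obtain ⟨n, s, hb⟩ := Redei.exists_isSquarefreePart hb
  constructor
  · obtain ⟨x, y, z, h⟩ := hab
    obtain ⟨t, ht, hmr⟩ := Redei.exists_minimallyRamified ha hb h
    exact ⟨t * x, t * y, t * z, h.smul ht, hmr⟩
  · intro x y z h hmr t
    obtain ⟨φ⟩ : Nonempty (Redei.quadField a →ₐ[ℚ] PadicAlgCl 2) := ⟨IsAlgClosed.lift⟩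
    obtain ⟨ψ⟩ : Nonempty (Redei.quadField b →ₐ[ℚ] PadicAlgCl 2) := ⟨IsAlgClosed.lift⟩
    have hA : φ ha.root ^ 2 = m := by rw [← map_pow, ha.root_sq, map_intCast]
    have hB : ψ hb.root ^ 2 = n := by rw [← map_pow, hb.root_sq, map_intCast]
    rw [Redei.minimallyRamified_smul_iff ha hb h hmr φ ψ t.ne_zero]
    exact ⟨fun hadm => Redei.InTwistingSubgroup.units_iff.1
      (Redei.inTwistingSubgroup_of_isAdmissible ha hb hA hB h hadm),
      fun ht => Redei.isAdmissible_of_mem ha hb hA hB ht t rfl⟩
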